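/- Work in second-order arithmetic, with real numbers, sequences of real numbers and continuous functions coded in the usual way. A \emph{Baire class 1 code} is a sequence $\langle f_n\rangle$ of codes of continuous functions $f_n\colon[0,1]\to\mathbb R$ such that for every $x\in[0,1]$ the sequence $\langle f_n(x)\rangle$ is Cauchy (neither a rate of convergence nor the existence of the limit $f(x)$ is required). It is a \emph{gauge} $\delta$ if $\delta(x)>0$ for all $x\in[0,1]$, i.e. there is $\varepsilon>0$ with $f_n(x)\ge\varepsilon$ for all but finitely many $n$; and $r\le\delta(x)$ means that for every $\varepsilon>0$, $r\le f_n(x)+\varepsilon$ for all but finitely many $n$. A \emph{$\delta$-fine cover} is a finite set $P\subseteq[0,1]$ with a function $p\mapsto r_p$ from $P$ to the positive reals such that $[0,1]\subseteq\bigcup_{p\in P}(p-r_p,p+r_p)$ and $r_p\le\delta(p)$ for all $p\in P$. A \emph{$\delta$-fine tagged partition} is a finite sequence $0=x_0\le\xi_0\le x_1\le\xi_1\le\dots\le\xi_{k-1}\le x_k=1$ with $x_{i+1}-x_i\le\delta(\xi_i)$ for all $i<k$. \emph{Cousin's lemma for Baire class 1 functions} is the statement that every Baire class 1 gauge $\delta$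 on $[0,1]$ has a $\delta$-fine cover. \textbf{Theorem.} Over $\mathsf{RCA}_0$ (that is, in every model of $\mathsf{RCA}_0$, possibly with a nonstandard first-order part), Cousin's lemma for Baire class 1 functions implies $\mathsf{ACA}_0$. Moreover, over $\mathsf{RCA}_0$: if $\langle z_n\rangle$ is a nondecreasing Cauchy sequence of real numbers in $[0,1]$ that has no limit, then the sequence of continuous functions $x\mapsto|x-z_n|$ on $[0,1]$ has a sequence of codes, and every such sequence of codes is a Baire class 1 code for a gauge $\delta$ for which there is no $\delta$-fine tagged partition. -/

import Mathlib

universe u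

/-! ## Structures for the language of second-order arithmetic -/

/-- A structure for the two-sorted language of second-order arithmetic: a set of numbers with
`0, 1, +, ·, <`, which may be nonstandard, and a nonempty collection of sets of numbers over which
the set variables range. -/
structure L2Structure where
  Num : Type u
  zero : Num
  one : Num
  add : Num → Num → Num
  mul : Num → Num → Num
  lt : Num → Num → Prop
  sets : Set (Set Num)
  sets_nonempty : sets.Nonempty

namespace L2Structure

instance (M : L2Structure.{u}) : Zero M.Num := ⟨M.zero⟩
instance (M : L2Structure.{u}) : One M.Num := ⟨M.one⟩
instance (M : L2Structure.{u}) : Add M.Num := ⟨M.add⟩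
instance (M : L2Structure.{u}) : Mul M.Num := ⟨M.mul⟩
instance (M : L2Structure.{u}) : LT M.Num := ⟨M.lt⟩
instance (M : L2Structure.{u}) : LE M.Num := ⟨fun a b => a < b ∨ a = b⟩

end L2Structure

/-! ## Arithmetical formulas -/

/-- Numerical terms; the number variables are de Bruijn indices. -/
inductive L2Term where
  | var (i : ℕ) : L2Term
  | zero : L2Term
  | one : L2Term
  | add (s t : L2Term) : L2Term
  | mul (s t : L2Term) : L2Term

/-- Arithmetical formulas (no set quantifiers): `mem t X` says that `t` belongs to the set variable
number `X`. Each of the four quantifiers binds the number variable `0` of its body; the bound `t`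
of a bounded quantifier is read outside of the scope of the quantifier. -/
inductive L2Formula where
  | eq (s t : L2Term) : L2Formula
  | lt (s t : L2Term) : L2Formula
  | mem (t : L2Term) (X : ℕ) : L2Formula
  | neg (φ : L2Formula) : L2Formula
  | and (φ ψ : L2Formula) : L2Formula
  | or (φ ψ : L2Formula) : L2Formula
  | ballLT (t : L2Term) (φ : L2Formula) : L2Formula
  | bexLT (t : L2Term) (φ : L2Formula) : L2Formula
  | all (φ : L2Formula) : L2Formula
  | ex (φ : L2Formula) : L2Formula

/-- Bounded quantifier formulas: all quantifiers are bounded (`Σ⁰₀`). -/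
def L2Formula.IsBounded : L2Formula → Prop
  | .eq _ _ => True
  | .lt _ _ => True
  | .mem _ _ => True
  | .neg φ => φ.IsBounded
  | .and φ ψ => φ.IsBounded ∧ ψ.IsBounded
  | .or φ ψ => φ.IsBounded ∧ ψ.IsBounded
  | .ballLT _ φ => φ.IsBounded
  | .bexLT _ φ => φ.IsBounded
  | .all _ => False
  | .ex _ => False

namespace L2Structure

/-- The assignment that gives the value `a` to variable `0` and shifts the assignment `e`. -/
def push {α : Type u} (a : α) (e : ℕ → α) : ℕ → α
  | 0 => a
  | i + 1 => e i

variable (M : L2Structure.{u})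

/-- The value of a term under an assignment of the number variables. -/
def val (e : ℕ → M.Num) : L2Term → M.Num
  | .var i => e i
  | .zero => 0
  | .one => 1
  | .add s t => val e s + val e t
  | .mul s t => val e s * val e t

/-- Satisfaction in `M`, under an assignment `V` of the set variables and an assignment of the
number variables. -/
def Sat (V : ℕ → M.sets) : L2Formula → (ℕ → M.Num) → Prop
  | .eq s t, e => M.val e s = M.val e t
  | .lt s t, e => M.val e s < M.val e t
  | .mem t X, e => M.val e t ∈ (V X : Set M.Num)
  | .neg φ, e => ¬ Sat V φ e
  | .and φ ψ, e => Sat V φ e ∧ Sat V ψ e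
  | .or φ ψ, e => Sat V φ e ∨ Sat V ψ e
  | .ballLT t φ, e => ∀ a : M.Num, a < M.val e t → Sat V φ (push a e)
  | .bexLT t φ, e => ∃ a : M.Num, a < M.val e t ∧ Sat V φ (push a e)
  | .all φ, e => ∀ a : M.Num, Sat V φ (push a e)
  | .ex φ, e => ∃ a : M.Num, Sat V φ (push a e)

/-! ## The systems `RCA₀` and `ACA₀` -/

/-- The basic axioms of second-order arithmetic. -/
structure IsBasic : Prop where
  succ_ne_zero : ∀ n : M.Num, n + 1 ≠ 0
  succ_inj : ∀ m n : M.Num, m + 1 = n + 1 → m = n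
  add_zero : ∀ m : M.Num, m + 0 = m
  add_succ : ∀ m n : M.Num, m + (n + 1) = (m + n) + 1
  mul_zero : ∀ m : M.Num, m * 0 = 0
  mul_succ : ∀ m n : M.Num, m * (n + 1) = m * n + m
  not_lt_zero : ∀ m : M.Num, ¬ m < 0
  lt_succ : ∀ m n : M.Num, m < n + 1 ↔ m < n ∨ m = n

/-- `M` is a model of `RCA₀`: the basic axioms, induction for `Σ⁰₁` formulas `∃ m, θ`, and
comprehension for `Δ⁰₁` formulas, with arbitrary number and set parameters. -/
structure IsRCA0 : Prop where
  basic : M.IsBasic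
  sigma_induction : ∀ θ : L2Formula, θ.IsBounded → ∀ (V : ℕ → M.sets) (e : ℕ → M.Num),
    M.Sat V (.ex θ) (push 0 e) →
    (∀ n : M.Num, M.Sat V (.ex θ) (push n e) → M.Sat V (.ex θ) (push (n + 1) e)) →
    ∀ n : M.Num, M.Sat V (.ex θ) (push n e)
  delta_comprehension : ∀ θ η : L2Formula, θ.IsBounded → η.IsBounded →
    ∀ (V : ℕ → M.sets) (e : ℕ → M.Num),
    (∀ n : M.Num, M.Sat V (.ex θ) (push n e) ↔ M.Sat V (.all η) (push n e)) →
    {n : M.Num | M.Sat V (.ex θ) (push n e)} ∈ M.sets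

/-- `M` is a model of `ACA₀`: the basic axioms, the induction axiom for sets, and comprehension for
all arithmetical formulas, with arbitrary number and set parameters. -/
structure IsACA0 : Prop where
  basic : M.IsBasic
  set_induction : ∀ X ∈ M.sets, (0 : M.Num) ∈ X → (∀ n : M.Num, n ∈ X → n + 1 ∈ X) →
    ∀ n : M.Num, n ∈ X
  arith_comprehension : ∀ (φ : L2Formula) (V : ℕ → M.sets) (e : ℕ → M.Num),
    {n : M.Num | M.Sat V φ (push n e)} ∈ M.sets

/-! ## Numbers, pairs, rationals -/

/-- The pairing function `(i, j) ↦ (i + j)² + i`. -/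
def pair (i j : M.Num) : M.Num := (i + j) * (i + j) + i

/-- `2 ^ k = m` in the sense of `M`: some function of `M` defined by the recursion for powers
of two takes the value `m` at `k`. -/
def TwoPow (k m : M.Num) : Prop :=
  ∃ p : M.Num → M.Num, Set.range (fun n => M.pair n (p n)) ∈ M.sets ∧
    p 0 = 1 ∧ (∀ i : M.Num, p (i + 1) = p i + p i) ∧ p k = m

/-- A representation of the rational number `(pos - neg) / (den + 1)` of `M`. Different
representations of one rational number are not identified. -/
structure RatCode where
  pos : M.Num
  neg : M.Num
  den : M.Num

namespace RatCode

variable {M}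

/-- The natural number that codes a representation of a rational number. -/
def code (p : M.RatCode) : M.Num := M.pair (M.pair p.pos p.neg) p.den

instance : Zero M.RatCode := ⟨⟨0, 0, 0⟩⟩
instance : One M.RatCode := ⟨⟨1, 0, 0⟩⟩

instance : LE M.RatCode := ⟨fun p q =>
  p.pos * (q.den + 1) + q.neg * (p.den + 1) ≤ q.pos * (p.den + 1) + p.neg * (q.den + 1)⟩

instance : LT M.RatCode := ⟨fun p q =>
  p.pos * (q.den + 1) + q.neg * (p.den + 1) < q.pos * (p.den + 1) + p.neg * (q.den + 1)⟩

/-- The denominator is `(p.den + 1) * (q.den + 1)`. -/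
instance : Add M.RatCode := ⟨fun p q =>
  ⟨p.pos * (q.den + 1) + q.pos * (p.den + 1), p.neg * (q.den + 1) + q.neg * (p.den + 1),
    p.den * q.den + p.den + q.den⟩⟩

instance : Neg M.RatCode := ⟨fun p => ⟨p.neg, p.pos, p.den⟩⟩
instance : Sub M.RatCode := ⟨fun p q => p + -q⟩

open Classical in
/-- The absolute value. -/
noncomputable def abs (p : M.RatCode) : M.RatCode := if p < 0 then -p else p

/-- The rational number `1 / (d + 1)`. -/
def inv (d : M.Num) : M.RatCode := ⟨1, 0, d⟩

end RatCode

/-! ## Real numbers and sequences of real numbers -/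

/-- A sequence of rationals, thought of as a name of a real number; it names a real number of `M`
if it satisfies `IsReal` below. -/
structure RealName where
  approx : M.Num → M.RatCode

namespace RealName

variable {M}

/-- Quick convergence: `|x_k - x_{k+i}| ≤ 2 ^ (-k)`. -/
def Rapid (x : M.RealName) : Prop :=
  ∀ k i d : M.Num, M.TwoPow k (d + 1) →
    (x.approx k - x.approx (k + i)).abs ≤ RatCode.inv d

/-- `x` is a real number of `M`: a quickly converging sequence of rationals that belongs to `M`. -/
def IsReal (x : M.RealName) : Prop :=
  Set.range (fun k => M.pair k (x.approx k).code) ∈ M.sets ∧ x.Rapid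

/-- A rational number as a real number. -/
def ofRat (q : M.RatCode) : M.RealName := ⟨fun _ => q⟩

instance : Zero M.RealName := ⟨ofRat 0⟩
instance : One M.RealName := ⟨ofRat 1⟩
instance : Add M.RealName := ⟨fun x y => ⟨fun k => x.approx (k + 1) + y.approx (k + 1)⟩⟩
instance : Neg M.RealName := ⟨fun x => ⟨fun k => -x.approx k⟩⟩
instance : Sub M.RealName := ⟨fun x y => x + -y⟩

/-- The absolute value. -/
noncomputable def abs (x : M.RealName) : M.RealName := ⟨fun k => (x.approx k).abs⟩

/-- `x ≤ y` if `x_k ≤ y_k + 2 * 2 ^ (-k)` for all `k`. -/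
instance : LE M.RealName := ⟨fun x y => ∀ k d : M.Num, M.TwoPow k (d + 1) →
  x.approx k ≤ y.approx k + (RatCode.inv d + RatCode.inv d)⟩

instance : LT M.RealName := ⟨fun x y => ¬ y ≤ x⟩

/-- Equality of real numbers. -/
def Equal (x y : M.RealName) : Prop := x ≤ y ∧ y ≤ x

/-- `x` is a point of the unit interval of `M`. -/
def InUnit (x : M.RealName) : Prop := x.IsReal ∧ 0 ≤ x ∧ x ≤ 1

end RealName

/-- `z` is a sequence of real numbers that belongs to `M`. -/
def IsRealSeq (z : M.Num → M.RealName) : Prop :=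
  Set.range (fun m : M.Num × M.Num => M.pair (M.pair m.1 m.2) ((z m.1).approx m.2).code) ∈ M.sets ∧
    ∀ n : M.Num, (z n).Rapid

variable {M} in
/-- The sequence `z` is Cauchy (no rate of convergence is required). -/
def IsCauchy (z : M.Num → M.RealName) : Prop :=
  ∀ ε : M.RatCode, 0 < ε → ∃ n₀ : M.Num, ∀ m n : M.Num, n₀ ≤ m → n₀ ≤ n →
    (z m - z n).abs ≤ RealName.ofRat ε

variable {M} in
/-- The sequence `z` converges to `x`. -/
def ConvergesTo (z : M.Num → M.RealName) (x : M.RealName) : Prop :=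
  ∀ ε : M.RatCode, 0 < ε → ∃ n₀ : M.Num, ∀ n : M.Num, n₀ ≤ n →
    (x - z n).abs ≤ RealName.ofRat ε

/-! ## Continuous functions on the unit interval -/

/-- The relation `(a, r) Φ (b, s)`: for some `n`, the tuple `(n, a, r, b, s)` is in `Φ`, where `a` is
a rational in the unit interval, `b` is a rational, and `r`, `s` are positive rationals. It says that
the function maps the open ball `B(a, r)` of the unit interval into the closed ball around `b` of
radius `s`. -/
def CodeRel (Φ : Set M.Num) (a r b s : M.RatCode) : Prop :=
  0 ≤ a ∧ a ≤ 1 ∧ 0 < r ∧ 0 < s ∧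
    ∃ n : M.Num, M.pair n (M.pair a.code (M.pair r.code (M.pair b.code s.code))) ∈ Φ

/-- `Φ` codes a continuous function from the unit interval to the reals. The last field says that the
function is defined at every point of the unit interval of `M`. -/
structure IsContinuousCode (Φ : Set M.Num) : Prop where
  consistent : ∀ a r b s b' s' : M.RatCode, M.CodeRel Φ a r b s → M.CodeRel Φ a r b' s' →
    (b - b').abs ≤ s + s'
  shrink : ∀ a r b s a' r' : M.RatCode, M.CodeRel Φ a r b s → 0 ≤ a' → a' ≤ 1 → 0 < r' →
    (a - a').abs + r' < r → M.CodeRel Φ a' r' b s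
  enlarge : ∀ a r b s b' s' : M.RatCode, M.CodeRel Φ a r b s → 0 < s' →
    (b - b').abs + s < s' → M.CodeRel Φ a r b' s'
  total : ∀ x : M.RealName, x.InUnit → ∀ ε : M.RatCode, 0 < ε →
    ∃ a r b s : M.RatCode, M.CodeRel Φ a r b s ∧
      (x - RealName.ofRat a).abs < RealName.ofRat r ∧ s < ε

/-- The value at `x` of the function coded by `Φ` is the real number `y`. -/
def IsValue (Φ : Set M.Num) (x y : M.RealName) : Prop :=
  ∀ a r b s : M.RatCode, M.CodeRel Φ a r b s →
    (x - RealName.ofRat a).abs < RealName.ofRat r →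
    (y - RealName.ofRat b).abs ≤ RealName.ofRat s

/-! ## Baire class 1 gauges and Cousin's lemma -/

/-- The `i`-th member of the sequence of sets coded by the set `F`. -/
def sect (F : Set M.Num) (i : M.Num) : Set M.Num := {m | M.pair i m ∈ F}

/-- If `F` codes a sequence of continuous functions `f_i`, then `y` is the sequence `f_i(x)`. -/
def IsValueSeq (F : Set M.Num) (x : M.RealName) (y : M.Num → M.RealName) : Prop :=
  M.IsRealSeq y ∧ ∀ i : M.Num, M.IsValue (M.sect F i) x (y i)

/-- `F` is a code of `M` for a Baire class 1 function on the unit interval: a sequence of codes of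
continuous functions `f_i` such that `f_i(x)` is a Cauchy sequence for each `x`. The limit is not
required to exist in `M`. -/
structure IsBaireOneCode (F : Set M.Num) : Prop where
  mem_sets : F ∈ M.sets
  continuous : ∀ i : M.Num, M.IsContinuousCode (M.sect F i)
  cauchy : ∀ x : M.RealName, x.InUnit → ∃ y : M.Num → M.RealName, M.IsValueSeq F x y ∧ IsCauchy y

/-- `δ(x) > 0`, where `δ` is the Baire class 1 function coded by `F`: for some `ε > 0`,
`f_i(x) ≥ ε` for all but finitely many `i`. -/
def LimPos (F : Set M.Num) (x : M.RealName) : Prop :=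
  ∃ y : M.Num → M.RealName, M.IsValueSeq F x y ∧
    ∃ ε : M.RatCode, 0 < ε ∧ ∃ n₀ : M.Num, ∀ n : M.Num, n₀ ≤ n → RealName.ofRat ε ≤ y n

/-- `r ≤ δ(x)`, where `δ` is the Baire class 1 function coded by `F`: for all `ε > 0`,
`r ≤ f_i(x) + ε` for all but finitely many `i`. -/
def LeLim (r : M.RealName) (F : Set M.Num) (x : M.RealName) : Prop :=
  ∃ y : M.Num → M.RealName, M.IsValueSeq F x y ∧
    ∀ ε : M.RatCode, 0 < ε → ∃ n₀ : M.Num, ∀ n : M.Num, n₀ ≤ n → r ≤ y n + RealName.ofRat ε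

/-- `F` is a code of `M` for a Baire class 1 gauge, that is, for a Baire class 1 function on the unit
interval with positive values. -/
def IsBaireOneGauge (F : Set M.Num) : Prop :=
  M.IsBaireOneCode F ∧ ∀ x : M.RealName, x.InUnit → M.LimPos F x

/-- There is in `M` a `δ`-fine cover for the gauge `δ` coded by `F`: finitely many (in the sense of
`M`) points `p_i` of the unit interval, `i < k`, with positive radii `r_i ≤ δ(p_i)` that depend only
on the point, such that the open balls `B(p_i, r_i)` cover the unit interval of `M`. -/
def HasFineCover (F : Set M.Num) : Prop :=
  ∃ (k : M.Num) (p r : M.Num → M.RealName), M.IsRealSeq p ∧ M.IsRealSeq r ∧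
    (∀ i : M.Num, i < k → (p i).InUnit ∧ 0 < r i ∧ M.LeLim (r i) F (p i)) ∧
    (∀ i j : M.Num, i < k → j < k → (p i).Equal (p j) → (r i).Equal (r j)) ∧
    ∀ x : M.RealName, x.InUnit → ∃ i : M.Num, i < k ∧ (x - p i).abs < r i

/-- There is in `M` a `δ`-fine tagged partition `0 = x_0 ≤ ξ_0 ≤ x_1 ≤ ξ_1 ≤ ⋯ ≤ x_k = 1` with
`x_{i+1} - x_i ≤ δ(ξ_i)` for all `i < k`, for the gauge `δ` coded by `F`. -/
def HasFinePartition (F : Set M.Num) : Prop :=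
  ∃ (k : M.Num) (x ξ : M.Num → M.RealName), M.IsRealSeq x ∧ M.IsRealSeq ξ ∧
    (x 0).Equal 0 ∧ (x k).Equal 1 ∧
    ∀ i : M.Num, i < k → x i ≤ ξ i ∧ ξ i ≤ x (i + 1) ∧ M.LeLim (x (i + 1) - x i) F (ξ i)

/-- Cousin's lemma for Baire class 1 functions (on the unit interval) holds in `M`. -/
def CousinBaireOne : Prop :=
  ∀ F : Set M.Num, M.IsBaireOneGauge F → M.HasFineCover F

/-- `F` is a code of `M` for the sequence of continuous functions `x ↦ |x - z_i|` on the unit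
interval. -/
def CodesDistances (z : M.Num → M.RealName) (F : Set M.Num) : Prop :=
  F ∈ M.sets ∧ ∀ i : M.Num, M.IsContinuousCode (M.sect F i) ∧
    ∀ x : M.RealName, x.InUnit → M.IsValue (M.sect F i) x (x - z i).abs

end L2Structure

/-! A nondecreasing Cauchy sequence `z` without a limit determines a cut of the reals of `M` that no
real fills. The functions `|x - z_n|` converge, in the Cauchy sense, to the distance from `x` to
this cut. The distance is positive at every real because no real is the limit, so it is a gauge. A
ball around `p` of radius `r ≤ δ(p)` cannot cross the cut (`LeLim.alternative`). If `p` lies below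
it, then `p + r` is also below: `p + r` is at most the missing limit and is not equal to it, so `p +
r < z_n` for some `n`. If `p` lies above it, then `z_n ≤ p - r` for all `n`.

Finitely many such balls do not cover. Strong Σ⁰₁ bounding, a consequence of Σ⁰₁ induction, gives
one `m` such that `z_m` exceeds the right end of every ball below the cut; the balls above the cut
miss all members of the sequence, so `z_m` is uncovered (`not_hasFineCover`). For a tagged
partition, Σ⁰₁ induction carries "`x_i` is below the cut" from `x_0 = 0` to `x_k = 1`, which is
absurd (`not_hasFinePartition`).

Cousin's lemma therefore makes every nondecreasing Cauchy sequence in the unit interval converge.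
Given a Σ⁰₁ predicate `P`, let `z_m` be the binary fraction whose digit `n`, for `n < m`, records
whether a witness for `P n` occurs below `m`. This sequence is nondecreasing, and it is Cauchy by
strong bounding. Its limit decides `P`: once `z_m` is within `2 ^ (-(n+1))` of the limit, digit `n`
can no longer change. So Σ⁰₁ comprehension holds (`sig_comprehension_of_limits`). It removes
unbounded quantifiers one at a time, which gives `ACA₀` (`isACA0_of_sig_comprehension`).

Two devices make this work in a possibly nonstandard model. Definability is handled semantically:
`Bdd`, `Sig`, `Del` and `Fn` are the predicates and functions that are bounded, Σ⁰₁, Δ⁰₁, or have a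
Σ⁰₁ graph, always with parameters, and formulas are replaced by closure lemmas. Real arithmetic
takes place in an actual ordered ring: the rationals of `M` form an ordered field, and a quickly
converging sequence has a value in the ring of bounded functions modulo null functions along an
ultrafilter. There, order and absolute value of real names become ordinary order and absolute value.
-/

set_option linter.unusedSectionVars false

namespace L2Structure

/-! ## Renaming of variables -/

/-- The renaming of number variables under a binder. -/
def liftRen (ρ : ℕ → ℕ) : ℕ → ℕ
  | 0 => 0
  | i + 1 => ρ i + 1

/-- Renaming of the number variables of a term. -/
def renTerm (ρ : ℕ → ℕ) : L2Term → L2Term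
  | .var i => .var (ρ i)
  | .zero => .zero
  | .one => .one
  | .add s t => .add (renTerm ρ s) (renTerm ρ t)
  | .mul s t => .mul (renTerm ρ s) (renTerm ρ t)

/-- Renaming of the set variables and of the free number variables of a formula. -/
def renFormula (σ : ℕ → ℕ) : (ℕ → ℕ) → L2Formula → L2Formula
  | ρ, .eq s t => .eq (renTerm ρ s) (renTerm ρ t)
  | ρ, .lt s t => .lt (renTerm ρ s) (renTerm ρ t)
  | ρ, .mem t X => .mem (renTerm ρ t) (σ X)
  | ρ, .neg φ => .neg (renFormula σ ρ φ)
  | ρ, .and φ ψ => .and (renFormula σ ρ φ) (renFormula σ ρ ψ)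
  | ρ, .or φ ψ => .or (renFormula σ ρ φ) (renFormula σ ρ ψ)
  | ρ, .ballLT t φ => .ballLT (renTerm ρ t) (renFormula σ (liftRen ρ) φ)
  | ρ, .bexLT t φ => .bexLT (renTerm ρ t) (renFormula σ (liftRen ρ) φ)
  | ρ, .all φ => .all (renFormula σ (liftRen ρ) φ)
  | ρ, .ex φ => .ex (renFormula σ (liftRen ρ) φ)

variable {M : L2Structure.{u}}

theorem push_comp_liftRen {β : Type u} (a : β) (e : ℕ → β) (ρ : ℕ → ℕ) :
    push a e ∘ liftRen ρ = push a (e ∘ ρ) := by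
  funext i; cases i <;> rfl

theorem val_renTerm (ρ : ℕ → ℕ) (e : ℕ → M.Num) (t : L2Term) :
    M.val e (renTerm ρ t) = M.val (e ∘ ρ) t := by
  induction t <;> simp_all [renTerm, val]

theorem isBounded_renFormula (σ : ℕ → ℕ) (φ : L2Formula) (ρ : ℕ → ℕ) (h : φ.IsBounded) :
    (renFormula σ ρ φ).IsBounded := by
  induction φ generalizing ρ <;> simp_all [renFormula, L2Formula.IsBounded]

theorem sat_renFormula (σ : ℕ → ℕ) (V : ℕ → M.sets) (φ : L2Formula) (ρ : ℕ → ℕ) (e : ℕ → M.Num) :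
    M.Sat V (renFormula σ ρ φ) e ↔ M.Sat (V ∘ σ) φ (e ∘ ρ) := by
  induction φ generalizing ρ e <;>
    simp_all [renFormula, Sat, val_renTerm, push_comp_liftRen]

/-! ## Definable predicates in contexts -/

/-- A context: a type with coordinate functions into the numbers, among which are all constants. -/
class Ctx (M : L2Structure.{u}) (α : Type u) where
  coord : Set (α → M.Num)
  const_mem : ∀ a : M.Num, (fun _ => a) ∈ coord

instance : Ctx M PUnit.{u+1} where
  coord := Set.univ
  const_mem _ := trivial

instance {α : Type u} [Ctx M α] : Ctx M (M.Num × α) where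
  coord := {f | f = Prod.fst ∨ ∃ g ∈ Ctx.coord (M := M) (α := α), f = g ∘ Prod.snd}
  const_mem a := Or.inr ⟨fun _ => a, Ctx.const_mem a, rfl⟩

instance : Ctx M (ℕ → M.Num) where
  coord := {f | (∃ i, f = fun e => e i) ∨ ∃ a, f = fun _ => a}
  const_mem a := Or.inr ⟨a, rfl⟩

variable {α : Type u} [Ctx M α]

variable (M) in
/-- Term functions. -/
def Tm (t : α → M.Num) : Prop :=
  ∃ (c : ℕ → α → M.Num) (τ : L2Term), (∀ i, c i ∈ Ctx.coord (M := M) (α := α)) ∧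
    ∀ v, t v = M.val (fun i => c i v) τ

variable (M) in
/-- Predicates that are defined by bounded formulas with parameters. -/
def Bdd (P : α → Prop) : Prop :=
  ∃ (V : ℕ → M.sets) (c : ℕ → α → M.Num) (θ : L2Formula),
    (∀ i, c i ∈ Ctx.coord (M := M) (α := α)) ∧ θ.IsBounded ∧
    ∀ v, P v ↔ M.Sat V θ (fun i => c i v)

/-- Interleaving along `ℕ ⊕ ℕ ≃ ℕ` lets two formulas with separate assignments share one, each read
through a renaming. Every merged value comes from one of the two, so it remains an admissible
coordinate. -/
theorem exists_merge {β : Type*} (c₁ c₂ : ℕ → β) : ∃ (c : ℕ → β) (ρ₁ ρ₂ : ℕ → ℕ),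
    c ∘ ρ₁ = c₁ ∧ c ∘ ρ₂ = c₂ ∧ ∀ i, c i ∈ Set.range c₁ ∪ Set.range c₂ := by
  refine ⟨Sum.elim c₁ c₂ ∘ Equiv.natSumNatEquivNat.symm, Equiv.natSumNatEquivNat ∘ Sum.inl,
    Equiv.natSumNatEquivNat ∘ Sum.inr, ?_, ?_, fun i => ?_⟩
  · funext i; simp
  · funext i; simp
  · simp only [Function.comp]
    cases Equiv.natSumNatEquivNat.symm i <;> simp

theorem exists_merge_coord (c₁ c₂ : ℕ → α → M.Num)
    (h₁ : ∀ i, c₁ i ∈ Ctx.coord (M := M) (α := α)) (h₂ : ∀ i, c₂ i ∈ Ctx.coord (M := M) (α := α)) :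
    ∃ (c : ℕ → α → M.Num) (ρ₁ ρ₂ : ℕ → ℕ), (∀ i, c i ∈ Ctx.coord (M := M) (α := α)) ∧
      (∀ v, (fun i => c i v) ∘ ρ₁ = fun i => c₁ i v) ∧
      ∀ v, (fun i => c i v) ∘ ρ₂ = fun i => c₂ i v := by
  obtain ⟨c, ρ₁, ρ₂, rfl, rfl, h⟩ := exists_merge c₁ c₂
  refine ⟨c, ρ₁, ρ₂, fun i => ?_, fun v => rfl, fun v => rfl⟩
  rcases h i with ⟨j, hj⟩ | ⟨j, hj⟩
  · rw [← hj]; exact h₁ j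
  · rw [← hj]; exact h₂ j

theorem Tm.merge {s t : α → M.Num} (hs : Tm M s) (ht : Tm M t) :
    ∃ (c : ℕ → α → M.Num) (σ τ : L2Term), (∀ i, c i ∈ Ctx.coord (M := M) (α := α)) ∧
      (∀ v, s v = M.val (fun i => c i v) σ) ∧ ∀ v, t v = M.val (fun i => c i v) τ := by
  obtain ⟨c₁, σ, h₁, hs⟩ := hs
  obtain ⟨c₂, τ, h₂, ht⟩ := ht
  obtain ⟨c, ρ₁, ρ₂, hc, e₁, e₂⟩ := exists_merge_coord c₁ c₂ h₁ h₂
  refine ⟨c, renTerm ρ₁ σ, renTerm ρ₂ τ, hc, fun v => ?_, fun v => ?_⟩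
  · rw [val_renTerm, e₁, hs]
  · rw [val_renTerm, e₂, ht]

theorem Bdd.merge {P Q : α → Prop} (hP : Bdd M P) (hQ : Bdd M Q) :
    ∃ (V : ℕ → M.sets) (c : ℕ → α → M.Num) (θ η : L2Formula),
      (∀ i, c i ∈ Ctx.coord (M := M) (α := α)) ∧ θ.IsBounded ∧ η.IsBounded ∧
      (∀ v, P v ↔ M.Sat V θ (fun i => c i v)) ∧ ∀ v, Q v ↔ M.Sat V η (fun i => c i v) := by
  obtain ⟨V₁, c₁, θ, h₁, b₁, hP⟩ := hP
  obtain ⟨V₂, c₂, η, h₂, b₂, hQ⟩ := hQ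
  obtain ⟨c, ρ₁, ρ₂, hc, e₁, e₂⟩ := exists_merge_coord c₁ c₂ h₁ h₂
  obtain ⟨V, σ₁, σ₂, f₁, f₂, -⟩ := exists_merge V₁ V₂
  refine ⟨V, c, renFormula σ₁ ρ₁ θ, renFormula σ₂ ρ₂ η, hc, isBounded_renFormula _ _ _ b₁,
    isBounded_renFormula _ _ _ b₂, fun v => ?_, fun v => ?_⟩
  · rw [sat_renFormula, e₁, f₁, hP]
  · rw [sat_renFormula, e₂, f₂, hQ]

theorem Tm.coord {f : α → M.Num} (hf : f ∈ Ctx.coord (M := M) (α := α)) : Tm M f :=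
  ⟨fun _ => f, .var 0, fun _ => hf, fun _ => rfl⟩

theorem Tm.const (a : M.Num) : Tm M (fun _ : α => a) := Tm.coord (Ctx.const_mem a)

theorem Tm.fst : Tm M (fun v : M.Num × α => v.1) := Tm.coord (Or.inl rfl)

theorem Tm.snd {t : α → M.Num} (ht : Tm M t) : Tm M (fun v : M.Num × α => t v.2) := by
  obtain ⟨c, τ, h, ht⟩ := ht
  exact ⟨fun i => c i ∘ Prod.snd, τ, fun i => Or.inr ⟨_, h i, rfl⟩, fun v => ht v.2⟩

theorem Tm.add {s t : α → M.Num} (hs : Tm M s) (ht : Tm M t) : Tm M (fun v => s v + t v) := by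
  obtain ⟨c, σ, τ, hc, hs, ht⟩ := hs.merge ht
  exact ⟨c, .add σ τ, hc, fun v => by simp [val, hs, ht]⟩

theorem Tm.mul {s t : α → M.Num} (hs : Tm M s) (ht : Tm M t) : Tm M (fun v => s v * t v) := by
  obtain ⟨c, σ, τ, hc, hs, ht⟩ := hs.merge ht
  exact ⟨c, .mul σ τ, hc, fun v => by simp [val, hs, ht]⟩

theorem Tm.pair {s t : α → M.Num} (hs : Tm M s) (ht : Tm M t) :
    Tm M (fun v => M.pair (s v) (t v)) :=
  ((hs.add ht).mul (hs.add ht)).add hs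

/-- Some assignment of the set variables. -/
noncomputable def anySets (M : L2Structure.{u}) : ℕ → M.sets :=
  fun _ => ⟨M.sets_nonempty.some, M.sets_nonempty.some_mem⟩

theorem Bdd.eq {s t : α → M.Num} (hs : Tm M s) (ht : Tm M t) : Bdd M (fun v => s v = t v) := by
  obtain ⟨c, σ, τ, hc, hs, ht⟩ := hs.merge ht
  exact ⟨M.anySets, c, .eq σ τ, hc, trivial, fun v => by simp [Sat, hs, ht]⟩

theorem Bdd.lt {s t : α → M.Num} (hs : Tm M s) (ht : Tm M t) : Bdd M (fun v => s v < t v) := by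
  obtain ⟨c, σ, τ, hc, hs, ht⟩ := hs.merge ht
  exact ⟨M.anySets, c, .lt σ τ, hc, trivial, fun v => by simp [Sat, hs, ht]⟩

theorem Bdd.mem {X : Set M.Num} (hX : X ∈ M.sets) {t : α → M.Num} (ht : Tm M t) :
    Bdd M (fun v => t v ∈ X) := by
  obtain ⟨c, τ, hc, ht⟩ := ht
  exact ⟨fun _ => ⟨X, hX⟩, c, .mem τ 0, hc, trivial, fun v => by simp [Sat, ht]⟩

theorem Bdd.not {P : α → Prop} (hP : Bdd M P) : Bdd M (fun v => ¬ P v) := by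
  obtain ⟨V, c, θ, hc, b, hP⟩ := hP
  exact ⟨V, c, .neg θ, hc, b, fun v => by simp [Sat, hP]⟩

theorem Bdd.and {P Q : α → Prop} (hP : Bdd M P) (hQ : Bdd M Q) : Bdd M (fun v => P v ∧ Q v) := by
  obtain ⟨V, c, θ, η, hc, b, b', hP, hQ⟩ := hP.merge hQ
  exact ⟨V, c, .and θ η, hc, ⟨b, b'⟩, fun v => by simp [Sat, hP, hQ]⟩

theorem Bdd.or {P Q : α → Prop} (hP : Bdd M P) (hQ : Bdd M Q) : Bdd M (fun v => P v ∨ Q v) := by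
  obtain ⟨V, c, θ, η, hc, b, b', hP, hQ⟩ := hP.merge hQ
  exact ⟨V, c, .or θ η, hc, ⟨b, b'⟩, fun v => by simp [Sat, hP, hQ]⟩

theorem Bdd.of_iff {P Q : α → Prop} (hP : Bdd M P) (h : ∀ v, Q v ↔ P v) : Bdd M Q := by
  rwa [show Q = P from funext fun v => propext (h v)]

theorem Bdd.imp {P Q : α → Prop} (hP : Bdd M P) (hQ : Bdd M Q) : Bdd M (fun v => P v → Q v) :=
  (hP.not.or hQ).of_iff fun _ => imp_iff_not_or

theorem Bdd.le {s t : α → M.Num} (hs : Tm M s) (ht : Tm M t) : Bdd M (fun v => s v ≤ t v) :=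
  (Bdd.lt hs ht).or (Bdd.eq hs ht)

/-- A coordinate of `M.Num × α` is either the fresh first component or comes from `α`. Renaming it
to `0` or to `i + 1` accordingly makes the first component the variable that a quantifier binds. -/
theorem exists_unbind (c : ℕ → M.Num × α → M.Num)
    (hc : ∀ i, c i ∈ Ctx.coord (M := M) (α := M.Num × α)) :
    ∃ (ρ : ℕ → ℕ) (c' : ℕ → α → M.Num), (∀ i, c' i ∈ Ctx.coord (M := M) (α := α)) ∧
      ∀ a v, push a (fun i => c' i v) ∘ ρ = fun i => c i (a, v) := by
  classical
  have key : ∀ i, ∃ (n : ℕ) (g : α → M.Num), g ∈ Ctx.coord (M := M) (α := α) ∧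
      ((n = 0 ∧ c i = Prod.fst) ∨ (n = i + 1 ∧ c i = g ∘ Prod.snd)) := by
    intro i
    rcases hc i with h | ⟨g, hg, h⟩
    -- The value `0` is a filler: no variable is renamed to `i + 1` in this case.
    · exact ⟨0, fun _ => 0, Ctx.const_mem 0, Or.inl ⟨rfl, h⟩⟩
    · exact ⟨i + 1, g, hg, Or.inr ⟨rfl, h⟩⟩
  choose ρ c' hc' h using key
  refine ⟨ρ, c', hc', fun a v => funext fun i => ?_⟩
  rcases h i with ⟨h₁, h₂⟩ | ⟨h₁, h₂⟩ <;> simp [h₁, h₂, push]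

theorem Bdd.unbind {P : M.Num × α → Prop} (hP : Bdd M P) :
    ∃ (V : ℕ → M.sets) (c : ℕ → α → M.Num) (θ : L2Formula),
      (∀ i, c i ∈ Ctx.coord (M := M) (α := α)) ∧ θ.IsBounded ∧
      ∀ a v, P (a, v) ↔ M.Sat V θ (push a (fun i => c i v)) := by
  obtain ⟨V, c, θ, hc, b, hP⟩ := hP
  obtain ⟨ρ, c', hc', h⟩ := exists_unbind c hc
  refine ⟨V, c', renFormula id ρ θ, hc', isBounded_renFormula _ _ _ b, fun a v => ?_⟩
  rw [sat_renFormula, h, hP]; rfl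

theorem Bdd.ballLT {t : α → M.Num} {P : M.Num × α → Prop} (ht : Tm M t) (hP : Bdd M P) :
    Bdd M (fun v => ∀ a, a < t v → P (a, v)) := by
  obtain ⟨V, c₁, θ, h₁, b, hP⟩ := hP.unbind
  obtain ⟨c₂, τ, h₂, ht⟩ := ht
  obtain ⟨c, ρ₁, ρ₂, hc, e₁, e₂⟩ := exists_merge_coord c₁ c₂ h₁ h₂
  refine ⟨V, c, .ballLT (renTerm ρ₂ τ) (renFormula id (liftRen ρ₁) θ), hc,
    isBounded_renFormula _ _ _ b, fun v => ?_⟩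
  simp only [Sat, val_renTerm, sat_renFormula, push_comp_liftRen, e₁, e₂, ht, hP]; rfl

theorem Bdd.bexLT {t : α → M.Num} {P : M.Num × α → Prop} (ht : Tm M t) (hP : Bdd M P) :
    Bdd M (fun v => ∃ a, a < t v ∧ P (a, v)) :=
  (Bdd.ballLT ht hP.not).not.of_iff fun v => by simp

/-- Over the empty context only constants remain, and they become the number parameters. Both
formulas share one assignment, as Δ⁰₁ comprehension requires. -/
theorem Bdd.unbind_const₂ {P Q : M.Num × M.Num × PUnit.{u+1} → Prop} (hP : Bdd M P) (hQ : Bdd M Q) :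
    ∃ (V : ℕ → M.sets) (e : ℕ → M.Num) (θ η : L2Formula), θ.IsBounded ∧ η.IsBounded ∧
      (∀ a b, P (a, b, ⟨⟩) ↔ M.Sat V θ (push a (push b e))) ∧
      ∀ a b, Q (a, b, ⟨⟩) ↔ M.Sat V η (push a (push b e)) := by
  obtain ⟨V, c, θ, η, hc, b, b', hP, hQ⟩ := hP.merge hQ
  obtain ⟨ρ, c', hc', h⟩ := exists_unbind c hc
  obtain ⟨ρ', c'', -, h'⟩ := exists_unbind c' hc'
  refine ⟨V, fun i => c'' i ⟨⟩, renFormula id (liftRen ρ' ∘ ρ) θ, renFormula id (liftRen ρ' ∘ ρ) η,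
    isBounded_renFormula _ _ _ b, isBounded_renFormula _ _ _ b', fun a b => ?_, fun a b => ?_⟩ <;>
  rw [sat_renFormula, ← Function.comp_assoc, push_comp_liftRen, h', h] <;> simp [hP, hQ]

/-! ## Induction and comprehension for definable predicates -/

theorem IsRCA0.induction_ex (hM : M.IsRCA0) {P : M.Num → Prop} {Q : M.Num × M.Num × PUnit.{u+1} → Prop}
    (hQ : Bdd M Q) (h : ∀ n, P n ↔ ∃ a, Q (a, n, ⟨⟩)) (h0 : P 0) (hs : ∀ n, P n → P (n + 1)) :
    ∀ n, P n := by
  obtain ⟨V, e, θ, -, b, -, hθ, -⟩ := hQ.unbind_const₂ hQ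
  have key : ∀ n, P n ↔ M.Sat V (.ex θ) (push n e) := fun n => by simp only [h, hθ, Sat]
  simp only [key] at h0 hs ⊢
  exact hM.sigma_induction θ b V e h0 hs

theorem IsRCA0.induction_bdd (hM : M.IsRCA0) {P : M.Num → Prop}
    (hP : Bdd M (fun v : M.Num × PUnit.{u+1} => P v.1)) (h0 : P 0) (hs : ∀ n, P n → P (n + 1)) :
    ∀ n, P n := by
  obtain ⟨V, c, θ, hc, b, hP⟩ := hP
  refine hM.induction_ex (Q := fun v => P v.2.1)
    ⟨V, fun i => c i ∘ Prod.snd, θ, fun i => Or.inr ⟨_, hc i, rfl⟩, b, fun v => hP v.2⟩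
    (fun n => ⟨fun h => ⟨0, h⟩, fun ⟨_, h⟩ => h⟩) h0 hs

theorem IsRCA0.comprehension_ex (hM : M.IsRCA0) {P : M.Num → Prop}
    {Q R : M.Num × M.Num × PUnit.{u+1} → Prop} (hQ : Bdd M Q) (hR : Bdd M R)
    (h : ∀ n, P n ↔ ∃ a, Q (a, n, ⟨⟩)) (h' : ∀ n, ¬ P n ↔ ∃ a, R (a, n, ⟨⟩)) :
    {n | P n} ∈ M.sets := by
  obtain ⟨V, e, θ, η, b, b', hθ, hη⟩ := hQ.unbind_const₂ hR.not
  have := hM.delta_comprehension θ η b b' V e fun n => by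
    simp only [Sat, ← hθ, ← hη, ← h]
    have := h' n
    grind
  convert this using 3 with n
  simp only [Sat, ← hθ, h]

end L2Structure

namespace L2Structure

/-! ## The ordered semiring of numbers -/

variable {M : L2Structure.{u}}

theorem IsRCA0.zero_add' (hM : M.IsRCA0) (n : M.Num) : 0 + n = n := by
  refine hM.induction_bdd (P := fun n => 0 + n = n)
    (Bdd.eq (.add (.const _) .fst) .fst) (hM.basic.add_zero 0) (fun n h => ?_) n
  rw [hM.basic.add_succ, h]

theorem IsRCA0.succ_add' (hM : M.IsRCA0) (m n : M.Num) : m + 1 + n = m + n + 1 := by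
  refine hM.induction_bdd (P := fun n => m + 1 + n = m + n + 1)
    (Bdd.eq (.add (.const _) .fst) (.add (.add (.const _) .fst) (.const _))) ?_ (fun n h => ?_) n
  · rw [hM.basic.add_zero, hM.basic.add_zero]
  · rw [hM.basic.add_succ, h, hM.basic.add_succ]

theorem IsRCA0.add_comm' (hM : M.IsRCA0) (m n : M.Num) : m + n = n + m := by
  refine hM.induction_bdd (P := fun n => m + n = n + m)
    (Bdd.eq (.add (.const _) .fst) (.add .fst (.const _))) ?_ (fun n h => ?_) n
  · rw [hM.basic.add_zero, hM.zero_add']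
  · rw [hM.basic.add_succ, hM.succ_add', h]

theorem IsRCA0.add_assoc' (hM : M.IsRCA0) (m n k : M.Num) : m + n + k = m + (n + k) := by
  refine hM.induction_bdd (P := fun k => m + n + k = m + (n + k))
    (Bdd.eq (.add (.const _) .fst) (.add (.const _) (.add (.const _) .fst))) ?_ (fun k h => ?_) k
  · rw [hM.basic.add_zero, hM.basic.add_zero]
  · rw [hM.basic.add_succ, hM.basic.add_succ, hM.basic.add_succ, h]

theorem IsRCA0.zero_mul' (hM : M.IsRCA0) (n : M.Num) : 0 * n = 0 := by
  refine hM.induction_bdd (P := fun n => 0 * n = 0)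
    (Bdd.eq (.mul (.const _) .fst) (.const _)) (hM.basic.mul_zero 0) (fun n h => ?_) n
  rw [hM.basic.mul_succ, h, hM.basic.add_zero]

theorem IsRCA0.succ_mul' (hM : M.IsRCA0) (m n : M.Num) : (m + 1) * n = m * n + n := by
  refine hM.induction_bdd (P := fun n => (m + 1) * n = m * n + n)
    (Bdd.eq (.mul (.const _) .fst) (.add (.mul (.const _) .fst) .fst)) ?_ (fun n h => ?_) n
  · rw [hM.basic.mul_zero, hM.basic.mul_zero, hM.basic.add_zero]
  · rw [hM.basic.mul_succ, h, hM.basic.mul_succ, hM.add_assoc', hM.add_assoc',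
      hM.basic.add_succ n m, hM.basic.add_succ m n, hM.add_comm' n m]

theorem IsRCA0.mul_comm' (hM : M.IsRCA0) (m n : M.Num) : m * n = n * m := by
  refine hM.induction_bdd (P := fun n => m * n = n * m)
    (Bdd.eq (.mul (.const _) .fst) (.mul .fst (.const _))) ?_ (fun n h => ?_) n
  · rw [hM.basic.mul_zero, hM.zero_mul']
  · rw [hM.basic.mul_succ, hM.succ_mul', h]

theorem IsRCA0.mul_add' (hM : M.IsRCA0) (m n k : M.Num) : m * (n + k) = m * n + m * k := by
  refine hM.induction_bdd (P := fun k => m * (n + k) = m * n + m * k)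
    (Bdd.eq (.mul (.const _) (.add (.const _) .fst))
      (.add (.const _) (.mul (.const _) .fst))) ?_ (fun k h => ?_) k
  · rw [hM.basic.mul_zero, hM.basic.add_zero, hM.basic.add_zero]
  · rw [hM.basic.add_succ, hM.basic.mul_succ, hM.basic.mul_succ, h, hM.add_assoc']

theorem IsRCA0.mul_assoc' (hM : M.IsRCA0) (m n k : M.Num) : m * n * k = m * (n * k) := by
  refine hM.induction_bdd (P := fun k => m * n * k = m * (n * k))
    (Bdd.eq (.mul (.const _) .fst) (.mul (.const _) (.mul (.const _) .fst))) ?_ (fun k h => ?_) k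
  · rw [hM.basic.mul_zero, hM.basic.mul_zero, hM.basic.mul_zero]
  · rw [hM.basic.mul_succ, hM.basic.mul_succ, hM.mul_add', h]

theorem IsRCA0.one_mul' (hM : M.IsRCA0) (n : M.Num) : 1 * n = n := by
  rw [← hM.zero_add' 1, hM.succ_mul', hM.zero_mul', hM.zero_add']

variable [hM : Fact M.IsRCA0]

instance : CommSemiring M.Num where
  add_assoc := hM.out.add_assoc'
  zero_add := hM.out.zero_add'
  add_zero := hM.out.basic.add_zero
  add_comm := hM.out.add_comm'
  nsmul := nsmulRec
  left_distrib := hM.out.mul_add'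
  right_distrib a b c := by
    rw [hM.out.mul_comm', hM.out.mul_add', hM.out.mul_comm' c, hM.out.mul_comm' c]
  zero_mul := hM.out.zero_mul'
  mul_zero := hM.out.basic.mul_zero
  mul_assoc := hM.out.mul_assoc'
  one_mul := hM.out.one_mul'
  mul_one n := by rw [hM.out.mul_comm', hM.out.one_mul']
  mul_comm := hM.out.mul_comm'
  npow := npowRec

theorem num_induction {P : M.Num → Prop} (hP : Bdd M (fun v : M.Num × PUnit.{u+1} => P v.1))
    (h0 : P 0) (hs : ∀ n, P n → P (n + 1)) : ∀ n, P n :=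
  hM.out.induction_bdd hP h0 hs

theorem num_induction_ex {P : M.Num → Prop} {Q : M.Num × M.Num × PUnit.{u+1} → Prop}
    (hQ : Bdd M Q) (h : ∀ n, P n ↔ ∃ a, Q (a, n, ⟨⟩)) (h0 : P 0) (hs : ∀ n, P n → P (n + 1)) :
    ∀ n, P n :=
  hM.out.induction_ex hQ h h0 hs

instance : IsCancelAdd M.Num :=
  have key : ∀ a b n : M.Num, a + n = b + n → a = b := fun a b => num_induction
    ((Bdd.eq (.add (.const _) .fst) (.add (.const _) .fst)).imp (.eq (.const _) (.const _)))
    (fun h => by simpa using h)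
    (fun n ih h => ih (hM.out.basic.succ_inj _ _ (by rwa [← add_assoc, ← add_assoc] at h)))
  { add_right_cancel := fun n a b h => key a b n h
    add_left_cancel := fun n a b h => key a b n (by rwa [add_comm a, add_comm b]) }

theorem eq_zero_or_succ (n : M.Num) : n = 0 ∨ ∃ m, n = m + 1 := by
  refine num_induction_ex (P := fun n : M.Num => n = 0 ∨ ∃ m, n = m + 1)
    (Q := fun v => v.2.1 = 0 ∨ v.2.1 = v.1 + 1)
    ((Bdd.eq (.snd .fst) (.const _)).or (.eq (.snd .fst) (.add .fst (.const _))))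
    (fun n => ?_) (Or.inl rfl) (fun n _ => Or.inr ⟨n, rfl⟩) n
  constructor
  · rintro (h | ⟨m, h⟩)
    · exact ⟨0, Or.inl h⟩
    · exact ⟨m, Or.inr h⟩
  · rintro ⟨m, h | h⟩
    · exact Or.inl h
    · exact Or.inr ⟨m, h⟩

/-- The axioms describe `<` only through `not_lt_zero` and `lt_succ`. All order properties below are
derived from this link with addition. -/
theorem lt_iff_exists_succ {m n : M.Num} : m < n ↔ ∃ k, m + k + 1 = n := by
  constructor
  · intro h
    -- The implication is written as a disjunction so that `∃ k` can be pulled in front of a bounded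
    -- matrix, which Σ⁰₁ induction needs.
    have key : ∀ n : M.Num, ¬ m < n ∨ ∃ k, m + k + 1 = n := by
      refine num_induction_ex (Q := fun v => ¬ m < v.2.1 ∨ m + v.1 + 1 = v.2.1)
        ((Bdd.lt (.const _) (.snd .fst)).not.or
          (.eq (((Tm.const _).add .fst).add (.const _)) (.snd .fst))) (fun n => ?_)
        (Or.inl (hM.out.basic.not_lt_zero m)) (fun n ih => ?_)
      · constructor
        · rintro (h | ⟨m, h⟩)
          · exact ⟨0, Or.inl h⟩
          · exact ⟨m, Or.inr h⟩
        · rintro ⟨m, h | h⟩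
          · exact Or.inl h
          · exact Or.inr ⟨m, h⟩
      · rcases Classical.em (m < n + 1) with h | h
        · rcases (hM.out.basic.lt_succ _ _).1 h with h | rfl
          · obtain ⟨k, rfl⟩ := ih.resolve_left (not_not.2 h)
            exact Or.inr ⟨k + 1, by rw [← add_assoc]⟩
          · exact Or.inr ⟨0, by rw [add_zero]⟩
        · exact Or.inl h
    exact (key n).resolve_left (not_not.2 h)
  · rintro ⟨k, rfl⟩
    refine num_induction (P := fun k => m + k + 1 > m)
      (.lt (.const _) (.add (.add (.const _) .fst) (.const _))) ?_ (fun k ih => ?_) k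
    · exact (hM.out.basic.lt_succ _ _).2 (Or.inr (add_zero m).symm)
    · exact (hM.out.basic.lt_succ _ _).2 (Or.inl (by rwa [← add_assoc]))

theorem le_iff_exists_add' {m n : M.Num} : m ≤ n ↔ ∃ k, n = m + k := by
  constructor
  · rintro (h | rfl)
    · obtain ⟨k, rfl⟩ := lt_iff_exists_succ.1 h
      exact ⟨k + 1, by rw [add_assoc]⟩
    · exact ⟨0, by rw [add_zero]⟩
  · rintro ⟨k, rfl⟩
    rcases eq_zero_or_succ k with rfl | ⟨k, rfl⟩
    · exact Or.inr (add_zero m).symm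
    · exact Or.inl (lt_iff_exists_succ.2 ⟨k, by rw [add_assoc]⟩)

theorem add_eq_zero_num {m n : M.Num} (h : m + n = 0) : n = 0 := by
  rcases eq_zero_or_succ n with rfl | ⟨n, rfl⟩
  · rfl
  · exact (hM.out.basic.succ_ne_zero (m + n) (by rwa [add_assoc])).elim

theorem le_total_num (m n : M.Num) : m ≤ n ∨ n ≤ m := by
  refine num_induction (P := fun n => m ≤ n ∨ n ≤ m)
    ((Bdd.le (.const _) .fst).or (.le .fst (.const _))) ?_ (fun n ih => ?_) n
  · exact Or.inr (le_iff_exists_add'.2 ⟨m, by rw [zero_add]⟩)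
  · rcases ih with ih | ih
    · obtain ⟨k, rfl⟩ := le_iff_exists_add'.1 ih
      exact Or.inl (le_iff_exists_add'.2 ⟨k + 1, by rw [add_assoc]⟩)
    · obtain ⟨k, rfl⟩ := le_iff_exists_add'.1 ih
      rcases eq_zero_or_succ k with rfl | ⟨k, rfl⟩
      · exact Or.inl (le_iff_exists_add'.2 ⟨1, by rw [add_zero]⟩)
      · exact Or.inr (le_iff_exists_add'.2 ⟨k, by rw [add_assoc, add_comm 1]⟩)

theorem le_antisymm_num {m n : M.Num} (h : m ≤ n) (h' : n ≤ m) : m = n := by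
  obtain ⟨k, rfl⟩ := le_iff_exists_add'.1 h
  obtain ⟨l, hl⟩ := le_iff_exists_add'.1 h'
  rw [add_assoc, left_eq_add, add_comm] at hl
  rw [add_eq_zero_num hl, add_zero]

theorem lt_irrefl_num (m : M.Num) : ¬ m < m := fun h => by
  obtain ⟨k, hk⟩ := lt_iff_exists_succ.1 h
  rw [add_assoc, add_eq_left] at hk
  exact hM.out.basic.succ_ne_zero _ hk

open Classical in
noncomputable instance : LinearOrder M.Num where
  le_refl _ := Or.inr rfl
  le_trans a b c h h' := by
    obtain ⟨k, rfl⟩ := le_iff_exists_add'.1 h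
    obtain ⟨l, rfl⟩ := le_iff_exists_add'.1 h'
    exact le_iff_exists_add'.2 ⟨k + l, add_assoc _ _ _⟩
  lt_iff_le_not_ge a b := by
    refine ⟨fun h => ⟨Or.inl h, fun h' => ?_⟩, fun ⟨h, h'⟩ => h.resolve_right fun e => h' (Or.inr e.symm)⟩
    have := le_antisymm_num (Or.inl h) h'
    subst this
    exact lt_irrefl_num _ h
  le_antisymm _ _ := le_antisymm_num
  le_total := le_total_num
  toDecidableLE := Classical.decRel _

instance : CanonicallyOrderedAdd M.Num where
  exists_add_of_le h := le_iff_exists_add'.1 h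
  le_add_self _ b := le_iff_exists_add'.2 ⟨b, add_comm _ _⟩
  le_self_add _ b := le_iff_exists_add'.2 ⟨b, rfl⟩

instance : IsOrderedAddMonoid M.Num where
  add_le_add_left a b h c := by
    obtain ⟨k, rfl⟩ := le_iff_exists_add'.1 h
    exact le_iff_exists_add'.2 ⟨k, add_right_comm _ _ _⟩

theorem lt_add_one_iff' {m n : M.Num} : m < n + 1 ↔ m ≤ n := hM.out.basic.lt_succ m n

instance : Nontrivial M.Num := ⟨0, 1, fun h => hM.out.basic.succ_ne_zero 0 (by rw [zero_add, h])⟩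

theorem mul_lt_mul_left_num {a b c : M.Num} (hc : 0 < c) (h : a < b) : c * a < c * b := by
  obtain ⟨k, rfl⟩ := lt_iff_exists_succ.1 h
  obtain ⟨l, rfl⟩ := lt_iff_exists_succ.1 hc
  exact lt_iff_exists_succ.2 ⟨(0 + l + 1) * k + l, by ring⟩

instance : IsStrictOrderedRing M.Num where
  le_of_add_le_add_left a b c h := by
    obtain ⟨k, hk⟩ := le_iff_exists_add'.1 h
    rw [add_assoc, add_right_inj] at hk
    exact le_iff_exists_add'.2 ⟨k, hk⟩
  zero_le_one := zero_le
  mul_lt_mul_of_pos_left c hc a b h := mul_lt_mul_left_num hc h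
  mul_lt_mul_of_pos_right c hc a b h := by
    simpa only [mul_comm _ c] using mul_lt_mul_left_num hc h

theorem succ_le_iff' {m n : M.Num} : m + 1 ≤ n ↔ m < n := by
  rw [← not_lt, lt_add_one_iff', not_le]

theorem eq_succ_of_pos {m : M.Num} (h : 0 < m) : ∃ k, m = k + 1 :=
  (eq_zero_or_succ m).resolve_left h.ne'

end L2Structure

namespace L2Structure

/-! ## Existential and recursive predicates, recursive functions -/

section

variable {M : L2Structure.{u}} {α β : Type u} [Ctx M α] [Ctx M β]

variable (M) in
/-- Maps of contexts that send variables to variables or constants. -/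
def CMap (g : β → α) : Prop :=
  ∀ f ∈ Ctx.coord (M := M) (α := α), f ∘ g ∈ Ctx.coord (M := M) (α := β)

theorem CMap.id : CMap M (fun v : α => v) := fun _ hf => hf

theorem CMap.snd {g : β → α} (hg : CMap M g) : CMap M (fun v : M.Num × β => g v.2) :=
  fun f hf => Or.inr ⟨f ∘ g, hg f hf, rfl⟩

theorem CMap.cons {t : β → M.Num} (ht : t ∈ Ctx.coord (M := M) (α := β)) {g : β → α}
    (hg : CMap M g) : CMap M (fun v => (t v, g v)) := by
  rintro f (rfl | ⟨f, hf, rfl⟩)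
  · exact ht
  · exact hg f hf

theorem CMap.nil : CMap M (fun _ : β => (⟨⟩ : PUnit.{u+1})) := fun f _ => Ctx.const_mem (f ⟨⟩)

theorem coord_fst : (fun v : M.Num × α => v.1) ∈ Ctx.coord (M := M) (α := M.Num × α) := Or.inl rfl

theorem coord_snd {t : α → M.Num} (ht : t ∈ Ctx.coord (M := M) (α := α)) :
    (fun v : M.Num × α => t v.2) ∈ Ctx.coord (M := M) (α := M.Num × α) := Or.inr ⟨t, ht, rfl⟩

theorem Bdd.comp {P : α → Prop} (hP : Bdd M P) {g : β → α} (hg : CMap M g) :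
    Bdd M (fun v => P (g v)) := by
  obtain ⟨V, c, θ, hc, b, hP⟩ := hP
  exact ⟨V, fun i => c i ∘ g, θ, fun i => hg _ (hc i), b, fun v => hP (g v)⟩

variable (M) in
/-- Predicates of the form `∃ a, Q (a, v)` with `Q` defined by a bounded formula. -/
def Sig (P : α → Prop) : Prop :=
  ∃ Q : M.Num × α → Prop, Bdd M Q ∧ ∀ v, P v ↔ ∃ a, Q (a, v)

variable (M) in
/-- Predicates that are `Sig` together with their complements. -/
structure Del (P : α → Prop) : Prop where
  sig : Sig M P
  sig_not : Sig M (fun v => ¬ P v)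

variable (M) in
/-- Functions whose graph is `Sig`. -/
def Fn (f : α → M.Num) : Prop := Sig M (fun p : M.Num × α => p.1 = f p.2)

theorem Sig.comp {P : α → Prop} (hP : Sig M P) {g : β → α} (hg : CMap M g) :
    Sig M (fun v => P (g v)) := by
  obtain ⟨Q, hQ, h⟩ := hP
  exact ⟨fun v => Q (v.1, g v.2), hQ.comp (.cons coord_fst hg.snd), fun v => h (g v)⟩

theorem Del.comp {P : α → Prop} (hP : Del M P) {g : β → α} (hg : CMap M g) :
    Del M (fun v => P (g v)) := ⟨hP.1.comp hg, hP.2.comp hg⟩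

theorem Fn.comp {f : α → M.Num} (hf : Fn M f) {g : β → α} (hg : CMap M g) :
    Fn M (fun v => f (g v)) := Sig.comp hf (.cons coord_fst hg.snd)

theorem Sig.of_iff {P Q : α → Prop} (hP : Sig M P) (h : ∀ v, Q v ↔ P v) : Sig M Q := by
  rwa [show Q = P from funext fun v => propext (h v)]

theorem Del.of_iff {P Q : α → Prop} (hP : Del M P) (h : ∀ v, Q v ↔ P v) : Del M Q := by
  rwa [show Q = P from funext fun v => propext (h v)]

theorem Fn.of_eq {f g : α → M.Num} (hf : Fn M f) (h : ∀ v, g v = f v) : Fn M g := by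
  rwa [show g = f from funext h]

theorem Bdd.sig' {P : α → Prop} (hP : Bdd M P) : Sig M P :=
  ⟨fun v => P v.2, hP.comp CMap.id.snd, fun _ => ⟨fun h => ⟨0, h⟩, fun ⟨_, h⟩ => h⟩⟩

theorem Bdd.del {P : α → Prop} (hP : Bdd M P) : Del M P := ⟨hP.sig', hP.not.sig'⟩

theorem Del.not {P : α → Prop} (hP : Del M P) : Del M (fun v => ¬ P v) :=
  ⟨hP.2, hP.1.of_iff fun _ => not_not⟩

end

variable {M : L2Structure.{u}} [hM : Fact M.IsRCA0] {α β : Type u} [Ctx M α] [Ctx M β]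

theorem Bdd.bexLE {P : M.Num × α → Prop} (hP : Bdd M P) {t : α → M.Num} (ht : Tm M t) :
    Bdd M (fun v => ∃ a ≤ t v, P (a, v)) :=
  (Bdd.bexLT (ht.add (.const 1)) hP).of_iff fun v => by simp [lt_add_one_iff']

/-- Two existential quantifiers contract to one that bounds both witnesses; the sum of the witnesses
is such a bound. -/
theorem Sig.ex {P : M.Num → α → Prop} (hP : Sig M (fun p : M.Num × α => P p.1 p.2)) :
    Sig M (fun v => ∃ a, P a v) := by
  obtain ⟨Q, hQ, h⟩ := hP
  refine ⟨fun w => ∃ x ≤ w.1, ∃ a ≤ w.1, Q (a, x, w.2), Bdd.bexLE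
    (P := fun p : M.Num × M.Num × α => ∃ a ≤ p.2.1, Q (a, p.1, p.2.2)) (Bdd.bexLE
    (P := fun p : M.Num × M.Num × M.Num × α => Q (p.1, p.2.1, p.2.2.2))
    (hQ.comp (.cons coord_fst (.cons (coord_snd coord_fst) CMap.id.snd.snd.snd)))
    (.snd .fst)) .fst, fun v => ?_⟩
  simp only [fun a => h (a, v)]
  constructor
  · rintro ⟨a, b, h⟩
    exact ⟨a + b, a, le_self_add, b, le_add_self, h⟩
  · rintro ⟨_, a, -, b, -, h⟩
    exact ⟨a, b, h⟩

theorem Sig.and {P Q : α → Prop} (hP : Sig M P) (hQ : Sig M Q) : Sig M (fun v => P v ∧ Q v) := by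
  obtain ⟨P', hP', h⟩ := hP
  have : Sig M (fun v => ∃ a, P' (a, v) ∧ Q v) := by
    obtain ⟨Q', hQ', h'⟩ := hQ
    have : Sig M (fun v : α => ∃ a b, P' (a, v) ∧ Q' (b, v)) :=
      .ex (.ex (Bdd.sig' (.and (hP'.comp (.cons (coord_snd coord_fst) CMap.id.snd.snd))
        (hQ'.comp (.cons coord_fst CMap.id.snd.snd)))))
    exact this.of_iff fun v => by simp [h']
  exact this.of_iff fun v => by simp [h]

theorem Sig.or {P Q : α → Prop} (hP : Sig M P) (hQ : Sig M Q) : Sig M (fun v => P v ∨ Q v) := by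
  obtain ⟨P', hP', h⟩ := hP
  obtain ⟨Q', hQ', h'⟩ := hQ
  exact ⟨_, hP'.or hQ', fun v => by simp [h, h', exists_or]⟩

theorem Sig.induction {P : M.Num → Prop} (hP : Sig M (fun v : M.Num × PUnit.{u+1} => P v.1))
    (h0 : P 0) (hs : ∀ n, P n → P (n + 1)) : ∀ n, P n := by
  obtain ⟨Q, hQ, h⟩ := hP
  exact num_induction_ex hQ (fun n => h (n, ⟨⟩)) h0 hs

theorem Tm.v0 : Tm M (fun v : M.Num × α => v.1) := .fst
theorem Tm.v1 : Tm M (fun v : M.Num × M.Num × α => v.2.1) := .snd .fst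

theorem Bdd.ball' {P : M.Num → α → Prop} (hP : Bdd M (fun p : M.Num × α => P p.1 p.2))
    {t : α → M.Num} (ht : Tm M t) : Bdd M (fun v => ∀ a < t v, P a v) := Bdd.ballLT ht hP

theorem Bdd.bex' {P : M.Num → α → Prop} (hP : Bdd M (fun p : M.Num × α => P p.1 p.2))
    {t : α → M.Num} (ht : Tm M t) : Bdd M (fun v => ∃ a < t v, P a v) := Bdd.bexLT ht hP

/-- Bounding of witnesses. -/
theorem collection {P : M.Num → M.Num → Prop}
    (hP : Bdd M (fun v : M.Num × M.Num × PUnit.{u+1} => P v.2.1 v.1)) (n : M.Num)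
    (h : ∀ i < n, ∃ a, P i a) : ∃ b, ∀ i < n, ∃ a < b, P i a := by
  -- The induction runs over all `m`; the disjunct `n < m` trivializes the claim beyond `n`, where
  -- no witnesses are assumed.
  suffices ∀ m, ∃ b, n < m ∨ ∀ i < m, ∃ a < b, P i a from
    (this n).imp fun b hb => hb.resolve_left (lt_irrefl n)
  refine Sig.induction (.ex (Bdd.sig' (.or (.lt (.const _) .v1) (.ball' (.bex' ?_ .v1) .v1))))
    ⟨0, Or.inr fun i hi => (not_lt_zero hi).elim⟩ (fun m ⟨b, ih⟩ => ?_)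
  · exact hP.comp (.cons coord_fst (.cons (coord_snd coord_fst) .nil))
  · rcases ih with ih | ih
    · exact ⟨b, Or.inl (ih.trans (lt_add_one_iff'.2 le_rfl))⟩
    rcases le_or_gt n m with hm | hm
    · exact ⟨b, Or.inl (lt_add_one_iff'.2 hm)⟩
    obtain ⟨a, ha⟩ := h m hm
    refine ⟨b + a + 1, Or.inr fun i hi => ?_⟩
    rcases (lt_add_one_iff'.1 hi).lt_or_eq with hi | rfl
    · obtain ⟨a', ha', hP⟩ := ih i hi
      exact ⟨a', ha'.trans_le (by rw [add_assoc]; exact le_self_add), hP⟩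
    · exact ⟨a, lt_add_one_iff'.2 le_add_self, ha⟩

/-- By `collection` a single bound serves for the witnesses of all `a < t v`, so the unbounded
quantifier can be moved to the front. -/
theorem Sig.ball_tm {P : M.Num → α → Prop} (hP : Sig M (fun p : M.Num × α => P p.1 p.2))
    {t : α → M.Num} (ht : Tm M t) : Sig M (fun v => ∀ a < t v, P a v) := by
  obtain ⟨Q, hQ, h⟩ := hP
  refine ⟨fun w => ∀ i < t w.2, ∃ a < w.1, Q (a, i, w.2), .ball' (.bex' (hQ.comp (.cons coord_fst
    (.cons (coord_snd coord_fst) CMap.id.snd.snd.snd))) .v1) ht.snd, fun v => ?_⟩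
  simp only [fun a => h (a, v)]
  constructor
  · refine collection (P := fun i a => Q (a, i, v)) ?_ _
    exact hQ.comp (.cons coord_fst (.cons (coord_snd coord_fst) fun f _ => Ctx.const_mem (f _)))
  · rintro ⟨b, hb⟩ a ha
    obtain ⟨c, -, hc⟩ := hb a ha
    exact ⟨c, hc⟩

/-! ### Closure properties -/

/-- The value `f v` is named by an existential quantifier. Since `f` is total, the same works for
the complement, and hence for `Del`. -/
theorem Sig.subst {P : M.Num → α → Prop} (hP : Sig M (fun p : M.Num × α => P p.1 p.2))
    {f : α → M.Num} (hf : Fn M f) : Sig M (fun v => P (f v) v) :=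
  (Sig.ex (P := fun a v => a = f v ∧ P a v) (Sig.and hf hP)).of_iff fun v => by simp

theorem Del.subst {P : M.Num → α → Prop} (hP : Del M (fun p : M.Num × α => P p.1 p.2))
    {f : α → M.Num} (hf : Fn M f) : Del M (fun v => P (f v) v) :=
  ⟨hP.1.subst hf, hP.2.subst (P := fun a v => ¬ P a v) hf⟩

theorem Fn.snd {f : α → M.Num} (hf : Fn M f) : Fn M (fun v : M.Num × α => f v.2) :=
  hf.comp CMap.id.snd

theorem Fn.subst {F : M.Num → α → M.Num} (hF : Fn M (fun p : M.Num × α => F p.1 p.2))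
    {f : α → M.Num} (hf : Fn M f) : Fn M (fun v => F (f v) v) :=
  Sig.subst (P := fun a (w : M.Num × α) => w.1 = F a w.2)
    (Sig.comp hF (.cons (coord_snd coord_fst) (.cons coord_fst CMap.id.snd.snd))) hf.snd

theorem Tm.fn {t : α → M.Num} (ht : Tm M t) : Fn M t := (Bdd.eq .fst ht.snd).sig'

theorem Fn.const (a : M.Num) : Fn M (fun _ : α => a) := (Tm.const a).fn
theorem Fn.v0 : Fn M (fun v : M.Num × α => v.1) := Tm.fst.fn
theorem Fn.v1 : Fn M (fun v : M.Num × M.Num × α => v.2.1) := Fn.v0.snd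
theorem Fn.v2 : Fn M (fun v : M.Num × M.Num × M.Num × α => v.2.2.1) := Fn.v1.snd
theorem Fn.v3 : Fn M (fun v : M.Num × M.Num × M.Num × M.Num × α => v.2.2.2.1) := Fn.v2.snd
theorem Fn.v4 : Fn M (fun v : M.Num × M.Num × M.Num × M.Num × M.Num × α => v.2.2.2.2.1) :=
  Fn.v3.snd
theorem Fn.v5 : Fn M (fun v : M.Num × M.Num × M.Num × M.Num × M.Num × M.Num × α =>
    v.2.2.2.2.2.1) := Fn.v4.snd

theorem Fn.map₁ {F : M.Num → M.Num} (hF : Fn M (fun v : M.Num × PUnit.{u+1} => F v.1))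
    {f : α → M.Num} (hf : Fn M f) : Fn M (fun v => F (f v)) :=
  .subst (F := fun a _ => F a) (hF.comp (g := fun p : M.Num × α => (p.1, ⟨⟩)) (.cons coord_fst .nil)) hf

theorem Fn.map₂ {F : M.Num → M.Num → M.Num}
    (hF : Fn M (fun v : M.Num × M.Num × PUnit.{u+1} => F v.1 v.2.1))
    {f g : α → M.Num} (hf : Fn M f) (hg : Fn M g) : Fn M (fun v => F (f v) (g v)) :=
  .subst (F := fun a v => F a (g v)) (.subst (F := fun b (w : M.Num × α) => F w.1 b)
    (hF.comp (.cons (coord_snd coord_fst) (.cons coord_fst .nil))) hg.snd) hf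

theorem Fn.map₃ {F : M.Num → M.Num → M.Num → M.Num}
    (hF : Fn M (fun v : M.Num × M.Num × M.Num × PUnit.{u+1} => F v.1 v.2.1 v.2.2.1))
    {f g h : α → M.Num} (hf : Fn M f) (hg : Fn M g) (hh : Fn M h) :
    Fn M (fun v => F (f v) (g v) (h v)) :=
  .subst (F := fun a v => F a (g v) (h v)) (.subst (F := fun b (w : M.Num × α) => F w.1 b (h w.2))
    (.subst (F := fun c (w : M.Num × M.Num × α) => F w.2.1 w.1 c)
      (hF.comp (.cons (coord_snd (coord_snd coord_fst)) (.cons (coord_snd coord_fst)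
        (.cons coord_fst .nil)))) hh.snd.snd) hg.snd) hf

theorem Fn.add {f g : α → M.Num} (hf : Fn M f) (hg : Fn M g) : Fn M (fun v => f v + g v) :=
  .map₂ (F := fun a b => a + b) (Tm.add .v0 .v1).fn hf hg

theorem Fn.mul {f g : α → M.Num} (hf : Fn M f) (hg : Fn M g) : Fn M (fun v => f v * g v) :=
  .map₂ (F := fun a b => a * b) (Tm.mul .v0 .v1).fn hf hg

theorem Fn.pair {f g : α → M.Num} (hf : Fn M f) (hg : Fn M g) :
    Fn M (fun v => M.pair (f v) (g v)) :=
  .map₂ (F := M.pair) (Tm.pair .v0 .v1).fn hf hg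

theorem Del.and {P Q : α → Prop} (hP : Del M P) (hQ : Del M Q) : Del M (fun v => P v ∧ Q v) :=
  ⟨hP.1.and hQ.1, (hP.2.or hQ.2).of_iff fun _ => not_and_or⟩

theorem Del.or {P Q : α → Prop} (hP : Del M P) (hQ : Del M Q) : Del M (fun v => P v ∨ Q v) :=
  ⟨hP.1.or hQ.1, (hP.2.and hQ.2).of_iff fun _ => not_or⟩

theorem Del.imp {P Q : α → Prop} (hP : Del M P) (hQ : Del M Q) : Del M (fun v => P v → Q v) :=
  (hP.not.or hQ).of_iff fun _ => imp_iff_not_or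

theorem Del.iff {P Q : α → Prop} (hP : Del M P) (hQ : Del M Q) : Del M (fun v => P v ↔ Q v) :=
  ((hP.imp hQ).and (hQ.imp hP)).of_iff fun _ => iff_iff_implies_and_implies

theorem Del.map₁ {R : M.Num → Prop} (hR : Del M (fun v : M.Num × PUnit.{u+1} => R v.1))
    {f : α → M.Num} (hf : Fn M f) : Del M (fun v => R (f v)) :=
  .subst (P := fun a _ => R a) (hR.comp (g := fun p : M.Num × α => (p.1, ⟨⟩)) (.cons coord_fst .nil)) hf

theorem Del.map₂ {R : M.Num → M.Num → Prop}
    (hR : Del M (fun v : M.Num × M.Num × PUnit.{u+1} => R v.1 v.2.1))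
    {f g : α → M.Num} (hf : Fn M f) (hg : Fn M g) : Del M (fun v => R (f v) (g v)) :=
  .subst (P := fun a v => R a (g v)) (.subst (P := fun b (w : M.Num × α) => R w.1 b)
    (hR.comp (.cons (coord_snd coord_fst) (.cons coord_fst .nil))) hg.snd) hf

theorem Del.eq {f g : α → M.Num} (hf : Fn M f) (hg : Fn M g) : Del M (fun v => f v = g v) :=
  .map₂ (R := fun a b => a = b) (Bdd.eq .v0 .v1).del hf hg

theorem Del.lt {f g : α → M.Num} (hf : Fn M f) (hg : Fn M g) : Del M (fun v => f v < g v) :=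
  .map₂ (R := fun a b => a < b) (Bdd.lt .v0 .v1).del hf hg

theorem Del.le {f g : α → M.Num} (hf : Fn M f) (hg : Fn M g) : Del M (fun v => f v ≤ g v) :=
  .map₂ (R := fun a b => a ≤ b) (Bdd.le .v0 .v1).del hf hg

theorem Del.mem {X : Set M.Num} (hX : X ∈ M.sets) {f : α → M.Num} (hf : Fn M f) :
    Del M (fun v => f v ∈ X) :=
  .map₁ (R := fun a => a ∈ X) (Bdd.mem hX .v0).del hf

theorem Sig.ball {P : M.Num → α → Prop} (hP : Sig M (fun p : M.Num × α => P p.1 p.2))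
    {t : α → M.Num} (ht : Fn M t) : Sig M (fun v => ∀ a < t v, P a v) :=
  .subst (P := fun b v => ∀ a < b, P a v)
    (.ball_tm (P := fun a (w : M.Num × α) => P a w.2) (hP.comp (.cons coord_fst CMap.id.snd.snd)) .v0) ht

theorem Sig.bex {P : M.Num → α → Prop} (hP : Sig M (fun p : M.Num × α => P p.1 p.2))
    {t : α → M.Num} (ht : Fn M t) : Sig M (fun v => ∃ a < t v, P a v) :=
  .ex (.and (Del.lt .v0 ht.snd).1 hP)

theorem Del.ball {P : M.Num → α → Prop} (hP : Del M (fun p : M.Num × α => P p.1 p.2))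
    {t : α → M.Num} (ht : Fn M t) : Del M (fun v => ∀ a < t v, P a v) :=
  ⟨hP.1.ball ht, (Sig.bex (P := fun a v => ¬ P a v) hP.2 ht).of_iff fun v => by simp⟩

theorem Del.bex {P : M.Num → α → Prop} (hP : Del M (fun p : M.Num × α => P p.1 p.2))
    {t : α → M.Num} (ht : Fn M t) : Del M (fun v => ∃ a < t v, P a v) :=
  (Del.ball (P := fun a v => ¬ P a v) hP.not ht).not.of_iff fun v => by simp

open Classical in
theorem Fn.ite {P : α → Prop} (hP : Del M P) {f g : α → M.Num} (hf : Fn M f) (hg : Fn M g) :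
    Fn M (fun v => if P v then f v else g v) := by
  refine Sig.of_iff (((hP.1.comp CMap.id.snd).and hf).or ((hP.2.comp CMap.id.snd).and hg)) ?_
  intro v
  by_cases h : P v.2 <;> simp [h]

theorem comprehension {P : M.Num → Prop} (hP : Del M (fun v : M.Num × PUnit.{u+1} => P v.1)) :
    {n | P n} ∈ M.sets := by
  obtain ⟨⟨Q, hQ, h⟩, ⟨R, hR, k⟩⟩ := hP
  exact hM.out.comprehension_ex hQ hR (fun n => h (n, ⟨⟩)) (fun n => k (n, ⟨⟩))

/-! ### Extremal elements -/

/-- If every element were exceeded by another, then Σ⁰₁ induction on `j` would give elements `≥ j`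
for every `j`, including `j = b + 1`. -/
theorem Sig.exists_max {P : M.Num → Prop} (hP : Sig M (fun v : M.Num × PUnit.{u+1} => P v.1))
    {a b : M.Num} (ha : P a) (hb : ∀ n, P n → n ≤ b) : ∃ m, P m ∧ ∀ n, P n → n ≤ m := by
  by_contra! H
  obtain ⟨m, hm, hP'⟩ := Sig.induction (P := fun j => ∃ m, j ≤ m ∧ P m)
    (.ex (.and (Del.le .v1 .v0).1 (hP.comp (.cons coord_fst .nil)))) ⟨a, zero_le, ha⟩
    (fun j ⟨m, hj, hm⟩ => by
      obtain ⟨n, hn, h⟩ := H m hm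
      exact ⟨n, succ_le_iff'.2 (hj.trans_lt h), hn⟩) (b + 1)
  exact (succ_le_iff'.1 hm).not_ge (hb m hP')

/-- Without a least element there would be, for every `j`, an element at least `j` below `a`; this
fails for `j = a + 1`. Stated in this way, the induction is on a Σ⁰₁ predicate although `P` itself
need not be decidable. -/
theorem Sig.exists_min {P : M.Num → Prop} (hP : Sig M (fun v : M.Num × PUnit.{u+1} => P v.1))
    {a : M.Num} (ha : P a) : ∃ m, P m ∧ ∀ n, P n → m ≤ n := by
  by_contra! H
  obtain ⟨m, hm, -⟩ := Sig.induction (P := fun j => ∃ m, m + j ≤ a ∧ P m)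
    (.ex (.and (Del.le (.add .v0 .v1) (.const _)).1 (hP.comp (.cons coord_fst .nil))))
    ⟨a, (add_zero a).le, ha⟩
    (fun j ⟨m, hj, hm⟩ => by
      obtain ⟨n, hn, h⟩ := H m hm
      refine ⟨n, le_trans ?_ hj, hn⟩
      rw [← add_assoc, add_right_comm]
      gcongr
      exact succ_le_iff'.2 h) (a + 1)
  have := (succ_le_iff'.1 (le_add_self.trans hm))
  exact lt_irrefl _ this

/-! ### Pairs -/

/-- The number `(i + j)² + i` lies strictly below `(i + j + 1)²`, so pairs with different sums have
codes between different consecutive squares. This is why pairing is injective. -/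
theorem pair_lt_of_add_lt {i j i' j' : M.Num} (h : i + j < i' + j') :
    M.pair i j < M.pair i' j' := by
  have h1 := succ_le_iff'.2 h
  calc M.pair i j = (i + j) * (i + j) + i := rfl
    _ < (i + j) * (i + j) + (i + j + (i + j) + 1) := by
        refine (add_lt_add_iff_left _).2 (lt_add_one_iff'.2 ?_)
        rw [add_assoc]; exact le_self_add
    _ = (i + j + 1) * (i + j + 1) := by ring
    _ ≤ (i' + j') * (i' + j') := mul_le_mul' h1 h1
    _ ≤ M.pair i' j' := le_self_add

theorem pair_inj {i j i' j' : M.Num} : M.pair i j = M.pair i' j' ↔ i = i' ∧ j = j' := by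
  refine ⟨fun h => ?_, fun h => by rw [h.1, h.2]⟩
  have hs : i + j = i' + j' := le_antisymm
    (not_lt.1 fun h' => (pair_lt_of_add_lt h').ne' h) (not_lt.1 fun h' => (pair_lt_of_add_lt h').ne h)
  unfold pair at h
  rw [hs, add_right_inj] at h
  subst h
  exact ⟨rfl, add_left_cancel hs⟩

theorem le_pair_left (i j : M.Num) : i ≤ M.pair i j := le_add_self

theorem le_pair_right (i j : M.Num) : j ≤ M.pair i j := by
  rcases eq_zero_or_succ j with rfl | ⟨j, rfl⟩
  · exact zero_le
  · calc j + 1 ≤ (j + 1) + ((j + 1) * i + i * (j + 1 + i) + (j + 1) * j + i) := le_self_add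
      _ = M.pair i (j + 1) := by unfold pair; ring

open Classical in
/-- The inverse of the pairing function, and `(0, 0)` where there is none. -/
noncomputable def unpair (m : M.Num) : M.Num × M.Num :=
  if h : ∃ i j, m = M.pair i j then ⟨h.choose, h.choose_spec.choose⟩ else ⟨0, 0⟩

@[simp] theorem unpair_pair (i j : M.Num) : unpair (M.pair i j) = (i, j) := by
  have h : ∃ i' j', M.pair i j = M.pair i' j' := ⟨i, j, rfl⟩
  have := pair_inj.1 h.choose_spec.choose_spec
  rw [unpair, dif_pos h]
  exact Prod.ext this.1.symm this.2.symm

theorem unpair_eq_zero {m : M.Num} (h : ¬ ∃ i j, m = M.pair i j) : unpair m = (0, 0) := dif_neg h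

theorem del_exists_pair : Del M (fun v : M.Num × PUnit.{u+1} => ∃ i j, v.1 = M.pair i j) := by
  have : Del M (fun v : M.Num × PUnit.{u+1} => ∃ i < v.1 + 1, ∃ j < v.1 + 1, v.1 = M.pair i j) := by
    apply_rules [Del.bex, Del.eq, Fn.pair, Fn.add, Fn.v0, Fn.v1, Fn.v2, Fn.const]
  refine this.of_iff fun v => ⟨fun ⟨i, j, h⟩ => ⟨i, ?_, j, ?_, h⟩, fun ⟨i, _, j, _, h⟩ => ⟨i, j, h⟩⟩
  · exact lt_add_one_iff'.2 (h ▸ le_pair_left i j)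
  · exact lt_add_one_iff'.2 (h ▸ le_pair_right i j)

theorem fn_unpair_fst : Fn M (fun v : M.Num × PUnit.{u+1} => (unpair v.1).1) := by
  have : Sig M (fun v : M.Num × M.Num × PUnit.{u+1} =>
      (∃ j, v.2.1 = M.pair v.1 j) ∨ (¬ ∃ i j, v.2.1 = M.pair i j) ∧ v.1 = 0) :=
    .or (.ex (Del.eq .v2 (.pair .v1 .v0)).1)
      (.and (del_exists_pair.comp CMap.id.snd).2 (Del.eq .v0 (.const 0)).1)
  refine this.of_iff fun ⟨y, m, _⟩ => ?_
  by_cases h : ∃ i j, m = M.pair i j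
  · obtain ⟨i, j, rfl⟩ := h
    simp [pair_inj, eq_comm]
  · simp only [unpair_eq_zero h, h]
    simp only [not_exists] at h
    simp [h]

theorem fn_unpair_snd : Fn M (fun v : M.Num × PUnit.{u+1} => (unpair v.1).2) := by
  have : Sig M (fun v : M.Num × M.Num × PUnit.{u+1} =>
      (∃ i, v.2.1 = M.pair i v.1) ∨ (¬ ∃ i j, v.2.1 = M.pair i j) ∧ v.1 = 0) :=
    .or (.ex (Del.eq .v2 (.pair .v0 .v1)).1)
      (.and (del_exists_pair.comp CMap.id.snd).2 (Del.eq .v0 (.const 0)).1)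
  refine this.of_iff fun ⟨y, m, _⟩ => ?_
  by_cases h : ∃ i j, m = M.pair i j
  · obtain ⟨i, j, rfl⟩ := h
    simp [pair_inj, eq_comm]
  · simp only [unpair_eq_zero h, h]
    simp only [not_exists] at h
    simp [h]

theorem Fn.unpair_fst {f : α → M.Num} (hf : Fn M f) : Fn M (fun v => (unpair (f v)).1) :=
  .map₁ (F := fun a => (unpair a).1) fn_unpair_fst hf

theorem Fn.unpair_snd {f : α → M.Num} (hf : Fn M f) : Fn M (fun v => (unpair (f v)).2) :=
  .map₁ (F := fun a => (unpair a).2) fn_unpair_snd hf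

theorem Fn.of_graph {f : M.Num → M.Num} (hf : Set.range (fun n => M.pair n (f n)) ∈ M.sets)
    {t : α → M.Num} (ht : Fn M t) : Fn M (fun v => f (t v)) :=
  .map₁ (F := f) ((Del.mem hf (.pair .v1 .v0)).1.of_iff fun v => by simp [pair_inj, eq_comm]) ht

/-- A number `m` is in the graph exactly if it equals the pair of its first component and the value
of `f` there, and equations between `Fn` functions are `Del`. -/
theorem graph_mem_sets {f : M.Num → M.Num} (hf : Fn M (fun v : M.Num × PUnit.{u+1} => f v.1)) :
    Set.range (fun n => M.pair n (f n)) ∈ M.sets := by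
  have : Del M (fun v : M.Num × PUnit.{u+1} => v.1 = M.pair (unpair v.1).1 (f (unpair v.1).1)) :=
    .eq .v0 (.pair (.unpair_fst .v0) (.map₁ hf (.unpair_fst .v0)))
  convert comprehension (P := fun m => m = M.pair (unpair m).1 (f (unpair m).1)) this using 1
  ext m
  constructor
  · rintro ⟨n, rfl⟩
    simp
  · intro h
    exact ⟨_, h.symm⟩

end L2Structure

namespace L2Structure

variable {M : L2Structure.{u}} [hM : Fact M.IsRCA0] {α β : Type u} [Ctx M α] [Ctx M β]

/-! ## Coding of finite sets -/

/-- The number `i` belongs to the finite set coded by the pair `c`. -/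
def InCode (c i : M.Num) : Prop := (i + 1) * (unpair c).2 + 1 ∣ (unpair c).1

/-- Replaces the subtraction `a = m * (y - x)` in a semiring without negatives. -/
theorem dvd_of_mul_add_eq_mul {m x y a : M.Num} (h : a + m * x = m * y) : m ∣ a := by
  rcases le_total x y with hxy | hxy
  · obtain ⟨z, rfl⟩ := le_iff_exists_add'.1 hxy
    exact ⟨z, by rw [mul_add, add_comm] at h; exact add_left_cancel h⟩
  · obtain ⟨z, rfl⟩ := le_iff_exists_add'.1 hxy
    rw [mul_add, add_left_comm] at h
    have : a + m * z = 0 := by simpa using h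
    rw [(add_eq_zero.1 this).1]
    exact dvd_zero _

theorem dvd_iff_exists_lt {m a : M.Num} (hm : 0 < m) : m ∣ a ↔ ∃ c < a + 1, a = m * c := by
  constructor
  · rintro ⟨c, rfl⟩
    refine ⟨c, lt_add_one_iff'.2 ?_, rfl⟩
    exact le_mul_of_one_le_left zero_le (by simpa using succ_le_iff'.2 hm)
  · rintro ⟨c, -, h⟩
    exact ⟨c, h⟩

theorem Del.dvd_succ {f g : α → M.Num} (hf : Fn M f) (hg : Fn M g) :
    Del M (fun v => f v + 1 ∣ g v) := by
  have : Del M (fun v => ∃ c < g v + 1, g v = (f v + 1) * c) := by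
    apply_rules [Del.bex, Del.eq, Fn.mul, Fn.add, Fn.v0, Fn.const, Fn.snd]
  exact this.of_iff fun v => dvd_iff_exists_lt (lt_add_one_iff'.2 zero_le)

theorem Del.inCode {f g : α → M.Num} (hf : Fn M f) (hg : Fn M g) :
    Del M (fun v => InCode (f v) (g v)) :=
  .dvd_succ (.mul (.add hg (.const 1)) hf.unpair_snd) hf.unpair_fst

theorem exists_common_multiple (n : M.Num) : ∃ b, 0 < b ∧ ∀ i < n, i + 1 ∣ b := by
  refine Sig.induction (P := fun n => ∃ b, 0 < b ∧ ∀ i < n, i + 1 ∣ b)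
    (.ex (.and (Del.lt (.const _) .v0).1 (Del.ball (.dvd_succ .v0 .v1) .v1).1))
    ⟨1, zero_lt_one, fun i hi => (not_lt_zero hi).elim⟩ (fun n ⟨b, hb, h⟩ => ?_) n
  refine ⟨b * (n + 1), mul_pos hb (lt_add_one_iff'.2 zero_le), fun i hi => ?_⟩
  rcases (lt_add_one_iff'.1 hi).lt_or_eq with hi | rfl
  · exact (h i hi).mul_right _
  · exact dvd_mul_left _ _

/-- The moduli used in coding finite sets are pairwise coprime. -/
theorem dvd_of_dvd_mul_modulus {n b i j a : M.Num} (hb : ∀ i < n, i + 1 ∣ b) (hi : i < n)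
    (hj : j < n) (hij : i ≠ j) (h : (j + 1) * b + 1 ∣ a * ((i + 1) * b + 1)) :
    (j + 1) * b + 1 ∣ a := by
  obtain ⟨q, hq⟩ := h
  rcases hij.lt_or_gt with hlt | hlt
  · obtain ⟨d, rfl⟩ := lt_iff_exists_succ.1 hlt
    obtain ⟨c, hc⟩ := hb d (lt_of_le_of_lt (by rw [add_assoc, add_left_comm]; exact le_self_add) hj)
    refine dvd_of_mul_add_eq_mul (x := (i + 1) * (i + d + 1 + 1) * c * q)
      (y := q + (i + 1) * (i + 1) * c * a) ?_
    -- A Bézout identity without subtraction. Write `μ_i` for `(i + 1) * b + 1`. Here `j = i + d +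
    -- 1` and `b = (d + 1) * c`, so `(j + 1) μ_i - (i + 1) μ_j = d + 1`, and multiplication by `(i +
    -- 1) * c` yields `μ_i - 1`. The equation is `a` times this, with the negative terms moved
    -- across.
    have e : a + (i + 1) * (i + d + 1 + 1) * c * (a * ((i + 1) * b + 1)) =
        a * ((i + 1) * b + 1) + (i + 1) * (i + 1) * c * a * ((i + d + 1 + 1) * b + 1) := by
      rw [hc]; ring
    rw [hq] at e
    linear_combination e
  · obtain ⟨d, rfl⟩ := lt_iff_exists_succ.1 hlt
    obtain ⟨c, hc⟩ := hb d (lt_of_le_of_lt (by rw [add_assoc, add_left_comm]; exact le_self_add) hi)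
    refine dvd_of_mul_add_eq_mul (x := (j + d + 1 + 1) * (j + d + 1 + 1) * c * a)
      (y := q + (j + d + 1 + 1) * (j + 1) * c * q) ?_
    -- The same with `i = j + d + 1`: now `(i + 1) μ_j - (j + 1) μ_i = d + 1`, and multiplication by
    -- `(i + 1) * c` gives `μ_i - 1` again.
    have e : a + (j + d + 1 + 1) * (j + d + 1 + 1) * c * a * ((j + 1) * b + 1) =
        a * ((j + d + 1 + 1) * b + 1) + (j + d + 1 + 1) * (j + 1) * c * (a * ((j + d + 1 + 1) * b + 1)) := by
      rw [hc]; ring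
    rw [hq] at e
    linear_combination e

theorem not_modulus_dvd_one {b i : M.Num} (hb : 0 < b) : ¬ (i + 1) * b + 1 ∣ 1 := by
  rintro ⟨c, hc⟩
  have h1 : 0 < (i + 1) * b := mul_pos (lt_add_one_iff'.2 zero_le) hb
  rcases eq_zero_or_succ c with rfl | ⟨c, rfl⟩
  · simp at hc
  · have h2 : (1 : M.Num) = 1 + ((i + 1) * b + ((i + 1) * b + 1) * c) :=
      hc.trans (by ring)
    have h3 := (add_eq_zero.1 (left_eq_add.1 h2)).1
    exact h1.ne' h3

/-- The code is the product of the moduli of the elements of `P`, built by Σ⁰₁ induction. Since the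
moduli are pairwise coprime, no further modulus below `n` divides the product. -/
theorem exists_code {P : M.Num → Prop} (hP : Del M (fun v : M.Num × PUnit.{u+1} => P v.1))
    (n : M.Num) : ∃ c, ∀ i < n, InCode c i ↔ P i := by
  obtain ⟨b, hb0, hb⟩ := exists_common_multiple n
  suffices ∀ m, ∃ a, ∀ i < n, (i + 1) * b + 1 ∣ a ↔ i < m ∧ P i by
    obtain ⟨a, ha⟩ := this n
    exact ⟨M.pair a b, fun i hi => by simp [InCode, ha i hi, hi]⟩
  refine Sig.induction (.ex (Del.ball (.iff ?_ (.and (.lt .v0 .v2) ?_)) (.const _)).1)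
    ⟨1, fun i _ => by simp [not_modulus_dvd_one hb0]⟩ (fun m ⟨a, ha⟩ => ?_)
  · exact .dvd_succ (.mul (.add .v0 (.const 1)) (.const _)) .v1
  · exact .map₁ hP .v0
  by_cases hm : m < n ∧ P m
  · refine ⟨a * ((m + 1) * b + 1), fun i hi => ?_⟩
    rcases eq_or_ne i m with rfl | hne
    · simp [hm.2]
    · rw [lt_add_one_iff', le_iff_lt_or_eq, or_iff_left hne, ← ha i hi]
      exact ⟨dvd_of_dvd_mul_modulus hb hm.1 hi hne.symm, fun h => h.mul_right _⟩
  · refine ⟨a, fun i hi => (ha i hi).trans ⟨fun h => ⟨lt_add_one_iff'.2 h.1.le, h.2⟩, fun h => ⟨?_, h.2⟩⟩⟩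
    refine (lt_add_one_iff'.1 h.1).lt_of_ne ?_
    rintro rfl
    exact hm ⟨hi, h.2⟩

/-! ## Strong bounding of witnesses -/

/-- Unlike in `collection`, some `i < k` may have no witness, and which ones do is not decidable.
Let `A` be a positive common multiple of the moduli of all `i < k`. Consider factorizations `A = a *
c` in which every modulus divides `c`, or else divides `a` and has a witness below some common `m`.
The possible `a` form a bounded Σ⁰₁ set, and the `m` that goes with the largest one is the required
bound. -/
theorem strong_collection {P : M.Num → M.Num → Prop}
    (hP : Sig M (fun v : M.Num × M.Num × PUnit.{u+1} => P v.1 v.2.1)) (k : M.Num) :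
    ∃ m, ∀ i < k, (∃ n, P i n) → ∃ n < m, P i n := by
  obtain ⟨b, hb0, hb⟩ := exists_common_multiple k
  obtain ⟨A, hA0, hA⟩ : ∃ A, 0 < A ∧ ∀ i < k, (i + 1) * b + 1 ∣ A := by
    suffices ∀ m, ∃ A, 0 < A ∧ ∀ i < m, (i + 1) * b + 1 ∣ A from this k
    refine Sig.induction (.ex (.and (Del.lt (.const _) .v0).1 (Del.ball (.dvd_succ
      (.mul (.add .v0 (.const 1)) (.const _)) .v1) .v1).1))
      ⟨1, zero_lt_one, fun i hi => (not_lt_zero hi).elim⟩ (fun m ⟨A, hA0, hA⟩ => ?_)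
    refine ⟨A * ((m + 1) * b + 1), mul_pos hA0 (lt_add_one_iff'.2 zero_le), fun i hi => ?_⟩
    rcases (lt_add_one_iff'.1 hi).lt_or_eq with hi | rfl
    · exact (hA i hi).mul_right _
    · exact dvd_mul_left _ _
  obtain ⟨a, ⟨m, c, hac, hm⟩, hmax⟩ := Sig.exists_max (P := fun a => ∃ m c, a * c = A ∧
      ∀ i < k, ((i + 1) * b + 1 ∣ a ∧ ∃ n < m, P i n) ∨ (i + 1) * b + 1 ∣ c) (by
    refine .ex (.ex (.and (Del.eq (.mul .v2 .v0) (.const _)).1 (.ball (.or (.and ?_ (.bex ?_ ?_)) ?_)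
      (.const _))))
    · exact (Del.dvd_succ (.mul (.add .v0 (.const 1)) (.const _)) .v3).1
    · exact hP.comp (.cons (coord_snd coord_fst) (.cons coord_fst .nil))
    · exact .v2
    · exact (Del.dvd_succ (.mul (.add .v0 (.const 1)) (.const _)) .v1).1)
    (a := 1) (b := A) ⟨0, A, one_mul _, fun i hi => Or.inr (hA i hi)⟩ (by
      rintro a ⟨-, c, rfl, -⟩
      refine le_mul_of_one_le_right zero_le ?_
      rw [← zero_add (1 : M.Num), succ_le_iff']
      exact pos_of_mul_pos_right hA0 zero_le)
  refine ⟨m, fun i hi ⟨n, hn⟩ => ?_⟩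
  rcases hm i hi with h | ⟨c', rfl⟩
  · exact h.2
  exfalso
  have ha0 : 0 < a := pos_of_mul_pos_left (hac ▸ hA0) zero_le
  -- The index `i` has a witness `n` while its modulus still divides the cofactor. Moving the
  -- modulus to `a` and raising the bound beyond `n` gives a larger admissible `a`; by coprimality
  -- the other moduli keep their places.
  refine (hmax (a * ((i + 1) * b + 1)) ⟨m + n + 1, c', by rw [mul_assoc, hac], fun j hj => ?_⟩).not_gt ?_
  · rcases eq_or_ne i j with rfl | hij
    · exact Or.inl ⟨dvd_mul_left _ _, n, lt_add_one_iff'.2 le_add_self, hn⟩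
    · rcases hm j hj with ⟨h, l, hl, hP⟩ | h
      · exact Or.inl ⟨h.mul_right _, l, hl.trans_le (by rw [add_assoc]; exact le_self_add), hP⟩
      · exact Or.inr (dvd_of_dvd_mul_modulus hb hi hj hij (by rwa [mul_comm c']))
  · refine lt_mul_of_one_lt_right ha0 ?_
    rw [lt_add_iff_pos_left]
    exact mul_pos (lt_add_one_iff'.2 zero_le) hb0

/-! ## Primitive recursion -/

section Recursion

variable (g : M.Num → M.Num) (G : M.Num → M.Num → M.Num → M.Num)

/-- `c` codes, below `N`, a set of pairs `(i, v)` that is justified by the recursion. -/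
def IsTrace (x c N : M.Num) : Prop :=
  ∀ s < N, InCode c s → s = M.pair 0 (g x) ∨ ∃ i < N, ∃ v < N, M.pair i v < N ∧
    InCode c (M.pair i v) ∧ s = M.pair (i + 1) (G x i v)

/-- The graph of the function defined by recursion. -/
def RecGraph (x j y : M.Num) : Prop :=
  ∃ c N, IsTrace g G x c N ∧ M.pair j y < N ∧ InCode c (M.pair j y)

variable {g G} (hg : Fn M (fun v : M.Num × PUnit.{u+1} => g v.1))
  (hG : Fn M (fun v : M.Num × M.Num × M.Num × PUnit.{u+1} => G v.1 v.2.1 v.2.2.1))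

include hg hG in
theorem sig_recGraph : Sig M (fun v : M.Num × M.Num × M.Num × PUnit.{u+1} =>
    RecGraph g G v.1 v.2.1 v.2.2.1) := by
  refine .ex (.ex (.and (Del.ball (.imp ?_ (.or ?_ (.bex (.bex (.and ?_ (.and ?_ ?_)) ?_) ?_)))
    ?_).1 (.and (Del.lt ?_ ?_).1 (Del.inCode ?_ ?_).1)))
  · exact .inCode .v2 .v0
  · exact .eq .v0 (.pair (.const _) (.map₁ hg .v3))
  · exact .lt (.pair .v1 .v0) .v3
  · exact .inCode .v4 (.pair .v1 .v0)
  · exact .eq .v2 (.pair (.add .v1 (.const _)) (.map₃ hG .v5 .v1 .v0))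
  · exact .v2
  · exact .v1
  all_goals apply_rules [Fn.pair, Fn.v0, Fn.v1, Fn.v2, Fn.v3, Fn.v4]

/-- With both traces fixed all quantifiers are bounded, so induction on `j` applies: a pair at stage
`j + 1` is justified in its trace by a pair at stage `j`. -/
theorem RecGraph.unique {x j y y' : M.Num} (h : RecGraph g G x j y) (h' : RecGraph g G x j y') :
    y = y' := by
  obtain ⟨c, N, hT, hN, hc⟩ := h
  obtain ⟨c', N', hT', hN', hc'⟩ := h'
  have key : ∀ j, ∀ y < N, ∀ y' < N', M.pair j y < N → InCode c (M.pair j y) →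
      M.pair j y' < N' → InCode c' (M.pair j y') → y = y' := by
    refine Sig.induction (P := fun j => ∀ y < N, ∀ y' < N', M.pair j y < N →
      InCode c (M.pair j y) → M.pair j y' < N' → InCode c' (M.pair j y') → y = y') ?_ ?_ ?_
    · refine (Del.ball (.ball ?_ (.const _)) (.const _)).1
      apply_rules [Del.imp, Del.lt, Del.inCode, Del.eq, Fn.pair, Fn.const, Fn.v0, Fn.v1, Fn.v2]
    · intro y _ y' _ hN hc hN' hc'
      have e := hT _ hN hc
      have e' := hT' _ hN' hc'
      have h0 : ∀ i : M.Num, 0 ≠ i + 1 := fun i => (lt_add_one_iff'.2 zero_le).ne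
      simp only [pair_inj, h0, false_and, and_false, exists_false, or_false, true_and] at e e'
      rw [e, e']
    · intro j ih y _ y' _ hN hc hN' hc'
      have e := hT _ hN hc
      have e' := hT' _ hN' hc'
      have h0 : ∀ i : M.Num, i + 1 ≠ 0 := fun i => (lt_add_one_iff'.2 zero_le).ne'
      simp only [pair_inj, h0, false_and, false_or, add_left_inj] at e e'
      obtain ⟨i, hi, v, hv, kN, kc, rfl, rfl⟩ := e
      obtain ⟨i', hi', v', hv', kN', kc', rfl, rfl⟩ := e'
      rw [ih v hv v' hv' kN kc kN' kc']
  exact key j y ((le_pair_right _ _).trans_lt hN) y' ((le_pair_right _ _).trans_lt hN') hN hc hN' hc'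

theorem recGraph_zero (x : M.Num) : RecGraph g G x 0 (g x) := by
  obtain ⟨c, hc⟩ := exists_code (P := fun s => s = M.pair 0 (g x)) (.eq .v0 (.const _))
    (M.pair 0 (g x) + 1)
  have h := lt_add_one_iff'.2 (le_refl (M.pair 0 (g x)))
  exact ⟨c, _, fun s hs h => Or.inl ((hc s hs).1 h), h, (hc _ h).2 rfl⟩

theorem RecGraph.succ {x j y : M.Num} (h : RecGraph g G x j y) :
    RecGraph g G x (j + 1) (G x j y) := by
  obtain ⟨c, N, hT, hN, hc⟩ := h
  set p := M.pair (j + 1) (G x j y) with hp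
  obtain ⟨d, hd⟩ := exists_code (P := fun s => s < N ∧ InCode c s ∨ s = p)
    (.or (.and (.lt .v0 (.const _)) (.inCode (.const _) .v0)) (.eq .v0 (.const _))) (N + p + 1)
  have hlt : ∀ {s}, s < N → s < N + p + 1 := fun hs =>
    hs.trans_le (by rw [add_assoc]; exact le_self_add)
  have hpl : p < N + p + 1 := lt_add_one_iff'.2 le_add_self
  refine ⟨d, N + p + 1, fun s hs h => ?_, hpl, (hd _ hpl).2 (Or.inr rfl)⟩
  rcases (hd s hs).1 h with ⟨hsN, hsc⟩ | rfl
  · rcases hT s hsN hsc with h | ⟨i, hi, v, hv, hl, hm, h⟩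
    · exact Or.inl h
    · exact Or.inr ⟨i, hlt hi, v, hlt hv, hlt hl, (hd _ (hlt hl)).2 (Or.inl ⟨hl, hm⟩), h⟩
  · exact Or.inr ⟨j, hlt ((le_pair_left _ _).trans_lt hN), y, hlt ((le_pair_right _ _).trans_lt hN),
      hlt hN, (hd _ (hlt hN)).2 (Or.inl ⟨hN, hc⟩), rfl⟩

include hg hG in
theorem exists_recGraph (x j : M.Num) : ∃ y, RecGraph g G x j y :=
  Sig.induction (P := fun j => ∃ y, RecGraph g G x j y) (.ex ((sig_recGraph hg hG).comp
    (.cons (Ctx.const_mem _) (.cons (coord_snd coord_fst) (.cons coord_fst .nil)))))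
    ⟨_, recGraph_zero x⟩ (fun _ ⟨_, h⟩ => ⟨_, h.succ⟩) j

include hg hG in
/-- Definition of functions by recursion with a parameter. -/
theorem exists_rec : ∃ f : M.Num → M.Num → M.Num,
    Fn M (fun v : M.Num × M.Num × PUnit.{u+1} => f v.1 v.2.1) ∧
    (∀ x, f x 0 = g x) ∧ ∀ x j, f x (j + 1) = G x j (f x j) := by
  choose f hf using exists_recGraph hg hG
  refine ⟨f, ?_, fun x => (hf x 0).unique (recGraph_zero x), fun x j => (hf x _).unique (hf x j).succ⟩
  refine ((sig_recGraph hg hG).comp (g := fun v : M.Num × M.Num × M.Num × PUnit.{u+1} =>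
    (v.2.1, v.2.2.1, v.1, ⟨⟩)) ?_).of_iff fun v => ⟨fun h => ?_, fun h => h.unique (hf _ _)⟩
  · exact .cons (coord_snd coord_fst) (.cons (coord_snd (coord_snd coord_fst)) (.cons coord_fst .nil))
  · exact h ▸ hf _ _

end Recursion

/-! ## Powers of two -/

theorem exists_twoPow : ∃ p : M.Num → M.Num, Fn M (fun v : M.Num × PUnit.{u+1} => p v.1) ∧
    p 0 = 1 ∧ ∀ i, p (i + 1) = p i + p i := by
  obtain ⟨f, hf, h0, hs⟩ := exists_rec (g := fun _ : M.Num => 1) (G := fun _ _ v => v + v)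
    (.const _) (.add .v2 .v2)
  exact ⟨f 0, hf.comp (.cons (Ctx.const_mem _) (.cons coord_fst .nil)), h0 0, hs 0⟩

variable (M) in
/-- The function `k ↦ 2 ^ k`. -/
noncomputable def two : M.Num → M.Num := exists_twoPow.choose

theorem fn_two : Fn M (fun v : M.Num × PUnit.{u+1} => M.two v.1) := exists_twoPow.choose_spec.1
theorem two_zero : M.two 0 = 1 := exists_twoPow.choose_spec.2.1
theorem two_succ (k : M.Num) : M.two (k + 1) = M.two k + M.two k := exists_twoPow.choose_spec.2.2 k

/-- A function satisfying the recursion is determined by induction, which is available since its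
graph belongs to `M`. -/
theorem twoPow_iff {k m : M.Num} : M.TwoPow k m ↔ m = M.two k := by
  constructor
  · rintro ⟨p, hp, h0, hs, rfl⟩
    refine Sig.induction (P := fun k => p k = M.two k)
      (Del.eq (.of_graph hp .v0) (.map₁ fn_two .v0)).1 ?_ (fun k ih => ?_) k
    · rw [h0, two_zero]
    · rw [hs, two_succ, ih]
  · rintro rfl
    exact ⟨M.two, graph_mem_sets fn_two, two_zero, two_succ, rfl⟩

theorem lt_two (k : M.Num) : k < M.two k := by
  refine Sig.induction (P := fun k => k < M.two k) (Del.lt .v0 (.map₁ fn_two .v0)).1 ?_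
    (fun k ih => ?_) k
  · rw [two_zero]; exact zero_lt_one
  · rw [two_succ]
    exact add_lt_add_of_lt_of_le ih (by simpa using succ_le_iff'.2 (zero_le.trans_lt ih))

theorem two_pos (k : M.Num) : 0 < M.two k := zero_le.trans_lt (lt_two k)

variable (M) in
/-- The number `2 ^ k - 1`. -/
noncomputable def predTwo (k : M.Num) : M.Num := (eq_succ_of_pos (two_pos k)).choose

theorem predTwo_add_one (k : M.Num) : M.predTwo k + 1 = M.two k :=
  (eq_succ_of_pos (two_pos k)).choose_spec.symm

theorem fn_predTwo : Fn M (fun v : M.Num × PUnit.{u+1} => M.predTwo v.1) :=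
  Sig.of_iff (Del.eq (.add .v0 (.const 1)) (.map₁ fn_two .v1)).1 fun v => by
    rw [← predTwo_add_one, add_left_inj]

end L2Structure

/-! ## The ordered field of fractions of an ordered semiring -/

section Differences

variable (N : Type u) [CommSemiring N] [LinearOrder N] [IsStrictOrderedRing N]
  [CanonicallyOrderedAdd N]

/-- Pairs with the same difference. -/
def diffSetoid : Setoid (N × N) where
  r p q := p.1 + q.2 = q.1 + p.2
  iseqv := ⟨fun _ => rfl, fun h => h.symm, fun {p q r} h k => by
    refine add_right_cancel (b := q.1 + q.2) ?_
    linear_combination h + k⟩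

/-- The ring of formal differences. -/
def Differences : Type u := Quotient (diffSetoid N)

namespace Differences

variable {N}

/-- The difference `a - b`. -/
def mk (a b : N) : Differences N := Quotient.mk (diffSetoid N) (a, b)

theorem mk_eq_mk {a b c d : N} : mk a b = mk c d ↔ a + d = c + b :=
  ⟨fun h => Quotient.exact h, fun h => Quotient.sound (s := diffSetoid N) h⟩

theorem ind {P : Differences N → Prop} (h : ∀ a b, P (mk a b)) (x) : P x :=
  Quotient.ind (fun p => h p.1 p.2) x

instance : Zero (Differences N) := ⟨mk 0 0⟩
instance : One (Differences N) := ⟨mk 1 0⟩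

instance : Add (Differences N) where
  add := Quotient.map₂ (fun p q => (p.1 + q.1, p.2 + q.2)) fun p p' h q q' h' => by
    change p.1 + q.1 + (p'.2 + q'.2) = p'.1 + q'.1 + (p.2 + q.2)
    replace h : p.1 + p'.2 = p'.1 + p.2 := h
    replace h' : q.1 + q'.2 = q'.1 + q.2 := h'
    linear_combination h + h'

instance : Neg (Differences N) where
  neg := Quotient.map (fun p => (p.2, p.1)) fun p p' h => by
    change p.2 + p'.1 = p'.2 + p.1
    replace h : p.1 + p'.2 = p'.1 + p.2 := h
    linear_combination -h

instance : Mul (Differences N) where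
  mul := Quotient.map₂ (fun p q => (p.1 * q.1 + p.2 * q.2, p.1 * q.2 + p.2 * q.1))
    fun p p' h q q' h' => by
    change p.1 * q.1 + p.2 * q.2 + (p'.1 * q'.2 + p'.2 * q'.1) =
      p'.1 * q'.1 + p'.2 * q'.2 + (p.1 * q.2 + p.2 * q.1)
    replace h : p.1 + p'.2 = p'.1 + p.2 := h
    replace h' : q.1 + q'.2 = q'.1 + q.2 := h'
    refine add_right_cancel (b := p'.2 * q.1 + p'.1 * q.2) ?_
    linear_combination h * q.1 + h.symm * q.2 + p'.1 * h' + p'.2 * h'.symm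

theorem mk_add (a b c d : N) : mk a b + mk c d = mk (a + c) (b + d) := rfl
theorem mk_mul (a b c d : N) : mk a b * mk c d = mk (a * c + b * d) (a * d + b * c) := rfl
theorem neg_mk (a b : N) : -mk a b = mk b a := rfl

instance : CommRing (Differences N) where
  add_assoc := ind fun a b => ind fun c d => ind fun e f => by
    simp only [mk_add, add_assoc]
  zero_add := ind fun a b => by rw [show (0 : Differences N) = mk 0 0 from rfl, mk_add]; simp
  add_zero := ind fun a b => by rw [show (0 : Differences N) = mk 0 0 from rfl, mk_add]; simp
  add_comm := ind fun a b => ind fun c d => by simp only [mk_add, add_comm]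
  neg_add_cancel := ind fun a b => by
    rw [neg_mk, mk_add, show (0 : Differences N) = mk 0 0 from rfl, mk_eq_mk]; ring
  mul_assoc := ind fun a b => ind fun c d => ind fun e f => by
    simp only [mk_mul, mk_eq_mk]; ring
  mul_comm := ind fun a b => ind fun c d => by simp only [mk_mul, mk_eq_mk]; ring
  one_mul := ind fun a b => by rw [show (1 : Differences N) = mk 1 0 from rfl, mk_mul]; simp
  mul_one := ind fun a b => by rw [show (1 : Differences N) = mk 1 0 from rfl, mk_mul]; simp
  zero_mul := ind fun a b => by rw [show (0 : Differences N) = mk 0 0 from rfl, mk_mul]; simp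
  mul_zero := ind fun a b => by rw [show (0 : Differences N) = mk 0 0 from rfl, mk_mul]; simp
  left_distrib := ind fun a b => ind fun c d => ind fun e f => by
    simp only [mk_mul, mk_add, mk_eq_mk]; ring
  right_distrib := ind fun a b => ind fun c d => ind fun e f => by
    simp only [mk_mul, mk_add, mk_eq_mk]; ring
  nsmul := nsmulRec
  zsmul := zsmulRec

/-- The embedding of the semiring. -/
def of : N →+* Differences N where
  toFun a := mk a 0
  map_zero' := rfl
  map_one' := rfl
  map_add' a b := by rw [mk_add, add_zero]
  map_mul' a b := by rw [mk_mul]; simp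

theorem of_injective : Function.Injective (of (N := N)) := fun a b h => by
  simpa using mk_eq_mk.1 (show mk a 0 = mk b 0 from h)

theorem eq_of_or_neg (x : Differences N) : ∃ a, x = of a ∨ x = -of a := by
  induction x using ind with
  | h a b =>
    rcases le_total a b with h | h
    · obtain ⟨c, rfl⟩ := exists_add_of_le h
      exact ⟨c, Or.inr (mk_eq_mk.2 (by ring))⟩
    · obtain ⟨c, rfl⟩ := exists_add_of_le h
      exact ⟨c, Or.inl (mk_eq_mk.2 (by ring))⟩

instance : Nontrivial (Differences N) := of_injective.nontrivial

instance : NoZeroDivisors (Differences N) where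
  eq_zero_or_eq_zero_of_mul_eq_zero {x y} h := by
    obtain ⟨a, ha⟩ := eq_of_or_neg x
    obtain ⟨b, hb⟩ := eq_of_or_neg y
    have : of (a * b) = 0 := by rcases ha with rfl | rfl <;> rcases hb with rfl | rfl <;> simpa using h
    rw [← map_zero of] at this
    rcases mul_eq_zero.1 (of_injective this) with rfl | rfl
    · left; simpa using ha
    · right; simpa using hb

instance : IsDomain (Differences N) := NoZeroDivisors.to_isDomain _

end Differences

/-- The field of fractions of an ordered semiring. -/
def Fractions : Type u := FractionRing (Differences N)

namespace Fractions

noncomputable instance : Field (Fractions N) := inferInstanceAs (Field (FractionRing (Differences N)))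

/-- The embedding of the semiring. -/
noncomputable def of : N →+* Fractions N :=
  (algebraMap (Differences N) (FractionRing (Differences N))).comp Differences.of

theorem of_injective : Function.Injective (of N) :=
  fun _ _ h => Differences.of_injective
    (IsFractionRing.injective (Differences N) (FractionRing (Differences N)) h)

variable {N} in
theorem of_ne_zero {a : N} (h : a ≠ 0) : of N a ≠ 0 := (map_ne_zero_iff _ (of_injective N)).2 h

/-- The cone of the nonnegative fractions. -/
noncomputable def cone : RingCone (Fractions N) where
  carrier := {x | ∃ a b, b ≠ 0 ∧ x = of N a / of N b}
  zero_mem' := ⟨0, 1, one_ne_zero, by simp⟩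
  one_mem' := ⟨1, 1, one_ne_zero, by simp⟩
  add_mem' := by
    rintro _ _ ⟨a, b, hb, rfl⟩ ⟨c, d, hd, rfl⟩
    refine ⟨a * d + b * c, b * d, mul_ne_zero hb hd, ?_⟩
    have := of_ne_zero hb
    have := of_ne_zero hd
    rw [map_add, map_mul, map_mul, map_mul]
    field_simp
  mul_mem' := by
    rintro _ _ ⟨a, b, hb, rfl⟩ ⟨c, d, hd, rfl⟩
    exact ⟨a * c, b * d, mul_ne_zero hb hd, by rw [map_mul, map_mul, div_mul_div_comm]⟩
  eq_zero_of_mem_of_neg_mem' := by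
    rintro _ ⟨a, b, hb, rfl⟩ ⟨c, d, hd, h⟩
    have hb' := of_ne_zero hb
    have hd' := of_ne_zero hd
    have : of N (a * d + b * c) = of N 0 := by
      rw [map_add, map_mul, map_mul, map_zero]
      field_simp at h
      linear_combination -h
    have := (add_eq_zero.1 (of_injective N this)).1
    rw [(mul_eq_zero.1 this).resolve_right hd]
    simp

instance : HasMemOrNegMem (cone N) where
  mem_or_neg_mem x := by
    obtain ⟨a, b, hb, rfl⟩ := IsFractionRing.div_surjective (A := Differences N)
      (K := FractionRing (Differences N)) x
    obtain ⟨c, hc⟩ := Differences.eq_of_or_neg a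
    obtain ⟨d, hd⟩ := Differences.eq_of_or_neg b
    have hd0 : d ≠ 0 := by
      rintro rfl
      exact nonZeroDivisors.ne_zero hb (by simpa using hd)
    rcases hc with rfl | rfl <;> rcases hd with rfl | rfl
    · exact Or.inl ⟨c, d, hd0, rfl⟩
    · refine Or.inr ⟨c, d, hd0, ?_⟩
      rw [map_neg, div_neg]; exact neg_neg (of N c / of N d)
    · refine Or.inr ⟨c, d, hd0, ?_⟩
      rw [map_neg, neg_div]; exact neg_neg (of N c / of N d)
    · refine Or.inl ⟨c, d, hd0, ?_⟩
      rw [map_neg, map_neg, neg_div_neg_eq]; rfl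

theorem exists_eq_div (x : Fractions N) :
    ∃ a b, b ≠ 0 ∧ (x = of N a / of N b ∨ x = -(of N a / of N b)) := by
  rcases mem_or_neg_mem (cone N) x with ⟨a, b, hb, h⟩ | ⟨a, b, hb, h⟩
  · exact ⟨a, b, hb, Or.inl h⟩
  · exact ⟨a, b, hb, Or.inr (by rw [← h, neg_neg])⟩

open Classical in
noncomputable instance : LinearOrder (Fractions N) := .mkOfAddGroupCone (cone N)

instance : IsOrderedRing (Fractions N) := .mkOfCone (cone N)

instance : IsStrictOrderedRing (Fractions N) := IsOrderedRing.toIsStrictOrderedRing _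

theorem of_strictMono : StrictMono (of N) := by
  refine Monotone.strictMono_of_injective (fun a b h => ?_) (of_injective N)
  obtain ⟨c, rfl⟩ := exists_add_of_le h
  exact ⟨c, 1, one_ne_zero, by simp⟩

end Fractions

end Differences

/-! ## Limits along an ultrafilter -/

section Limits

open Filter

variable (K : Type u) [Field K] [LinearOrder K] [IsStrictOrderedRing K] {I : Type u}
  (U : Ultrafilter I)

/-- The functions that are bounded along the ultrafilter. -/
def boundedFns : Subring (I → K) where
  carrier := {f | ∃ B, ∀ᶠ i in U, |f i| ≤ B}
  zero_mem' := ⟨0, by simp⟩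
  one_mem' := ⟨1, by simp⟩
  add_mem' := by
    rintro f g ⟨B, hB⟩ ⟨C, hC⟩
    exact ⟨B + C, by filter_upwards [hB, hC] with i h h' using (abs_add_le _ _).trans (add_le_add h h')⟩
  mul_mem' := by
    rintro f g ⟨B, hB⟩ ⟨C, hC⟩
    refine ⟨B * C, ?_⟩
    filter_upwards [hB, hC] with i h h'
    rw [Pi.mul_apply, abs_mul]
    exact mul_le_mul h h' (abs_nonneg _) ((abs_nonneg _).trans h)
  neg_mem' := by
    rintro f ⟨B, hB⟩
    exact ⟨B, by simpa using hB⟩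

/-- The functions with limit zero along the ultrafilter. -/
def nullFns : Ideal (boundedFns K U) where
  carrier := {f | ∀ ε > 0, ∀ᶠ i in U, |f.1 i| ≤ ε}
  zero_mem' ε hε := by simp [hε.le]
  add_mem' {f g} hf hg ε hε := by
    filter_upwards [hf (ε / 2) (half_pos hε), hg (ε / 2) (half_pos hε)] with i h h'
    exact (abs_add_le _ _).trans ((add_le_add h h').trans (add_halves ε).le)
  smul_mem' := by
    rintro ⟨f, B, hB⟩ g hg ε hε
    have hB0 : 0 < |B| + 1 := by positivity
    filter_upwards [hB, hg (ε / (|B| + 1)) (div_pos hε hB0)] with i h h'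
    change |f i * g.1 i| ≤ ε
    rw [abs_mul]
    calc |f i| * |g.1 i| ≤ (|B| + 1) * (ε / (|B| + 1)) :=
          mul_le_mul (h.trans ((le_abs_self B).trans (by linarith))) h' (abs_nonneg _) hB0.le
      _ = ε := by field_simp

variable {K U} in
theorem mem_nullFns {f : boundedFns K U} : f ∈ nullFns K U ↔ ∀ ε > 0, ∀ᶠ i in U, |f.1 i| ≤ ε := Iff.rfl

/-- Along an ultrafilter a function that is not null is bounded away from zero on a large set. A
product of two such functions is then bounded away from zero too. -/
instance : (nullFns K U).IsPrime where
  ne_top' h := by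
    have := (nullFns K U).eq_top_iff_one.1 h (1 / 2) (by positivity)
    obtain ⟨i, hi⟩ := this.exists
    change |(1 : K)| ≤ 1 / 2 at hi
    rw [abs_one] at hi
    linarith
  mem_or_mem' {f g} h := by
    by_contra! H
    simp only [mem_nullFns, not_forall, not_le, exists_prop,
      ← Ultrafilter.eventually_not] at H
    obtain ⟨⟨a, ha, hf⟩, b, hb, hg⟩ := H
    obtain ⟨i, h1, h2, h3⟩ := ((h (a * b / 2) (by positivity)).and (hf.and hg)).exists
    change |f.1 i * g.1 i| ≤ _ at h1
    rw [abs_mul] at h1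
    have := mul_lt_mul'' h2 h3 ha.le hb.le
    have : 0 < a * b := by positivity
    linarith

/-- The ring of limits along the ultrafilter. -/
def Limits : Type u := boundedFns K U ⧸ nullFns K U

namespace Limits

noncomputable instance : CommRing (Limits K U) :=
  inferInstanceAs (CommRing (boundedFns K U ⧸ nullFns K U))

instance : IsDomain (Limits K U) := inferInstanceAs (IsDomain (boundedFns K U ⧸ nullFns K U))

/-- The limit of a bounded function. -/
noncomputable def lim : boundedFns K U →+* Limits K U := Ideal.Quotient.mk (nullFns K U)

theorem lim_surjective : Function.Surjective (lim K U) := Ideal.Quotient.mk_surjective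

variable {K U} in
theorem lim_eq_zero {f : boundedFns K U} : lim K U f = 0 ↔ f ∈ nullFns K U :=
  Ideal.Quotient.eq_zero_iff_mem

/-- The cone of the nonnegative limits. -/
noncomputable def cone : RingCone (Limits K U) where
  carrier := {x | ∃ f : boundedFns K U, (∀ᶠ i in U, 0 ≤ f.1 i) ∧ x = lim K U f}
  zero_mem' := ⟨0, by simp, (map_zero _).symm⟩
  one_mem' := ⟨1, by simp, (map_one _).symm⟩
  add_mem' := by
    rintro _ _ ⟨f, hf, rfl⟩ ⟨g, hg, rfl⟩
    exact ⟨f + g, by filter_upwards [hf, hg] with i h h' using add_nonneg h h', (map_add _ _ _).symm⟩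
  mul_mem' := by
    rintro _ _ ⟨f, hf, rfl⟩ ⟨g, hg, rfl⟩
    exact ⟨f * g, by filter_upwards [hf, hg] with i h h' using mul_nonneg h h', (map_mul _ _ _).symm⟩
  eq_zero_of_mem_of_neg_mem' := by
    rintro _ ⟨f, hf, rfl⟩ ⟨g, hg, h⟩
    rw [lim_eq_zero]
    have h' : lim K U (f + g) = 0 := by rw [map_add, ← h, add_neg_cancel]
    rw [lim_eq_zero] at h'
    intro ε hε
    filter_upwards [hf, hg, h' ε hε] with i hf hg h
    replace h : |f.1 i + g.1 i| ≤ ε := h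
    rw [abs_of_nonneg (add_nonneg hf hg)] at h
    rw [abs_of_nonneg hf]
    linarith

instance : HasMemOrNegMem (cone K U) where
  mem_or_neg_mem x := by
    obtain ⟨f, rfl⟩ := lim_surjective K U x
    have : ∀ᶠ i in U, 0 ≤ f.1 i ∨ 0 ≤ -f.1 i := by
      filter_upwards with i using (le_total 0 (f.1 i)).imp_right neg_nonneg.2
    rcases Ultrafilter.eventually_or.1 this with h | h
    · exact Or.inl ⟨f, h, rfl⟩
    · exact Or.inr ⟨-f, h, (map_neg _ _).symm⟩

open Classical in
noncomputable instance : LinearOrder (Limits K U) := .mkOfAddGroupCone (cone K U)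

instance : IsOrderedRing (Limits K U) := .mkOfCone (cone K U)

instance : IsStrictOrderedRing (Limits K U) := IsOrderedRing.toIsStrictOrderedRing _

variable {K U}

theorem lim_le_of_eventually {f g : boundedFns K U} (h : ∀ᶠ i in U, f.1 i ≤ g.1 i) :
    lim K U f ≤ lim K U g :=
  ⟨g - f, by filter_upwards [h] with i h using sub_nonneg.2 h, (map_sub _ _ _).symm⟩

theorem lim_le_iff {f g : boundedFns K U} :
    lim K U f ≤ lim K U g ↔ ∀ ε > 0, ∀ᶠ i in U, f.1 i ≤ g.1 i + ε := by
  constructor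
  · rintro ⟨h, hh, e⟩ ε hε
    rw [← map_sub, ← sub_eq_zero, ← map_sub, lim_eq_zero] at e
    filter_upwards [hh, e ε hε] with i h1 h2
    have := (abs_le.1 h2).1
    change -ε ≤ g.1 i - f.1 i - h.1 i at this
    linarith
  · intro h
    have : ∀ᶠ i in U, f.1 i ≤ g.1 i ∨ g.1 i ≤ f.1 i := by
      filter_upwards with i using le_total _ _
    rcases Ultrafilter.eventually_or.1 this with h' | h'
    · exact lim_le_of_eventually h'
    · refine (sub_eq_zero.1 ?_).le
      rw [← map_sub, lim_eq_zero]
      intro ε hε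
      filter_upwards [h ε hε, h'] with i h1 h2
      change |f.1 i - g.1 i| ≤ ε
      rw [abs_of_nonneg (sub_nonneg.2 h2)]
      linarith

theorem lim_abs {f g : boundedFns K U} (h : ∀ i, g.1 i = |f.1 i|) : lim K U g = |lim K U f| := by
  have : ∀ᶠ i in U, 0 ≤ f.1 i ∨ f.1 i ≤ 0 := by
    filter_upwards with i using le_total _ _
  rcases Ultrafilter.eventually_or.1 this with h' | h'
  · rw [abs_of_nonneg]
    · refine le_antisymm (lim_le_of_eventually ?_) (lim_le_of_eventually ?_) <;>
      filter_upwards [h'] with i hi <;> simp [h, abs_of_nonneg hi]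
    · rw [← map_zero (lim K U)]; exact lim_le_of_eventually h'
  · rw [abs_of_nonpos, ← map_neg]
    · refine le_antisymm (lim_le_of_eventually ?_) (lim_le_of_eventually ?_) <;>
      filter_upwards [h'] with i hi <;> simp [h, abs_of_nonpos hi]
    · rw [← map_zero (lim K U)]; exact lim_le_of_eventually h'

theorem const_mem (a : K) : (fun _ => a) ∈ boundedFns K U := ⟨|a|, by simp⟩

variable (K U) in
/-- The embedding of the field as the constant functions. -/
noncomputable def const : K →+* Limits K U :=
  (lim K U).comp ((Pi.constRingHom I K).codRestrict (boundedFns K U) const_mem)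

theorem const_eq (a : K) : const K U a = lim K U ⟨fun _ => a, const_mem a⟩ := rfl

theorem const_strictMono : StrictMono (const K U) := by
  refine Monotone.strictMono_of_injective (fun a b h => ?_) (const K U).injective
  exact lim_le_of_eventually (by simpa using h)

/-- Division by the null functions leaves no infinitesimals relative to `K`, so every strict
inequality between limits has a slack in `K`. -/
theorem exists_const_le {x : Limits K U} (hx : 0 < x) : ∃ ε > 0, const K U ε ≤ x := by
  by_contra! H
  obtain ⟨f, rfl⟩ := lim_surjective K U x
  refine hx.not_ge ?_
  rw [← map_zero (lim K U), lim_le_iff]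
  intro ε hε
  have h1 := (H (ε / 2) (half_pos hε)).le
  rw [const_eq, lim_le_iff] at h1
  filter_upwards [h1 (ε / 2) (half_pos hε)] with i hi
  change f.1 i ≤ 0 + ε
  linarith

end Limits

end Limits

namespace L2Structure

variable {M : L2Structure.{u}} [hM : Fact M.IsRCA0]

/-! ## Rational numbers -/

variable (M) in
/-- The field of rational numbers of `M`. -/
abbrev Rational : Type u := Fractions M.Num

/-- The embedding of the numbers into the rational numbers. -/
noncomputable abbrev ofNum : M.Num →+* M.Rational := Fractions.of M.Num

theorem ofNum_lt {a b : M.Num} : ofNum a < ofNum b ↔ a < b := (Fractions.of_strictMono _).lt_iff_lt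

theorem ofNum_le {a b : M.Num} : ofNum a ≤ ofNum b ↔ a ≤ b := (Fractions.of_strictMono _).le_iff_le

theorem ofNum_nonneg (a : M.Num) : 0 ≤ ofNum a := by
  rw [← map_zero ofNum, ofNum_le]; exact zero_le

theorem ofNum_pos {a : M.Num} (h : 0 < a) : 0 < ofNum a := by
  rwa [← map_zero ofNum, ofNum_lt]

namespace RatCode

/-- The rational number with a given representation. -/
noncomputable def toRat (p : M.RatCode) : M.Rational :=
  (ofNum p.pos - ofNum p.neg) / (ofNum p.den + 1)

theorem den_pos (p : M.RatCode) : 0 < ofNum p.den + 1 := by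
  have := ofNum_nonneg p.den
  positivity

theorem le_iff {p q : M.RatCode} : p ≤ q ↔ p.toRat ≤ q.toRat := by
  have hp := p.den_pos
  have hq := q.den_pos
  rw [toRat, toRat, div_le_div_iff₀ hp hq]
  change p.pos * (q.den + 1) + q.neg * (p.den + 1) ≤ q.pos * (p.den + 1) + p.neg * (q.den + 1) ↔ _
  rw [← ofNum_le]
  simp only [map_add, map_mul, map_one]
  constructor <;> intro h <;> linarith

theorem lt_iff {p q : M.RatCode} : p < q ↔ p.toRat < q.toRat := by
  have hp := p.den_pos
  have hq := q.den_pos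
  rw [toRat, toRat, div_lt_div_iff₀ hp hq]
  change p.pos * (q.den + 1) + q.neg * (p.den + 1) < q.pos * (p.den + 1) + p.neg * (q.den + 1) ↔ _
  rw [← ofNum_lt]
  simp only [map_add, map_mul, map_one]
  constructor <;> intro h <;> linarith

theorem toRat_zero : (0 : M.RatCode).toRat = 0 := by
  change (ofNum 0 - ofNum 0) / (ofNum 0 + 1) = (0 : M.Rational)
  simp

theorem toRat_one : (1 : M.RatCode).toRat = 1 := by
  change (ofNum 1 - ofNum 0) / (ofNum 0 + 1) = (1 : M.Rational)
  simp

theorem toRat_neg (p : M.RatCode) : (-p).toRat = -p.toRat := by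
  change (ofNum p.neg - ofNum p.pos) / (ofNum p.den + 1) = -((ofNum p.pos - ofNum p.neg) / (ofNum p.den + 1))
  rw [← neg_div, neg_sub]

theorem toRat_add (p q : M.RatCode) : (p + q).toRat = p.toRat + q.toRat := by
  have hp := p.den_pos.ne'
  have hq := q.den_pos.ne'
  have h : ofNum (p.den * q.den + p.den + q.den) + 1 = (ofNum p.den + 1) * (ofNum q.den + 1) := by
    simp only [map_add, map_mul]; ring
  change (ofNum (p.pos * (q.den + 1) + q.pos * (p.den + 1)) -
    ofNum (p.neg * (q.den + 1) + q.neg * (p.den + 1))) /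
    (ofNum (p.den * q.den + p.den + q.den) + 1) = _
  rw [h, toRat, toRat]
  simp only [map_add, map_mul, map_one]
  field_simp
  ring

theorem toRat_sub (p q : M.RatCode) : (p - q).toRat = p.toRat - q.toRat := by
  change (p + -q).toRat = _
  rw [toRat_add, toRat_neg, sub_eq_add_neg]

theorem toRat_abs (p : M.RatCode) : p.abs.toRat = |p.toRat| := by
  unfold RatCode.abs
  split_ifs with h
  · rw [lt_iff, toRat_zero] at h
    rw [toRat_neg, abs_of_neg h]
  · rw [lt_iff, toRat_zero, not_lt] at h
    rw [abs_of_nonneg h]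

theorem toRat_inv (d : M.Num) : (RatCode.inv d).toRat = 1 / (ofNum d + 1) := by
  simp [toRat, RatCode.inv]

theorem toRat_surjective (x : M.Rational) : ∃ p : M.RatCode, p.toRat = x := by
  obtain ⟨a, b, hb, h⟩ := Fractions.exists_eq_div _ x
  obtain ⟨d, rfl⟩ := eq_succ_of_pos (pos_iff_ne_zero.2 hb)
  rcases h with rfl | rfl
  · exact ⟨⟨a, 0, d⟩, by simp [toRat]⟩
  · exact ⟨⟨0, a, d⟩, by simp [toRat, neg_div]⟩

end RatCode

theorem exists_ratCode_lt {ε : M.Rational} (hε : 0 < ε) : ∃ p : M.RatCode, 0 < p ∧ p.toRat = ε := by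
  obtain ⟨p, rfl⟩ := RatCode.toRat_surjective ε
  exact ⟨p, by rwa [RatCode.lt_iff, RatCode.toRat_zero], rfl⟩

/-! ## Powers of one half -/

/-- The rational number `2 ^ (-k)`. -/
noncomputable def half (k : M.Num) : M.Rational := 1 / ofNum (M.two k)

theorem half_pos' (k : M.Num) : 0 < half k := one_div_pos.2 (ofNum_pos (two_pos k))

theorem half_zero : half (0 : M.Num) = 1 := by simp [half, two_zero]

theorem half_succ (k : M.Num) : half k = half (k + 1) + half (k + 1) := by
  have := (ofNum_pos (two_pos k)).ne'
  simp only [half, two_succ, map_add]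
  field_simp

theorem two_mono : Monotone M.two := fun k l h => by
  obtain ⟨d, rfl⟩ := le_iff_exists_add'.1 h
  refine Sig.induction (P := fun d => M.two k ≤ M.two (k + d))
    (Del.le (.const _) (.map₁ fn_two (.add (.const _) .v0))).1 (by rw [add_zero]) (fun d ih => ?_) d
  rw [← add_assoc, two_succ]
  exact ih.trans le_self_add

theorem half_anti {k l : M.Num} (h : k ≤ l) : half l ≤ half k :=
  one_div_le_one_div_of_le (ofNum_pos (two_pos k)) (ofNum_le.2 (two_mono h))

/-- For `ε = a / b` with `a ≥ 1`, the exponent `b` suffices, because `b < 2 ^ b`. -/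
theorem exists_half_lt {ε : M.Rational} (hε : 0 < ε) : ∃ k : M.Num, half k < ε := by
  obtain ⟨a, b, hb, h⟩ := Fractions.exists_eq_div _ ε
  have hb' := ofNum_pos (pos_iff_ne_zero.2 hb)
  have hab : 0 ≤ ofNum a / ofNum b := div_nonneg (ofNum_nonneg a) hb'.le
  replace h : ε = ofNum a / ofNum b := h.resolve_right fun h => by linarith
  refine ⟨b, ?_⟩
  subst h
  have ha : 0 < ofNum a := (div_pos_iff_of_pos_right hb').1 hε
  have ha1 : 1 ≤ ofNum a := by
    rw [← map_zero ofNum, ofNum_lt] at ha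
    rw [← map_one ofNum, ofNum_le]
    simpa using succ_le_iff'.2 ha
  calc half b < 1 / ofNum b := one_div_lt_one_div_of_lt hb' (ofNum_lt.2 (lt_two b))
    _ ≤ _ := by gcongr

theorem inv_predTwo (k : M.Num) : (RatCode.inv (M.predTwo k)).toRat = half k := by
  rw [RatCode.toRat_inv, half, ← predTwo_add_one, map_add, map_one]

/-- The quantifier over `d` in the definitions for real names ranges over a single value. -/
theorem forall_twoPow {k : M.Num} {P : M.Num → Prop} :
    (∀ d, M.TwoPow k (d + 1) → P d) ↔ P (M.predTwo k) := by
  simp only [twoPow_iff, ← predTwo_add_one, add_left_inj, forall_eq]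

/-! ## Real numbers -/

namespace RealName

/-- The rational approximations of a real number. -/
noncomputable def app (x : M.RealName) (k : M.Num) : M.Rational := (x.approx k).toRat

theorem rapid_iff {x : M.RealName} : x.Rapid ↔ ∀ k i, |x.app k - x.app (k + i)| ≤ half k := by
  unfold Rapid
  simp only [forall_twoPow, RatCode.le_iff, RatCode.toRat_abs, RatCode.toRat_sub, inv_predTwo]
  rfl

theorem le_iff_app {x y : M.RealName} : x ≤ y ↔ ∀ k, x.app k ≤ y.app k + (half k + half k) := by
  change (∀ k d : M.Num, M.TwoPow k (d + 1) →
    x.approx k ≤ y.approx k + (RatCode.inv d + RatCode.inv d)) ↔ _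
  simp only [forall_twoPow, RatCode.le_iff, RatCode.toRat_add, inv_predTwo]
  rfl

theorem Rapid.abs_sub_le {x : M.RealName} (hx : x.Rapid) {k l : M.Num} (h : k ≤ l) :
    |x.app k - x.app l| ≤ half k := by
  obtain ⟨i, rfl⟩ := le_iff_exists_add'.1 h
  exact rapid_iff.1 hx k i

theorem app_ofRat (q : M.RatCode) (k : M.Num) : (ofRat q).app k = q.toRat := rfl

theorem app_add (x y : M.RealName) (k : M.Num) : (x + y).app k = x.app (k + 1) + y.app (k + 1) :=
  RatCode.toRat_add _ _

theorem app_neg (x : M.RealName) (k : M.Num) : (-x).app k = -x.app k := RatCode.toRat_neg _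

theorem app_abs (x : M.RealName) (k : M.Num) : x.abs.app k = |x.app k| := RatCode.toRat_abs _

theorem rapid_ofRat (q : M.RatCode) : (ofRat q).Rapid := by
  rw [rapid_iff]
  intro k i
  rw [app_ofRat, app_ofRat, sub_self, abs_zero]
  exact (half_pos' k).le

theorem Rapid.add {x y : M.RealName} (hx : x.Rapid) (hy : y.Rapid) : (x + y).Rapid := by
  rw [rapid_iff] at *
  intro k i
  have h1 := hx (k + 1) i
  have h2 := hy (k + 1) i
  rw [app_add, app_add, half_succ, add_right_comm k i 1]
  calc _ = |(x.app (k + 1) - x.app (k + 1 + i)) + (y.app (k + 1) - y.app (k + 1 + i))| := by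
        congr 1; ring
    _ ≤ _ := (abs_add_le _ _).trans (add_le_add h1 h2)

theorem Rapid.neg {x : M.RealName} (hx : x.Rapid) : (-x).Rapid := by
  rw [rapid_iff] at *
  intro k i
  rw [app_neg, app_neg, ← neg_sub', abs_neg]
  exact hx k i

theorem Rapid.sub {x y : M.RealName} (hx : x.Rapid) (hy : y.Rapid) : (x - y).Rapid :=
  hx.add hy.neg

theorem Rapid.abs {x : M.RealName} (hx : x.Rapid) : x.abs.Rapid := by
  rw [rapid_iff] at *
  intro k i
  rw [app_abs, app_abs]
  exact (abs_abs_sub_abs_le_abs_sub _ _).trans (hx k i)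

end RealName

/-! ### Values of real names in a ring of ultrafilter limits -/

variable (M) in
/-- An ultrafilter that contains the final segments of the numbers. -/
noncomputable def ultra : Ultrafilter M.Num := Ultrafilter.of Filter.atTop

theorem eventually_ultra (k : M.Num) : ∀ᶠ i in M.ultra, k ≤ i :=
  Ultrafilter.of_le Filter.atTop (Filter.eventually_ge_atTop k)

variable (M) in
/-- An ordered ring that contains the real numbers of `M`. -/
abbrev Limit : Type u := Limits M.Rational M.ultra

variable (M) in
/-- The embedding of the rational numbers. -/
noncomputable abbrev ofRational : M.Rational →+* M.Limit := Limits.const M.Rational M.ultra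

theorem ofRational_lt {a b : M.Rational} : M.ofRational a < M.ofRational b ↔ a < b :=
  Limits.const_strictMono.lt_iff_lt

theorem ofRational_le {a b : M.Rational} : M.ofRational a ≤ M.ofRational b ↔ a ≤ b :=
  Limits.const_strictMono.le_iff_le

theorem ofRational_pos {a : M.Rational} : 0 < M.ofRational a ↔ 0 < a := by
  rw [← map_zero M.ofRational, ofRational_lt]

theorem ofRational_abs (a : M.Rational) : M.ofRational |a| = |M.ofRational a| :=
  Limits.lim_abs fun _ => rfl

namespace RealName

theorem Rapid.bounded {x : M.RealName} (hx : x.Rapid) : x.app ∈ boundedFns M.Rational M.ultra := by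
  refine ⟨|x.app 0| + half 0, Filter.Eventually.of_forall fun l => ?_⟩
  have h := hx.abs_sub_le (zero_le (a := l))
  have := abs_sub_abs_le_abs_sub (x.app l) (x.app 0)
  rw [abs_sub_comm] at this
  linarith

open Classical in
/-- The value of a real number of `M`. -/
noncomputable def val (x : M.RealName) : M.Limit :=
  if h : x.app ∈ boundedFns M.Rational M.ultra then Limits.lim _ _ ⟨x.app, h⟩ else 0

theorem Rapid.val_eq {x : M.RealName} (hx : x.Rapid) : x.val = Limits.lim _ _ ⟨x.app, hx.bounded⟩ :=
  dif_pos hx.bounded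

theorem Rapid.abs_val_sub_le {x : M.RealName} (hx : x.Rapid) (k : M.Num) :
    |x.val - M.ofRational (x.app k)| ≤ M.ofRational (half k) := by
  rw [hx.val_eq, Limits.const_eq, ← map_sub, abs_le, Limits.const_eq, ← map_neg]
  constructor <;> refine Limits.lim_le_of_eventually ?_ <;>
    filter_upwards [eventually_ultra k] with l hl <;>
    have := abs_le.1 (hx.abs_sub_le hl)
  · change -half k ≤ x.app l - x.app k
    linarith
  · change x.app l - x.app k ≤ half k
    linarith

/-- The tolerance `2 * 2 ^ (-k)` in the order of names is the sum of the two approximation errors at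
`k`, and it vanishes in the limit. -/
theorem Rapid.le_iff {x y : M.RealName} (hx : x.Rapid) (hy : y.Rapid) : x ≤ y ↔ x.val ≤ y.val := by
  constructor
  · intro h
    rw [le_iff_app] at h
    rw [hx.val_eq, hy.val_eq, Limits.lim_le_iff]
    intro ε hε
    obtain ⟨k, hk⟩ := exists_half_lt (half_pos hε)
    filter_upwards [eventually_ultra k] with l hl
    linarith [h l, half_anti hl]
  · intro h
    rw [le_iff_app]
    intro k
    have h1 := abs_le.1 (hx.abs_val_sub_le k)
    have h2 := abs_le.1 (hy.abs_val_sub_le k)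
    rw [← ofRational_le, map_add, map_add]
    linarith

theorem Rapid.lt_iff {x y : M.RealName} (hx : x.Rapid) (hy : y.Rapid) : x < y ↔ x.val < y.val := by
  rw [← not_le, ← hy.le_iff hx]; rfl

/-- Strict inequality of reals is Σ⁰₁; this is what makes it accessible to induction, extremal
elements and bounding. -/
theorem Rapid.lt_iff_exists {x y : M.RealName} (hx : x.Rapid) (hy : y.Rapid) :
    x.val < y.val ↔ ∃ k, y.app k > x.app k + (half k + half k) := by
  rw [← not_le, ← hy.le_iff hx, le_iff_app, not_forall]
  simp only [not_le, gt_iff_lt]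

theorem Rapid.equal_iff {x y : M.RealName} (hx : x.Rapid) (hy : y.Rapid) :
    x.Equal y ↔ x.val = y.val := by
  rw [Equal, hx.le_iff hy, hy.le_iff hx, le_antisymm_iff]

theorem val_ofRat (q : M.RatCode) : (ofRat q).val = M.ofRational q.toRat := (rapid_ofRat q).val_eq

theorem val_eq_of_forall {a b : M.Limit} (h : ∀ k : M.Num, |a - b| ≤ M.ofRational (half k)) :
    a = b := by
  by_contra hne
  obtain ⟨ε, hε, h'⟩ := Limits.exists_const_le (abs_pos.2 (sub_ne_zero.2 hne))
  obtain ⟨k, hk⟩ := exists_half_lt hε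
  exact (ofRational_lt.2 hk).not_ge (h'.trans (h k))

theorem Rapid.val_add {x y : M.RealName} (hx : x.Rapid) (hy : y.Rapid) :
    (x + y).val = x.val + y.val := by
  refine val_eq_of_forall fun k => ?_
  -- Addition shifts the index by one, so the total error is `2 ^ (-(k+1)) + 2 * 2 ^ (-(k+2)) = 2 ^
  -- (-k)`.
  have h1 := abs_le.1 ((hx.add hy).abs_val_sub_le (k + 1))
  have h2 := abs_le.1 (hx.abs_val_sub_le (k + 1 + 1))
  have h3 := abs_le.1 (hy.abs_val_sub_le (k + 1 + 1))
  rw [app_add, map_add] at h1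
  rw [half_succ k, abs_le]
  have h4 := congrArg M.ofRational (half_succ (k + 1))
  rw [map_add] at h4 ⊢
  constructor <;> linarith

theorem Rapid.val_neg {x : M.RealName} (hx : x.Rapid) : (-x).val = -x.val := by
  rw [hx.val_eq, hx.neg.val_eq, ← map_neg]
  congr 2
  funext k
  exact app_neg x k

theorem Rapid.val_sub {x y : M.RealName} (hx : x.Rapid) (hy : y.Rapid) :
    (x - y).val = x.val - y.val := by
  rw [sub_eq_add_neg, ← hy.val_neg]
  exact hx.val_add hy.neg

theorem Rapid.val_abs {x : M.RealName} (hx : x.Rapid) : x.abs.val = |x.val| := by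
  rw [hx.val_eq, hx.abs.val_eq]
  exact Limits.lim_abs fun k => app_abs x k

theorem val_zero : (0 : M.RealName).val = 0 := by
  change (ofRat 0).val = 0
  rw [val_ofRat, RatCode.toRat_zero, map_zero]

theorem val_one : (1 : M.RealName).val = 1 := by
  change (ofRat 1).val = 1
  rw [val_ofRat, RatCode.toRat_one, map_one]

theorem rapid_zero : (0 : M.RealName).Rapid := rapid_ofRat 0
theorem rapid_one : (1 : M.RealName).Rapid := rapid_ofRat 1

end RealName

end L2Structure

namespace L2Structure

variable {M : L2Structure.{u}} [hM : Fact M.IsRCA0] {α β : Type u} [Ctx M α] [Ctx M β]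

/-! ## Recursive functions with rational and real values -/

variable (M) in
/-- Recursive functions with values in the representations of rational numbers. -/
structure RFn (q : α → M.RatCode) : Prop where
  pos : Fn M (fun v => (q v).pos)
  neg : Fn M (fun v => (q v).neg)
  den : Fn M (fun v => (q v).den)

/-- The representation of a rational number with a given code. -/
noncomputable def RatCode.ofCode (m : M.Num) : M.RatCode :=
  ⟨(unpair (unpair m).1).1, (unpair (unpair m).1).2, (unpair m).2⟩

@[simp] theorem RatCode.ofCode_code (p : M.RatCode) : ofCode p.code = p := by
  simp [ofCode, code]

theorem RFn.ofCode {f : α → M.Num} (hf : Fn M f) : RFn M (fun v => RatCode.ofCode (f v)) :=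
  ⟨hf.unpair_fst.unpair_fst, hf.unpair_fst.unpair_snd, hf.unpair_snd⟩

theorem Fn.code {q : α → M.RatCode} (hq : RFn M q) : Fn M (fun v => (q v).code) :=
  (hq.pos.pair hq.neg).pair hq.den

theorem RFn.comp {q : α → M.RatCode} (hq : RFn M q) {g : β → α} (hg : CMap M g) :
    RFn M (fun v => q (g v)) := ⟨hq.pos.comp hg, hq.neg.comp hg, hq.den.comp hg⟩

theorem RFn.subst {q : M.Num → α → M.RatCode} (hq : RFn M (fun p : M.Num × α => q p.1 p.2))
    {f : α → M.Num} (hf : Fn M f) : RFn M (fun v => q (f v) v) :=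
  ⟨.subst (F := fun a v => (q a v).pos) hq.pos hf, .subst (F := fun a v => (q a v).neg) hq.neg hf,
    .subst (F := fun a v => (q a v).den) hq.den hf⟩

theorem RFn.const (p : M.RatCode) : RFn M (fun _ : α => p) := ⟨.const _, .const _, .const _⟩

theorem RFn.add {p q : α → M.RatCode} (hp : RFn M p) (hq : RFn M q) :
    RFn M (fun v => p v + q v) where
  pos := (hp.pos.mul (hq.den.add (.const 1))).add (hq.pos.mul (hp.den.add (.const 1)))
  neg := (hp.neg.mul (hq.den.add (.const 1))).add (hq.neg.mul (hp.den.add (.const 1)))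
  den := ((hp.den.mul hq.den).add hp.den).add hq.den

theorem RFn.neg' {p : α → M.RatCode} (hp : RFn M p) : RFn M (fun v => -p v) :=
  ⟨hp.neg, hp.pos, hp.den⟩

theorem RFn.sub {p q : α → M.RatCode} (hp : RFn M p) (hq : RFn M q) :
    RFn M (fun v => p v - q v) := hp.add hq.neg'

theorem RFn.inv {f : α → M.Num} (hf : Fn M f) : RFn M (fun v => RatCode.inv (f v)) :=
  ⟨.const 1, .const 0, hf⟩

theorem Del.rat_lt {p q : α → M.RatCode} (hp : RFn M p) (hq : RFn M q) :
    Del M (fun v => p v < q v) :=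
  .lt ((hp.pos.mul (hq.den.add (.const 1))).add (hq.neg.mul (hp.den.add (.const 1))))
    ((hq.pos.mul (hp.den.add (.const 1))).add (hp.neg.mul (hq.den.add (.const 1))))

theorem RFn.abs {p : α → M.RatCode} (hp : RFn M p) : RFn M (fun v => (p v).abs) := by
  classical
  have h : Del M (fun v => p v < 0) := .rat_lt hp (.const 0)
  have e : ∀ v, (p v).abs = if p v < 0 then -p v else p v := fun v => by
    unfold RatCode.abs; congr
  refine ⟨(Fn.ite h hp.neg hp.pos).of_eq fun v => ?_, (Fn.ite h hp.pos hp.neg).of_eq fun v => ?_,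
    hp.den.of_eq fun v => ?_⟩ <;> rw [e] <;> split_ifs <;> rfl

variable (M) in
/-- Recursive functions with values in the real numbers. -/
def RealFn (x : α → M.RealName) : Prop := RFn M (fun p : M.Num × α => (x p.2).approx p.1)

theorem isReal_iff {x : M.RealName} : x.IsReal ↔ RealFn M (fun _ : PUnit.{u+1} => x) ∧ x.Rapid := by
  refine and_congr_left' ⟨fun h => ?_, fun h => graph_mem_sets (Fn.code h)⟩
  simpa [RealFn] using RFn.ofCode (Fn.of_graph (f := fun k => (x.approx k).code) h
    (Fn.v0 (α := PUnit.{u+1})))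

theorem isRealSeq_iff {z : M.Num → M.RealName} :
    M.IsRealSeq z ↔ RealFn M (fun v : M.Num × PUnit.{u+1} => z v.1) ∧ ∀ n, (z n).Rapid := by
  refine and_congr_left' ⟨fun h => ?_, fun h => ?_⟩
  · have : Fn M (fun v : M.Num × M.Num × PUnit.{u+1} => ((z v.2.1).approx v.1).code) :=
      (Del.mem h (.pair (.pair .v2 .v1) .v0)).1.of_iff fun v => by
        simp [pair_inj, eq_comm]
    simpa [RealFn] using RFn.ofCode this
  · have h' : Del M (fun v : M.Num × PUnit.{u+1} => v.1 =
        M.pair (M.pair (unpair (unpair v.1).1).1 (unpair (unpair v.1).1).2)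
          ((z (unpair (unpair v.1).1).1).approx (unpair (unpair v.1).1).2).code) :=
      .eq .v0 (.pair (.pair Fn.v0.unpair_fst.unpair_fst Fn.v0.unpair_fst.unpair_snd)
        (.map₂ (F := fun n k => ((z n).approx k).code) (Fn.comp (Fn.code h)
          (.cons (coord_snd coord_fst) (.cons coord_fst .nil)))
          Fn.v0.unpair_fst.unpair_fst Fn.v0.unpair_fst.unpair_snd))
    convert comprehension (P := fun m => m =
        M.pair (M.pair (unpair (unpair m).1).1 (unpair (unpair m).1).2)
          ((z (unpair (unpair m).1).1).approx (unpair (unpair m).1).2).code) h' using 1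
    ext m
    constructor
    · rintro ⟨⟨n, k⟩, rfl⟩
      simp
    · intro h
      exact ⟨⟨_, _⟩, h.symm⟩

theorem RealFn.comp {x : α → M.RealName} (hx : RealFn M x) {g : β → α} (hg : CMap M g) :
    RealFn M (fun v => x (g v)) := RFn.comp hx (.cons coord_fst hg.snd)

theorem RealFn.approx {x : α → M.RealName} (hx : RealFn M x) {f : α → M.Num} (hf : Fn M f) :
    RFn M (fun v => (x v).approx (f v)) :=
  .subst (q := fun k v => (x v).approx k) hx hf

theorem RealFn.const {x : M.RealName} (hx : x.IsReal) : RealFn M (fun _ : α => x) :=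
  (isReal_iff.1 hx).1.comp .nil

theorem RealFn.seq {z : M.Num → M.RealName} (hz : M.IsRealSeq z) {f : α → M.Num} (hf : Fn M f) :
    RealFn M (fun v => z (f v)) :=
  .subst (q := fun n (w : M.Num × α) => (z n).approx w.1) (RFn.comp (isRealSeq_iff.1 hz).1
    (.cons (coord_snd coord_fst) (.cons coord_fst .nil))) hf.snd

theorem RealFn.add {x y : α → M.RealName} (hx : RealFn M x) (hy : RealFn M y) :
    RealFn M (fun v => x v + y v) := by
  have h : Fn M (fun w : M.Num × α => w.1 + 1) := .add .v0 (.const 1)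
  exact RFn.add (RealFn.approx (x := fun w : M.Num × α => x w.2) (hx.comp CMap.id.snd) h)
    (RealFn.approx (x := fun w : M.Num × α => y w.2) (hy.comp CMap.id.snd) h)

theorem RealFn.neg {x : α → M.RealName} (hx : RealFn M x) : RealFn M (fun v => -x v) := RFn.neg' hx

theorem RealFn.sub {x y : α → M.RealName} (hx : RealFn M x) (hy : RealFn M y) :
    RealFn M (fun v => x v - y v) := hx.add hy.neg

theorem RealFn.abs {x : α → M.RealName} (hx : RealFn M x) : RealFn M (fun v => (x v).abs) :=
  RFn.abs hx

theorem Sig.real_lt {x y : α → M.RealName} (hx : RealFn M x) (hy : RealFn M y)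
    (hx' : ∀ v, (x v).Rapid) (hy' : ∀ v, (y v).Rapid) : Sig M (fun v => x v < y v) := by
  have hd : RFn M (fun p : M.Num × α => RatCode.inv (M.predTwo p.1)) := .inv (.map₁ fn_predTwo .v0)
  refine Sig.of_iff (.ex (P := fun k v => (x v).approx k + (RatCode.inv (M.predTwo k) +
    RatCode.inv (M.predTwo k)) < (y v).approx k) (Del.rat_lt (.add hx (.add hd hd)) hy).1)
    fun v => ?_
  rw [(hx' v).lt_iff (hy' v), (hx' v).lt_iff_exists (hy' v)]
  simp only [RatCode.lt_iff, RatCode.toRat_add, inv_predTwo]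
  rfl

theorem isReal_ofRat (q : M.RatCode) : (RealName.ofRat q).IsReal :=
  isReal_iff.2 ⟨RFn.const q, RealName.rapid_ofRat q⟩

namespace RealName

variable {x y : M.RealName}

theorem IsReal.add (hx : x.IsReal) (hy : y.IsReal) : (x + y).IsReal :=
  isReal_iff.2 ⟨.add (.const hx) (.const hy), hx.2.add hy.2⟩

theorem IsReal.sub (hx : x.IsReal) (hy : y.IsReal) : (x - y).IsReal :=
  isReal_iff.2 ⟨.sub (.const hx) (.const hy), hx.2.sub hy.2⟩

end RealName

theorem IsRealSeq.isReal {z : M.Num → M.RealName} (hz : M.IsRealSeq z) (n : M.Num) :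
    (z n).IsReal := isReal_iff.2 ⟨RealFn.seq hz (.const n), hz.2 n⟩

end L2Structure

namespace L2Structure

variable {M : L2Structure.{u}} [hM : Fact M.IsRCA0]

open RealName

/-! ## Sequences of real numbers -/

theorem forall_ratCode_pos {P : M.Rational → Prop} :
    (∀ ε : M.RatCode, 0 < ε → P ε.toRat) ↔ ∀ ε > 0, P ε := by
  constructor
  · intro h ε hε
    obtain ⟨p, hp, rfl⟩ := exists_ratCode_lt hε
    exact h p hp
  · intro h ε hε
    exact h _ (by rwa [RatCode.lt_iff, RatCode.toRat_zero] at hε)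

theorem Rapid.abs_sub_le_ofRat {x y : M.RealName} (hx : x.Rapid) (hy : y.Rapid) (q : M.RatCode) :
    (x - y).abs ≤ ofRat q ↔ |x.val - y.val| ≤ M.ofRational q.toRat := by
  rw [(hx.sub hy).abs.le_iff (rapid_ofRat q), (hx.sub hy).val_abs, hx.val_sub hy, val_ofRat]

theorem Rapid.abs_sub_lt {x y z : M.RealName} (hx : x.Rapid) (hy : y.Rapid) (hz : z.Rapid) :
    (x - y).abs < z ↔ |x.val - y.val| < z.val := by
  rw [(hx.sub hy).abs.lt_iff hz, (hx.sub hy).val_abs, hx.val_sub hy]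

theorem isCauchy_iff {z : M.Num → M.RealName} (hz : ∀ n, (z n).Rapid) :
    IsCauchy z ↔ ∀ ε > 0, ∃ n₀, ∀ m n, n₀ ≤ m → n₀ ≤ n →
      |(z m).val - (z n).val| ≤ M.ofRational ε := by
  unfold IsCauchy
  simp only [fun m n => Rapid.abs_sub_le_ofRat (hz m) (hz n)]
  exact forall_ratCode_pos (P := fun ε => ∃ n₀, ∀ m n, n₀ ≤ m → n₀ ≤ n →
    |(z m).val - (z n).val| ≤ M.ofRational ε)

theorem convergesTo_iff {z : M.Num → M.RealName} (hz : ∀ n, (z n).Rapid) {x : M.RealName}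
    (hx : x.Rapid) : ConvergesTo z x ↔ ∀ ε > 0, ∃ n₀, ∀ n, n₀ ≤ n →
      |x.val - (z n).val| ≤ M.ofRational ε := by
  unfold ConvergesTo
  simp only [fun n => Rapid.abs_sub_le_ofRat hx (hz n)]
  exact forall_ratCode_pos (P := fun ε => ∃ n₀, ∀ n, n₀ ≤ n →
    |x.val - (z n).val| ≤ M.ofRational ε)

theorem inUnit_iff {x : M.RealName} : x.InUnit ↔ x.IsReal ∧ 0 ≤ x.val ∧ x.val ≤ 1 := by
  refine and_congr_right fun h => ?_
  rw [rapid_zero.le_iff h.2, h.2.le_iff rapid_one, val_zero, val_one]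

/-! ## Codes of the distance functions -/

/-- The condition, verified at stage `n`, that the distance to `x` maps the ball `B(a, r)` into the
ball `B(b, s)`. -/
def DistCond (x : M.RealName) (n : M.Num) (a r b s : M.RatCode) : Prop :=
  ((a - x.approx n).abs - b).abs + (r + RatCode.inv (M.predTwo n)) < s

/-- Replacing `x` by its `n`-th approximation changes the nested absolute value by at most `2 ^
(-n)`; as the inequality is strict, its slack absorbs this error and the added `2 ^ (-n)` for large
`n`. The tuple index in `CodeRel` carries the quantifier over `n`, which leaves `distCode` itself
decidable. -/
theorem exists_distCond_iff {x : M.RealName} (hx : x.Rapid) {a r b s : M.RatCode} :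
    (∃ n, DistCond x n a r b s) ↔ |(|M.ofRational a.toRat - x.val|) - M.ofRational b.toRat| +
      M.ofRational r.toRat < M.ofRational s.toRat := by
  have key : ∀ n, DistCond x n a r b s ↔
      |(|M.ofRational a.toRat - M.ofRational (x.app n)|) - M.ofRational b.toRat| +
        (M.ofRational r.toRat + M.ofRational (half n)) < M.ofRational s.toRat := fun n => by
    unfold DistCond
    rw [RatCode.lt_iff, ← ofRational_lt]
    simp only [RatCode.toRat_add, RatCode.toRat_abs, RatCode.toRat_sub, inv_predTwo, map_add,
      ofRational_abs, map_sub]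
    rfl
  have lip : ∀ n, |(|(|M.ofRational a.toRat - M.ofRational (x.app n)|) - M.ofRational b.toRat| -
      |(|M.ofRational a.toRat - x.val|) - M.ofRational b.toRat|)| ≤ M.ofRational (half n) := fun n => by
    refine (abs_abs_sub_abs_le_abs_sub _ _).trans ?_
    rw [sub_sub_sub_cancel_right]
    refine (abs_abs_sub_abs_le_abs_sub _ _).trans ?_
    rw [sub_sub_sub_cancel_left]
    exact hx.abs_val_sub_le n
  constructor
  · rintro ⟨n, h⟩
    rw [key] at h
    have := abs_le.1 (lip n)
    linarith
  · intro h
    obtain ⟨ε, hε, h'⟩ := Limits.exists_const_le (sub_pos.2 h)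
    obtain ⟨n, hn⟩ := exists_half_lt (half_pos hε)
    refine ⟨n, (key n).2 ?_⟩
    have := abs_le.1 (lip n)
    rw [← ofRational_lt] at hn
    have h2 : M.ofRational ε = M.ofRational (ε / 2) + M.ofRational (ε / 2) := by
      rw [← map_add, add_halves]
    linarith

/-- The code of the sequence of the distance functions to the members of a sequence. -/
def distCode (z : M.Num → M.RealName) : Set M.Num :=
  {m | DistCond (z (unpair m).1) (unpair (unpair m).2).1
    (RatCode.ofCode (unpair (unpair (unpair m).2).2).1)
    (RatCode.ofCode (unpair (unpair (unpair (unpair m).2).2).2).1)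
    (RatCode.ofCode (unpair (unpair (unpair (unpair (unpair m).2).2).2).2).1)
    (RatCode.ofCode (unpair (unpair (unpair (unpair (unpair m).2).2).2).2).2)}

theorem distCode_mem_sets {z : M.Num → M.RealName} (hz : M.IsRealSeq z) : distCode z ∈ M.sets := by
  have h1 : Fn M (fun v : M.Num × PUnit.{u+1} => (unpair v.1).2) := Fn.v0.unpair_snd
  have h2 := h1.unpair_snd
  have h3 := h2.unpair_snd
  have h4 := h3.unpair_snd
  refine comprehension (P := fun m => m ∈ distCode z) (Del.rat_lt (.add (.abs (.sub (.abs (.sub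
    (.ofCode h2.unpair_fst) (RealFn.approx (.seq hz Fn.v0.unpair_fst) h1.unpair_fst)))
    (.ofCode h4.unpair_fst))) (.add (.ofCode h3.unpair_fst)
    (.inv (.map₁ fn_predTwo h1.unpair_fst)))) (.ofCode h4.unpair_snd))

theorem codeRel_distCode {z : M.Num → M.RealName} (hz : ∀ n, (z n).Rapid) {i : M.Num}
    {a r b s : M.RatCode} : M.CodeRel (M.sect (distCode z) i) a r b s ↔
      0 ≤ a.toRat ∧ a.toRat ≤ 1 ∧ 0 < r.toRat ∧ 0 < s.toRat ∧
      |(|M.ofRational a.toRat - (z i).val|) - M.ofRational b.toRat| +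
        M.ofRational r.toRat < M.ofRational s.toRat := by
  unfold CodeRel
  rw [← exists_distCond_iff (hz i)]
  simp only [RatCode.le_iff, RatCode.lt_iff, RatCode.toRat_zero, RatCode.toRat_one, sect, distCode,
    Set.mem_ofPred_eq, unpair_pair, RatCode.ofCode_code]

theorem isContinuousCode_distCode {z : M.Num → M.RealName} (hz : ∀ n, (z n).Rapid) (i : M.Num) :
    M.IsContinuousCode (M.sect (distCode z) i) where
  consistent a r b s b' s' h h' := by
    rw [codeRel_distCode hz] at h h'
    obtain ⟨-, -, hr, -, h⟩ := h
    obtain ⟨-, -, -, -, h'⟩ := h'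
    rw [RatCode.le_iff, RatCode.toRat_abs, RatCode.toRat_sub, RatCode.toRat_add, ← ofRational_le,
      ofRational_abs, map_sub, map_add]
    rw [← ofRational_pos] at hr
    have := abs_sub_le (M.ofRational b.toRat) |M.ofRational a.toRat - (z i).val|
      (M.ofRational b'.toRat)
    rw [abs_sub_comm (M.ofRational b.toRat) |M.ofRational a.toRat - (z i).val|] at this
    linarith
  shrink a r b s a' r' h h0 h1 hr' hlt := by
    rw [codeRel_distCode hz] at h ⊢
    obtain ⟨-, -, hr, hs, h⟩ := h
    rw [RatCode.le_iff, RatCode.toRat_zero] at h0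
    rw [RatCode.le_iff, RatCode.toRat_one] at h1
    rw [RatCode.lt_iff, RatCode.toRat_zero] at hr'
    rw [RatCode.lt_iff, RatCode.toRat_add, RatCode.toRat_abs, RatCode.toRat_sub, ← ofRational_lt,
      map_add, ofRational_abs, map_sub] at hlt
    refine ⟨h0, h1, hr', hs, ?_⟩
    have e1 := abs_sub_le |M.ofRational a'.toRat - (z i).val| |M.ofRational a.toRat - (z i).val|
      (M.ofRational b.toRat)
    have e2 := abs_abs_sub_abs_le_abs_sub (M.ofRational a'.toRat - (z i).val)
      (M.ofRational a.toRat - (z i).val)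
    rw [sub_sub_sub_cancel_right, abs_sub_comm (M.ofRational a'.toRat) (M.ofRational a.toRat)] at e2
    linarith
  enlarge a r b s b' s' h hs' hlt := by
    rw [codeRel_distCode hz] at h ⊢
    obtain ⟨h0, h1, hr, hs, h⟩ := h
    rw [RatCode.lt_iff, RatCode.toRat_zero] at hs'
    rw [RatCode.lt_iff, RatCode.toRat_add, RatCode.toRat_abs, RatCode.toRat_sub, ← ofRational_lt,
      map_add, ofRational_abs, map_sub] at hlt
    refine ⟨h0, h1, hr, hs', ?_⟩
    have := abs_sub_le |M.ofRational a.toRat - (z i).val| (M.ofRational b.toRat)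
      (M.ofRational b'.toRat)
    linarith
  total x hx ε hε := by
    rw [inUnit_iff] at hx
    obtain ⟨hx, hx0, hx1⟩ := hx
    rw [RatCode.lt_iff, RatCode.toRat_zero] at hε
    -- With `η = 2 ^ (-k) < ε / 4`: the centre `a` is within `η` of `x`, so `r = 2η` captures `x`;
    -- and `b` is within `η` of `|a - z_i|`, so `η + r = 3η < s = 4η < ε`.
    obtain ⟨k, hk⟩ := exists_half_lt (div_pos hε (by norm_num : (0 : M.Rational) < 4))
    have hk0 := half_pos' k
    -- The approximation is clipped because centres must lie in the unit interval; as `x` does,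
    -- clipping does not spoil the error bound.
    obtain ⟨a, ha⟩ := RatCode.toRat_surjective (max 0 (min 1 (x.app k)))
    obtain ⟨b, hb⟩ := RatCode.toRat_surjective |a.toRat - (z i).app k|
    obtain ⟨r, hr⟩ := RatCode.toRat_surjective (half k + half k)
    obtain ⟨s, hs⟩ := RatCode.toRat_surjective (half k + half k + half k + half k)
    have hxa : |x.val - M.ofRational a.toRat| ≤ M.ofRational (half k) := by
      have h := abs_le.1 (hx.2.abs_val_sub_le k)
      rw [← ofRational_pos] at hk0
      rw [ha, abs_le]
      rcases le_total 1 (x.app k) with h1 | h1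
      · rw [min_eq_left h1, max_eq_right zero_le_one, map_one]
        rw [← ofRational_le, map_one] at h1
        constructor <;> linarith
      · rw [min_eq_right h1]
        rcases le_total 0 (x.app k) with h2 | h2
        · rw [max_eq_right h2]
          constructor <;> linarith
        · rw [max_eq_left h2, map_zero]
          rw [← ofRational_le, map_zero] at h2
          constructor <;> linarith
    refine ⟨a, r, b, s, (codeRel_distCode hz).2 ⟨?_, ?_, ?_, ?_, ?_⟩, ?_, ?_⟩
    · rw [ha]; exact le_max_left _ _
    · rw [ha]; exact max_le zero_le_one (min_le_left _ _)
    · rw [hr]; linarith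
    · rw [hs]; linarith
    · rw [hb, hr, hs, ofRational_abs, map_sub]
      have e := abs_abs_sub_abs_le_abs_sub (M.ofRational a.toRat - (z i).val)
        (M.ofRational a.toRat - M.ofRational ((z i).app k))
      rw [sub_sub_sub_cancel_left, abs_sub_comm (M.ofRational ((z i).app k)) (z i).val] at e
      have e' := (hz i).abs_val_sub_le k
      rw [← ofRational_pos] at hk0
      simp only [map_add]
      linarith
    · rw [Rapid.abs_sub_lt hx.2 (rapid_ofRat _) (rapid_ofRat _), val_ofRat, val_ofRat, hr, map_add]
      rw [← ofRational_pos] at hk0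
      linarith
    · rw [RatCode.lt_iff, hs]
      linarith

theorem exists_codesDistances {z : M.Num → M.RealName} (hz : M.IsRealSeq z) :
    ∃ F : Set M.Num, M.CodesDistances z F := by
  refine ⟨distCode z, distCode_mem_sets hz, fun i => ⟨isContinuousCode_distCode hz.2 i, ?_⟩⟩
  intro x hx a r b s h hlt
  have hr := hx.1.2
  rw [codeRel_distCode hz.2] at h
  obtain ⟨-, -, -, -, h⟩ := h
  rw [Rapid.abs_sub_lt hr (rapid_ofRat _) (rapid_ofRat _), val_ofRat, val_ofRat] at hlt
  rw [Rapid.abs_sub_le_ofRat (hr.sub (hz.2 i)).abs (rapid_ofRat _), val_ofRat,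
    (hr.sub (hz.2 i)).val_abs, hr.val_sub (hz.2 i)]
  have e1 := abs_sub_le |x.val - (z i).val| |M.ofRational a.toRat - (z i).val|
    (M.ofRational b.toRat)
  have e2 := abs_abs_sub_abs_le_abs_sub (x.val - (z i).val) (M.ofRational a.toRat - (z i).val)
  rw [sub_sub_sub_cancel_right] at e2
  linarith

/-! ## The gauge of a sequence without limit -/

/-- Two values lie in a common ball of arbitrarily small radius. Consequently the value sequences in
`LeLim` may be replaced by `|x - z_n|`, whatever code is used. -/
theorem IsContinuousCode.value_unique {Φ : Set M.Num} (hΦ : M.IsContinuousCode Φ)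
    {x y y' : M.RealName} (hx : x.InUnit) (hy : y.Rapid) (hy' : y'.Rapid) (h : M.IsValue Φ x y)
    (h' : M.IsValue Φ x y') : y.val = y'.val := by
  refine val_eq_of_forall fun k => ?_
  obtain ⟨ε, hε, e⟩ := exists_ratCode_lt (half_pos' (k + 1))
  obtain ⟨a, r, b, s, hrel, hlt, hs⟩ := hΦ.total x hx ε hε
  have h1 := h a r b s hrel hlt
  have h2 := h' a r b s hrel hlt
  rw [Rapid.abs_sub_le_ofRat hy (rapid_ofRat _), val_ofRat] at h1
  rw [Rapid.abs_sub_le_ofRat hy' (rapid_ofRat _), val_ofRat, abs_sub_comm] at h2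
  rw [RatCode.lt_iff, e, ← ofRational_lt] at hs
  rw [half_succ, map_add]
  have := abs_sub_le y.val (M.ofRational b.toRat) y'.val
  linarith

section

variable {z : M.Num → M.RealName} (hz : M.IsRealSeq z) {F : Set M.Num} (hF : M.CodesDistances z F)

include hz hF

theorem isValueSeq_dist {x : M.RealName} (hx : x.InUnit) :
    M.IsValueSeq F x (fun i => (x - z i).abs) :=
  ⟨isRealSeq_iff.2 ⟨.abs (.sub (.const hx.1) (.seq hz .v0)), fun i => (hx.1.2.sub (hz.2 i)).abs⟩,
    fun i => (hF.2 i).2 x hx⟩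

theorem IsValueSeq.val_eq {x : M.RealName} (hx : x.InUnit) {y : M.Num → M.RealName}
    (hy : M.IsValueSeq F x y) (i : M.Num) : (y i).val = |x.val - (z i).val| := by
  have h := hx.1.2.sub (hz.2 i)
  rw [← hx.1.2.val_sub (hz.2 i), ← h.val_abs]
  exact (hF.2 i).1.value_unique hx (hy.1.2 i) h.abs (hy.2 i) ((hF.2 i).2 x hx)

theorem LeLim.le {r x : M.RealName} (hr : r.Rapid) (hx : x.InUnit) (h : M.LeLim r F x) :
    ∀ ε > 0, ∃ n₀, ∀ n, n₀ ≤ n → r.val ≤ |x.val - (z n).val| + M.ofRational ε := by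
  obtain ⟨y, hy, h⟩ := h
  rw [← forall_ratCode_pos (P := fun ε => ∃ n₀, ∀ n, n₀ ≤ n →
    r.val ≤ |x.val - (z n).val| + M.ofRational ε)]
  intro ε hε
  refine (h ε hε).imp fun n₀ h n hn => ?_
  have := h n hn
  rwa [hr.le_iff ((hy.1.2 n).add (rapid_ofRat ε)), (hy.1.2 n).val_add (rapid_ofRat ε), val_ofRat,
    IsValueSeq.val_eq hz hF hx hy] at this

variable (hc : IsCauchy z) (hlim : ¬ ∃ x : M.RealName, x.IsReal ∧ ConvergesTo z x)

-- The distances inherit the Cauchy property from `z` by the triangle inequality. For positivity at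
-- `x`: since `x` is not the limit, some `ε` is exceeded by `|x - z_m|` for arbitrarily late `m`,
-- and the Cauchy property at `ε / 2` keeps all late distances above `ε / 2`.
include hc hlim in
theorem isBaireOneGauge_dist : M.IsBaireOneGauge F := by
  rw [isCauchy_iff hz.2] at hc
  refine ⟨⟨hF.1, fun i => (hF.2 i).1, fun x hx => ⟨_, isValueSeq_dist hz hF hx, ?_⟩⟩,
    fun x hx => ⟨_, isValueSeq_dist hz hF hx, ?_⟩⟩
  · rw [isCauchy_iff fun i => (hx.1.2.sub (hz.2 i)).abs]
    intro ε hε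
    refine (hc ε hε).imp fun n₀ h m n hm hn => ?_
    rw [(hx.1.2.sub (hz.2 m)).val_abs, (hx.1.2.sub (hz.2 n)).val_abs, hx.1.2.val_sub (hz.2 m),
      hx.1.2.val_sub (hz.2 n)]
    refine (abs_abs_sub_abs_le_abs_sub _ _).trans ?_
    rw [sub_sub_sub_cancel_left]
    exact h n m hn hm
  · have h : ¬ ConvergesTo z x := fun h => hlim ⟨x, hx.1, h⟩
    rw [convergesTo_iff hz.2 hx.1.2] at h
    push Not at h
    obtain ⟨ε, hε, h⟩ := h
    obtain ⟨n₀, hn₀⟩ := hc (ε / 2) (half_pos hε)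
    obtain ⟨m, hm, hlt⟩ := h n₀
    obtain ⟨p, hp, e⟩ := exists_ratCode_lt (half_pos hε)
    refine ⟨p, hp, n₀, fun n hn => ?_⟩
    rw [(rapid_ofRat p).le_iff (hx.1.2.sub (hz.2 n)).abs, (hx.1.2.sub (hz.2 n)).val_abs,
      hx.1.2.val_sub (hz.2 n), val_ofRat, e]
    have h1 := hn₀ n m hn hm
    have h2 := abs_sub_le x.val (z n).val (z m).val
    have h3 : M.ofRational ε = M.ofRational (ε / 2) + M.ofRational (ε / 2) := by
      rw [← map_add, add_halves]
    linarith

end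

/-! ### Fine balls and the cut of a monotone sequence without limit -/

section

variable {z : M.Num → M.RealName} (hz : M.IsRealSeq z)
  (hmono : ∀ m n : M.Num, m ≤ n → (z m).val ≤ (z n).val)
  (hlim : ¬ ∃ x : M.RealName, x.IsReal ∧ ConvergesTo z x)

include hz hmono hlim

/-- If `x` were an upper bound of the sequence, it would be squeezed into being the limit. -/
theorem exists_lt_of_eventually_le {x : M.RealName} (hx : x.IsReal)
    (h : ∀ ε > 0, ∃ n₀, ∀ n, n₀ ≤ n → x.val ≤ (z n).val + M.ofRational ε) :
    ∃ n, x.val < (z n).val := by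
  by_contra! H
  refine hlim ⟨x, hx, (convergesTo_iff hz.2 hx.2).2 fun ε hε => (h ε hε).imp fun n₀ h n hn => ?_⟩
  rw [abs_of_nonneg (sub_nonneg.2 (H n))]
  linarith [h n hn]

variable {F : Set M.Num} (hF : M.CodesDistances z F)

include hF

/-- A ball that is fine for the gauge lies on one side of the missing limit. -/
theorem LeLim.alternative {p r : M.RealName} (hp : p.InUnit) (hr : r.IsReal)
    (h : M.LeLim r F p) :
    (∃ n, p.val + r.val < (z n).val) ∨ ∀ n, (z n).val ≤ p.val - r.val := by
  replace h := LeLim.le hz hF hr.2 hp h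
  by_cases hcase : ∃ n₁, p.val < (z n₁).val
  · left
    obtain ⟨n₁, hn₁⟩ := hcase
    rw [← hp.1.2.val_add hr.2]
    refine exists_lt_of_eventually_le hz hmono hlim (IsReal.add hp.1 hr) fun ε hε => ?_
    obtain ⟨n₀, h⟩ := h ε hε
    refine ⟨max n₀ n₁, fun n hn => ?_⟩
    -- Beyond `n₁` the distance is `z_n - p`, so fineness says that `p + r` is eventually at most
    -- `z_n + ε`.
    have h1 := h n ((le_max_left _ _).trans hn)
    have h2 := hmono n₁ n ((le_max_right _ _).trans hn)
    rw [abs_of_neg (by linarith)] at h1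
    rw [hp.1.2.val_add hr.2]
    linarith
  · right
    push Not at hcase
    intro n
    by_contra! hlt
    -- Above the cut the distances `p - z_n` are nonincreasing, so a bound on late distances bounds
    -- all of them; the slack `ε` of a violation is contradicted with tolerance `ε / 2`.
    obtain ⟨ε, hε, hle⟩ := Limits.exists_const_le (sub_pos.2 hlt)
    obtain ⟨n₀, h⟩ := h (ε / 2) (half_pos hε)
    have h1 := h (max n₀ n) (le_max_left _ _)
    rw [abs_of_nonneg (sub_nonneg.2 (hcase _))] at h1
    have h2 := hmono n (max n₀ n) (le_max_right _ _)
    have h3 : M.ofRational ε = M.ofRational (ε / 2) + M.ofRational (ε / 2) := by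
      rw [← map_add, add_halves]
    have h4 := ofRational_pos.2 (half_pos hε)
    linarith

omit hz hmono hlim hF in
/-- The points of a tagged partition belong to the unit interval. -/
theorem partition_bounds {k : M.Num} {x : M.Num → M.RealName} (hx : M.IsRealSeq x)
    (h0 : (x 0).val = 0) (h1 : (x k).val = 1) (h : ∀ i < k, (x i).val ≤ (x (i + 1)).val)
    {i : M.Num} (hi : i ≤ k) : 0 ≤ (x i).val ∧ (x i).val ≤ 1 := by
  constructor
  · by_contra! hneg
    -- Induction on the Π⁰₁ statement `0 ≤ x i` is replaced by the least index of the Σ⁰₁ statement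
    -- `x i < 0`.
    obtain ⟨j, ⟨hjk, hj⟩, hmin⟩ := Sig.exists_min (P := fun i => i ≤ k ∧ x i < 0)
      (.and (Del.le .v0 (.const _)).1 (.real_lt (.seq hx .v0) (.const (isReal_ofRat 0))
        (fun _ => hx.2 _) (fun _ => rapid_zero))) (a := i)
      ⟨hi, by rwa [(hx.2 i).lt_iff rapid_zero, val_zero]⟩
    rw [(hx.2 j).lt_iff rapid_zero, val_zero] at hj
    rcases eq_zero_or_succ j with rfl | ⟨j, rfl⟩
    · exact hj.ne h0
    · have hj' : j < k := succ_le_iff'.1 hjk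
      refine (lt_add_one_iff'.2 le_rfl).not_ge (hmin j ⟨hj'.le, ?_⟩)
      rw [(hx.2 j).lt_iff rapid_zero, val_zero]
      exact (h j hj').trans_lt hj
  · by_contra! hneg
    obtain ⟨j, ⟨hjk, hj⟩, hmax⟩ := Sig.exists_max (P := fun i => i ≤ k ∧ 1 < x i)
      (.and (Del.le .v0 (.const _)).1 (.real_lt (.const (isReal_ofRat 1)) (.seq hx .v0)
        (fun _ => rapid_one) (fun _ => hx.2 _))) (a := i) (b := k)
      ⟨hi, by rwa [rapid_one.lt_iff (hx.2 i), val_one]⟩ (fun n hn => hn.1)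
    rw [rapid_one.lt_iff (hx.2 j), val_one] at hj
    rcases hjk.eq_or_lt with rfl | hlt
    · exact hj.ne' h1
    · refine (lt_add_one_iff'.2 le_rfl).not_ge (hmax (j + 1) ⟨succ_le_iff'.2 hlt, ?_⟩)
      rw [rapid_one.lt_iff (hx.2 _), val_one]
      exact hj.trans_le (h j hlt)

/-- Being below the cut is the Σ⁰₁ property `∃ n, x i < z n`. It holds at `0`, passes from each
division point to the next since no fine interval crosses the cut, and fails at `1`. -/
theorem not_hasFinePartition (hu : ∀ n, (z n).InUnit) : ¬ M.HasFinePartition F := by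
  rintro ⟨k, x, ξ, hx, hξ, h0, h1, h⟩
  rw [(hx.2 0).equal_iff rapid_zero, val_zero] at h0
  rw [(hx.2 k).equal_iff rapid_one, val_one] at h1
  have hle : ∀ i < k, (x i).val ≤ (ξ i).val ∧ (ξ i).val ≤ (x (i + 1)).val := fun i hi => by
    rw [← (hx.2 i).le_iff (hξ.2 i), ← (hξ.2 i).le_iff (hx.2 (i + 1))]
    exact ⟨(h i hi).1, (h i hi).2.1⟩
  have hbd := fun i => partition_bounds hx h0 h1 (fun i hi => (hle i hi).1.trans (hle i hi).2) (i := i)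
  have key : ∀ i, k < i ∨ ∃ n, x i < z n := by
    refine Sig.induction (P := fun i => k < i ∨ ∃ n, x i < z n)
      (.or (Del.lt (.const _) .v0).1 (.ex (.real_lt (.seq hx .v1) (.seq hz .v0)
        (fun _ => hx.2 _) (fun _ => hz.2 _)))) (Or.inr ?_) (fun i ih => ?_)
    · simp only [(hx.2 0).lt_iff (hz.2 _)]
      -- All `z_n` are nonnegative and `x_0 = 0` is not their limit.
      refine exists_lt_of_eventually_le hz hmono hlim (hx.isReal 0) fun ε hε => ⟨0, fun n _ => ?_⟩
      have := (inUnit_iff.1 (hu n)).2.1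
      have := (ofRational_pos.2 hε).le
      linarith
    · rcases ih with ih | ⟨n, hn⟩
      · exact Or.inl (ih.trans (lt_add_one_iff'.2 le_rfl))
      rcases le_or_gt k i with hki | hki
      · exact Or.inl (lt_add_one_iff'.2 hki)
      right
      rw [(hx.2 i).lt_iff (hz.2 n)] at hn
      obtain ⟨h2, h3⟩ := hle i hki
      have hξu : (ξ i).InUnit := inUnit_iff.2 ⟨hξ.isReal i, (hbd i hki.le).1.trans h2,
        h3.trans (hbd _ (succ_le_iff'.2 hki)).2⟩
      have halt := LeLim.alternative hz hmono hlim hF hξu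
        (IsReal.sub (hx.isReal (i + 1)) (hx.isReal i)) (h i hki).2.2
      rw [(hx.2 _).val_sub (hx.2 _)] at halt
      -- In the first case `x_i ≤ ξ_i` gives `x_{i+1} ≤ ξ_i + (x_{i+1} - x_i) < z_m`. In the second,
      -- `ξ_i ≤ x_{i+1}` gives `z_n ≤ ξ_i - (x_{i+1} - x_i) ≤ x_i`, against the induction
      -- hypothesis.
      rcases halt with ⟨m, hm⟩ | hm
      · refine ⟨m, ?_⟩
        rw [(hx.2 _).lt_iff (hz.2 _)]
        linarith
      · linarith [hm n]
  rcases key k with hk | ⟨n, hn⟩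
  · exact lt_irrefl _ hk
  · rw [(hx.2 k).lt_iff (hz.2 n), h1] at hn
    exact hn.not_ge (inUnit_iff.1 (hu n)).2.2

/-- Which balls lie below the cut is only Σ⁰₁, hence the use of `strong_collection`: its bound `m`
makes `z m` exceed the right ends of all of them, while the balls above the cut contain no member of
the sequence. -/
theorem not_hasFineCover (hu : ∀ n, (z n).InUnit) : ¬ M.HasFineCover F := by
  rintro ⟨k, p, r, hp, hr, h, -, hcov⟩
  obtain ⟨m, hm⟩ := strong_collection (P := fun i n => p i + r i < z n)
    (.real_lt (.add (.seq hp .v0) (.seq hr .v0)) (.seq hz .v1)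
      (fun _ => (hp.2 _).add (hr.2 _)) (fun _ => hz.2 _)) k
  obtain ⟨i, hi, hlt⟩ := hcov (z m) (hu m)
  rw [Rapid.abs_sub_lt (hz.2 m) (hp.2 i) (hr.2 i), abs_lt] at hlt
  obtain ⟨hpi, -, hle⟩ := h i hi
  rcases LeLim.alternative hz hmono hlim hF hpi (hr.isReal i) hle with ⟨n, hn⟩ | hn
  · obtain ⟨n', hn', hlt'⟩ := hm i hi ⟨n, by
      rwa [((hp.2 i).add (hr.2 i)).lt_iff (hz.2 n), (hp.2 i).val_add (hr.2 i)]⟩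
    rw [((hp.2 i).add (hr.2 i)).lt_iff (hz.2 n'), (hp.2 i).val_add (hr.2 i)] at hlt'
    have := hmono n' m hn'.le
    linarith
  · have := hn m
    linarith

end

end L2Structure

namespace L2Structure

variable {M : L2Structure.{u}} [hM : Fact M.IsRCA0]

open RealName

/-! ## Comprehension from limits of monotone sequences -/

theorem two_add (j i : M.Num) : M.two (j + i) = M.two j * M.two i := by
  refine Sig.induction (P := fun i => M.two (j + i) = M.two j * M.two i)
    (Del.eq (.map₁ fn_two (.add (.const _) .v0)) (.mul (.const _) (.map₁ fn_two .v0))).1 ?_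
    (fun i ih => ?_) i
  · rw [add_zero, two_zero, mul_one]
  · rw [← add_assoc, two_succ, two_succ, ih, mul_add]

/-! ### Binary fractions with increasing sets of digits -/

section

variable {T : M.Num → M.Num → Prop} {s : M.Num → M.Num → M.Num}

variable (T s) in
/-- `s m j` is the number with binary digits `T m 0, ..., T m (j - 1)`. -/
structure IsDigitSum : Prop where
  fn : Fn M (fun v : M.Num × M.Num × PUnit.{u+1} => s v.1 v.2.1)
  zero : ∀ m, s m 0 = 0
  succ_of : ∀ m j, T m j → s m (j + 1) = s m j + s m j + 1
  succ_of_not : ∀ m j, ¬ T m j → s m (j + 1) = s m j + s m j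
  mono : ∀ m m' j, m ≤ m' → T m j → T m' j

theorem exists_isDigitSum (hT : Del M (fun v : M.Num × M.Num × PUnit.{u+1} => T v.1 v.2.1))
    (hmono : ∀ m m' j, m ≤ m' → T m j → T m' j) : ∃ s, IsDigitSum T s := by
  classical
  obtain ⟨s, hs, h0, h1⟩ := exists_rec (g := fun _ : M.Num => 0)
    (G := fun m j v => v + v + if T m j then 1 else 0) (.const _)
    (.add (.add .v2 .v2) (.ite (.map₂ hT .v0 .v1) (.const _) (.const _)))
  exact ⟨s, hs, h0, fun m j h => by simp [h1, h], fun m j h => by simp [h1, h], hmono⟩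

namespace IsDigitSum

variable (h : IsDigitSum T s)

include h

theorem fn_comp {α : Type u} [Ctx M α] {f g : α → M.Num} (hf : Fn M f) (hg : Fn M g) :
    Fn M (fun v => s (f v) (g v)) := .map₂ h.fn hf hg

theorem double_le (m j : M.Num) : s m j + s m j ≤ s m (j + 1) := by
  by_cases hT : T m j
  · rw [h.succ_of _ _ hT]; exact le_self_add
  · rw [h.succ_of_not _ _ hT]

theorem le_double (m j : M.Num) : s m (j + 1) ≤ s m j + s m j + 1 := by
  by_cases hT : T m j
  · rw [h.succ_of _ _ hT]
  · rw [h.succ_of_not _ _ hT]; exact le_self_add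

theorem mul_two_le (m j i : M.Num) : s m j * M.two i ≤ s m (j + i) := by
  refine Sig.induction (P := fun i => s m j * M.two i ≤ s m (j + i))
    (Del.le (.mul (.const _) (.map₁ fn_two .v0))
      (h.fn_comp (.const _) (.add (.const _) .v0))).1 ?_ (fun i ih => ?_) i
  · rw [two_zero, mul_one, add_zero]
  · rw [two_succ, mul_add, ← add_assoc]
    exact (add_le_add ih ih).trans (h.double_le _ _)

theorem add_one_le_mul_two (m j i : M.Num) : s m (j + i) + 1 ≤ (s m j + 1) * M.two i := by
  refine Sig.induction (P := fun i => s m (j + i) + 1 ≤ (s m j + 1) * M.two i)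
    (Del.le (.add (h.fn_comp (.const _) (.add (.const _) .v0)) (.const _))
      (.mul (.const _) (.map₁ fn_two .v0))).1 ?_ (fun i ih => ?_) i
  · rw [two_zero, mul_one, add_zero]
  · rw [two_succ, mul_add, ← add_assoc]
    refine le_trans ?_ (add_le_add ih ih)
    rw [add_add_add_comm, ← add_assoc]
    exact add_le_add_left (h.le_double _ _) _

theorem le_of_le {m m' : M.Num} (hm : m ≤ m') (j : M.Num) : s m j ≤ s m' j := by
  refine Sig.induction (P := fun j => s m j ≤ s m' j)
    (Del.le (h.fn_comp (.const _) .v0) (h.fn_comp (.const _) .v0)).1 ?_ (fun j ih => ?_) j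
  · rw [h.zero, h.zero]
  · by_cases hT : T m j
    · rw [h.succ_of _ _ hT, h.succ_of _ _ (h.mono _ _ _ hm hT)]
      gcongr
    · rw [h.succ_of_not _ _ hT]
      exact (add_le_add ih ih).trans (h.double_le _ _)

theorem eq_of_agree {m m' k : M.Num} (hm : ∀ l < k, T m l ↔ T m' l) : s m k = s m' k := by
  have key : ∀ j, j ≤ k → s m j = s m' j := by
    refine Sig.induction (P := fun j => j ≤ k → s m j = s m' j) (Del.imp (.le .v0 (.const _))
      (.eq (h.fn_comp (.const _) .v0) (h.fn_comp (.const _) .v0))).1 (fun _ => ?_) (fun j ih hj => ?_)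
    · rw [h.zero, h.zero]
    · have hj := succ_le_iff'.1 hj
      by_cases hT : T m j
      · rw [h.succ_of _ _ hT, h.succ_of _ _ ((hm j hj).1 hT), ih hj.le]
      · rw [h.succ_of_not _ _ hT, h.succ_of_not _ _ (fun hT' => hT ((hm j hj).2 hT')), ih hj.le]
  exact key k le_rfl

/-- The new digit `n` gives a lead of at least `1` after `n + 1` digits. Each further digit doubles
the lead and cannot reduce it otherwise, since the digits at `m` are among those at `m'`. -/
theorem gap {m m' n : M.Num} (hm : m ≤ m') (hn : T m' n) (hn' : ¬ T m n) (i : M.Num) :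
    s m (n + 1 + i) + M.two i ≤ s m' (n + 1 + i) := by
  refine Sig.induction (P := fun i => s m (n + 1 + i) + M.two i ≤ s m' (n + 1 + i))
    (Del.le (.add (h.fn_comp (.const _) (.add (.const _) .v0)) (.map₁ fn_two .v0))
      (h.fn_comp (.const _) (.add (.const _) .v0))).1 ?_ (fun i ih => ?_) i
  · rw [two_zero, add_zero, h.succ_of _ _ hn, h.succ_of_not _ _ hn']
    have := h.le_of_le hm n
    gcongr
  · rw [two_succ, ← add_assoc (n + 1) i 1]
    by_cases hT : T m (n + 1 + i)
    · rw [h.succ_of _ _ hT, h.succ_of _ _ (h.mono _ _ _ hm hT)]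
      calc _ = (s m (n + 1 + i) + M.two i) + (s m (n + 1 + i) + M.two i) + 1 := by ring
        _ ≤ _ := by gcongr
    · rw [h.succ_of_not _ _ hT, add_add_add_comm]
      exact (add_le_add ih ih).trans (h.double_le _ _)

variable (s) in
omit h in
/-- The binary fraction with digits `T m 0, ..., T m (j - 1)`. -/
noncomputable def frac (m j : M.Num) : M.Rational := ofNum (s m j) * half j

omit h in
theorem half_add (j i : M.Num) : half (j + i) * ofNum (M.two i) = half j := by
  have h1 := (ofNum_pos (two_pos j)).ne'
  have h2 := (ofNum_pos (two_pos i)).ne'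
  rw [half, half, two_add, map_mul]
  field_simp

theorem frac_mono (m : M.Num) {j l : M.Num} (hjl : j ≤ l) : frac s m j ≤ frac s m l := by
  obtain ⟨i, rfl⟩ := le_iff_exists_add'.1 hjl
  have h1 := ofNum_le.2 (h.mul_two_le m j i)
  have h2 := half_pos' (j + i)
  rw [frac, frac, ← half_add j i]
  rw [map_mul] at h1
  calc _ = ofNum (s m j) * ofNum (M.two i) * half (j + i) := by ring
    _ ≤ _ := mul_le_mul_of_nonneg_right h1 h2.le

/-- The digits from position `j` on contribute at most `2 ^ (-j)`. -/
theorem frac_le_add (m : M.Num) {j l : M.Num} (hjl : j ≤ l) :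
    frac s m l ≤ frac s m j + half j := by
  obtain ⟨i, rfl⟩ := le_iff_exists_add'.1 hjl
  have h1 := ofNum_le.2 ((le_self_add).trans (h.add_one_le_mul_two m j i))
  have h2 := half_pos' (j + i)
  rw [frac, frac, ← half_add j i]
  rw [map_mul, map_add, map_one] at h1
  calc _ ≤ (ofNum (s m j) + 1) * ofNum (M.two i) * half (j + i) :=
        mul_le_mul_of_nonneg_right h1 h2.le
    _ = _ := by ring

theorem frac_le_of_le {m m' : M.Num} (hm : m ≤ m') (j : M.Num) : frac s m j ≤ frac s m' j :=
  mul_le_mul_of_nonneg_right (ofNum_le.2 (h.le_of_le hm j)) (half_pos' j).le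

theorem frac_gap {m m' n j : M.Num} (hm : m ≤ m') (hn : T m' n) (hn' : ¬ T m n) (hj : n + 1 ≤ j) :
    frac s m j + half (n + 1) ≤ frac s m' j := by
  obtain ⟨i, rfl⟩ := le_iff_exists_add'.1 hj
  have h1 := ofNum_le.2 (h.gap hm hn hn' i)
  rw [map_add] at h1
  rw [frac, frac, ← half_add (n + 1) i]
  calc _ = (ofNum (s m (n + 1 + i)) + ofNum (M.two i)) * half (n + 1 + i) := by ring
    _ ≤ _ := mul_le_mul_of_nonneg_right h1 (half_pos' _).le

theorem frac_nonneg (m j : M.Num) : 0 ≤ frac s m j :=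
  mul_nonneg (ofNum_nonneg _) (half_pos' j).le

theorem frac_le_one (m j : M.Num) : frac s m j ≤ 1 := by
  have := h.frac_le_add m (zero_le (a := j))
  have e : frac s m 0 = 0 := by rw [frac, h.zero, map_zero, zero_mul]
  rwa [e, zero_add, half_zero] at this

theorem diag_mono {m m' : M.Num} (hm : m ≤ m') : frac s m m ≤ frac s m' m' :=
  (h.frac_mono m hm).trans (h.frac_le_of_le hm m')

variable (s) in
omit h in
/-- The sequence of the binary fractions as real numbers. -/
noncomputable def seq (m : M.Num) : M.RealName := ofRat ⟨s m m, 0, M.predTwo m⟩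

omit h in
theorem val_seq (m : M.Num) : (seq s m).val = M.ofRational (frac s m m) := by
  rw [seq, val_ofRat]
  congr 1
  rw [RatCode.toRat, frac, map_zero, sub_zero, half, ← predTwo_add_one, map_add, map_one,
    mul_one_div]

theorem isRealSeq_seq : M.IsRealSeq (seq s) :=
  isRealSeq_iff.2 ⟨⟨h.fn_comp .v1 .v1, .const _, .map₁ fn_predTwo .v1⟩, fun _ => rapid_ofRat _⟩

theorem inUnit_seq (m : M.Num) : (seq s m).InUnit := by
  rw [inUnit_iff, val_seq]
  refine ⟨h.isRealSeq_seq.isReal m, ?_, ?_⟩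
  · rw [← map_zero M.ofRational, ofRational_le]; exact h.frac_nonneg m m
  · rw [← map_one M.ofRational, ofRational_le]; exact h.frac_le_one m m

theorem val_seq_mono {m m' : M.Num} (hm : m ≤ m') : (seq s m).val ≤ (seq s m').val := by
  rw [val_seq, val_seq, ofRational_le]; exact h.diag_mono hm

/-- By `strong_collection` the first `k` digits are final from some stage on, and later members
differ by at most `2 ^ (-k)`. No rate is claimed, as the stage is not computed from `k`. -/
theorem isCauchy_seq (hT : Sig M (fun v : M.Num × M.Num × PUnit.{u+1} => T v.2.1 v.1)) :
    IsCauchy (seq s) := by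
  rw [isCauchy_iff h.isRealSeq_seq.2]
  intro ε hε
  obtain ⟨k, hk⟩ := exists_half_lt hε
  obtain ⟨b, hb⟩ := strong_collection (P := fun l m => T m l) hT k
  have hagree : ∀ m, max b k ≤ m → ∀ l < k, T (max b k) l ↔ T m l := fun m hm l hl => by
    refine ⟨h.mono _ _ _ hm, fun hT => ?_⟩
    obtain ⟨m', hm', hT'⟩ := hb l hl ⟨m, hT⟩
    exact h.mono _ _ _ (hm'.le.trans (le_max_left _ _)) hT'
  have hclose : ∀ m, max b k ≤ m → frac s (max b k) k ≤ frac s m m ∧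
      frac s m m ≤ frac s (max b k) k + half k := fun m hm => by
    have hkm := (le_max_right b k).trans hm
    have e : frac s (max b k) k = frac s m k := by
      rw [frac, frac, h.eq_of_agree (hagree m hm)]
    rw [e]
    exact ⟨h.frac_mono m hkm, h.frac_le_add m hkm⟩
  -- The maximum with `k` ensures that `seq s m` displays at least `k` digits.
  refine ⟨max b k, fun m n hm hn => ?_⟩
  rw [val_seq, val_seq, ← map_sub, ← ofRational_abs, ofRational_le, abs_le]
  have h1 := hclose m hm
  have h2 := hclose n hn
  constructor <;> linarith

/-- The digits can be computed from the limit. -/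
theorem del_exists (hT : Del M (fun v : M.Num × M.Num × PUnit.{u+1} => T v.1 v.2.1))
    {x : M.RealName} (hx : x.IsReal) (hconv : ConvergesTo (seq s) x) :
    Del M (fun v : M.Num × PUnit.{u+1} => ∃ m, T m v.1) := by
  rw [convergesTo_iff h.isRealSeq_seq.2 hx.2] at hconv
  have hle : ∀ m, (seq s m).val ≤ x.val := fun m => by
    by_contra! hlt
    obtain ⟨ε, hε, hle⟩ := Limits.exists_const_le (sub_pos.2 hlt)
    obtain ⟨n₀, hn₀⟩ := hconv (ε / 2) (half_pos hε)
    have h1 := (abs_le.1 (hn₀ (max n₀ m) (le_max_left _ _))).1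
    have h2 := h.val_seq_mono (le_max_right n₀ m)
    have h3 := ofRational_lt.2 (half_lt_self hε)
    linarith
  have hex : ∀ n, ∃ m, x.val < (seq s m).val + M.ofRational (half (n + 1)) := fun n => by
    obtain ⟨n₀, hn₀⟩ := hconv (half (n + 1 + 1)) (half_pos' _)
    refine ⟨n₀, ?_⟩
    have h1 := (abs_le.1 (hn₀ n₀ le_rfl)).2
    have h2 := ofRational_pos.2 (half_pos' (n + 1 + 1))
    rw [half_succ (n + 1), map_add]
    linarith
  -- Closeness to the limit settles digit `n`: were it to appear after stage `m`, the sequence would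
  -- grow by at least `2 ^ (-(n+1))` and overtake `x`.
  have hkey : ∀ n m, x.val < (seq s m).val + M.ofRational (half (n + 1)) →
      ((∃ m, T m n) ↔ T m n) := fun n m hm => by
    refine ⟨fun ⟨m₁, h₁⟩ => ?_, fun h => ⟨m, h⟩⟩
    by_contra hn
    -- A stage after both `m` and `m₁`, with enough displayed digits to include digit `n`.
    set m' := max (max m m₁) (n + 1) with hm'
    have hmm' : m ≤ m' := (le_max_left _ _).trans (le_max_left _ _)
    have h1 := h.frac_gap hmm' (h.mono _ _ _ ((le_max_right _ _).trans (le_max_left _ _)) h₁) hn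
      (le_max_right _ _ : n + 1 ≤ m')
    have h2 := h.frac_mono m hmm'
    have h3 := hle m'
    rw [val_seq] at hm h3
    have h4 : M.ofRational (frac s m m) + M.ofRational (half (n + 1)) ≤
        M.ofRational (frac s m' m') := by
      rw [← map_add, ofRational_le]
      linarith
    linarith
  have hr : ∀ (m n : M.Num), (seq s m + ofRat (RatCode.inv (M.predTwo (n + 1)))).val =
      (seq s m).val + M.ofRational (half (n + 1)) := fun m n => by
    rw [(h.isRealSeq_seq.2 m).val_add (rapid_ofRat _), val_ofRat, inv_predTwo]
  have hS : Sig M (fun v : M.Num × M.Num × PUnit.{u+1} =>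
      x < seq s v.1 + ofRat (RatCode.inv (M.predTwo (v.2.1 + 1)))) := by
    refine .real_lt (.const hx) (.add (.seq h.isRealSeq_seq .v0) ?_) (fun _ => hx.2)
      (fun _ => (rapid_ofRat _).add (rapid_ofRat _))
    exact RFn.inv (.map₁ fn_predTwo (.add .v2 (.const _)))
  have hS' : ∀ m n, x < seq s m + ofRat (RatCode.inv (M.predTwo (n + 1))) ↔
      x.val < (seq s m).val + M.ofRational (half (n + 1)) := fun m n => by
    rw [hx.2.lt_iff ((h.isRealSeq_seq.2 m).add (rapid_ofRat _)), hr]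
  constructor
  · exact Sig.ex hT.1
  -- The complement is Σ⁰₁: search for a stage close enough to `x` at which the digit is absent.
  · have hS'' : Sig M (fun v : M.Num × PUnit.{u+1} =>
        ∃ m, x < seq s m + ofRat (RatCode.inv (M.predTwo (v.1 + 1))) ∧ ¬ T m v.1) :=
      Sig.ex (hS.and hT.2)
    refine hS''.of_iff fun v => ?_
    simp only [hS']
    constructor
    · intro hn
      obtain ⟨m, hm⟩ := hex v.1
      exact ⟨m, hm, fun h => hn ⟨m, h⟩⟩
    · rintro ⟨m, hm, hn⟩
      rwa [hkey _ _ hm]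

end IsDigitSum

end

/-- Convergence of monotone Cauchy sequences gives comprehension for `Sig` predicates. -/
theorem sig_comprehension_of_limits
    (H : ∀ z : M.Num → M.RealName, M.IsRealSeq z → (∀ n, (z n).InUnit) →
      (∀ m n, m ≤ n → (z m).val ≤ (z n).val) → IsCauchy z →
      ∃ x : M.RealName, x.IsReal ∧ ConvergesTo z x)
    {P : M.Num → Prop} (hP : Sig M (fun v : M.Num × PUnit.{u+1} => P v.1)) :
    {n | P n} ∈ M.sets := by
  obtain ⟨Q, hQ, hPQ⟩ := hP
  have hT : Del M (fun v : M.Num × M.Num × PUnit.{u+1} => ∃ a < v.1, Q (a, v.2.1, ⟨⟩)) := by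
    refine .bex (hQ.del.comp (.cons coord_fst (.cons (coord_snd (coord_snd coord_fst)) .nil))) .v0
  -- Stage `m` looks for witnesses below `m`, so digits only appear and `P n` means that digit `n`
  -- appears at some stage.
  obtain ⟨s, hs⟩ := exists_isDigitSum (T := fun m n => ∃ a < m, Q (a, n, ⟨⟩)) hT
    (fun m m' j hm ⟨a, ha, h⟩ => ⟨a, ha.trans_le hm, h⟩)
  obtain ⟨x, hx, hconv⟩ := H _ hs.isRealSeq_seq hs.inUnit_seq (fun _ _ => hs.val_seq_mono)
    (hs.isCauchy_seq (hT.1.comp (.cons (coord_snd coord_fst) (.cons coord_fst .nil))))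
  refine comprehension ((hs.del_exists hT hx hconv).of_iff fun v => ?_)
  refine (hPQ v).trans ⟨?_, ?_⟩
  · rintro ⟨a, h⟩
    exact ⟨a + 1, a, lt_add_one_iff'.2 le_rfl, h⟩
  · rintro ⟨m, a, -, h⟩
    exact ⟨a, h⟩

end L2Structure

namespace L2Structure

variable {M : L2Structure.{u}} [hM : Fact M.IsRCA0] {α β : Type u} [Ctx M α] [Ctx M β]

/-! ## Arithmetical comprehension -/

theorem Fn.val {f : ℕ → α → M.Num} (hf : ∀ i, Fn M (f i)) (t : L2Term) :
    Fn M (fun v => M.val (fun i => f i v) t) := by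
  induction t with
  | var i => exact hf i
  | zero => exact .const 0
  | one => exact .const 1
  | add s t hs ht => exact hs.add ht
  | mul s t hs ht => exact hs.mul ht

theorem push_eq (a : M.Num) (f : ℕ → α → M.Num) (v : α) :
    push a (fun i => f i v) =
      fun i => push (Prod.fst : M.Num × α → M.Num) (fun i => f i ∘ Prod.snd) i (a, v) := by
  funext i; cases i <;> rfl

/-- Recursive functions may be substituted in a bounded formula. -/
theorem Del.sat (V : ℕ → M.sets) (θ : L2Formula) (hθ : θ.IsBounded) :
    ∀ {α : Type u} [Ctx M α] {f : ℕ → α → M.Num}, (∀ i, Fn M (f i)) →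
      Del M (fun v => M.Sat V θ (fun i => f i v)) := by
  have hpush : ∀ {α : Type u} [Ctx M α] {f : ℕ → α → M.Num}, (∀ i, Fn M (f i)) →
      ∀ i, Fn M (push (Prod.fst : M.Num × α → M.Num) (fun i => f i ∘ Prod.snd) i) := by
    intro α _ f hf i
    cases i with
    | zero => exact .v0
    | succ i => exact (hf i).snd
  induction θ with
  | eq s t => intro _ _ _ hf; exact .eq (.val hf s) (.val hf t)
  | lt s t => intro _ _ _ hf; exact .lt (.val hf s) (.val hf t)
  | mem t X => intro _ _ _ hf; exact .mem (V X).2 (.val hf t)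
  | neg φ ih => intro _ _ _ hf; exact (ih hθ hf).not
  | and φ ψ ih ih' => intro _ _ _ hf; exact (ih hθ.1 hf).and (ih' hθ.2 hf)
  | or φ ψ ih ih' => intro _ _ _ hf; exact (ih hθ.1 hf).or (ih' hθ.2 hf)
  | ballLT t φ ih =>
    intro _ _ f hf
    refine Del.ball (P := fun a v => M.Sat V φ (push a (fun i => f i v))) ?_ (.val hf t)
    simp only [push_eq]
    exact ih hθ (hpush hf)
  | bexLT t φ ih =>
    intro _ _ f hf
    refine Del.bex (P := fun a v => M.Sat V φ (push a (fun i => f i v))) ?_ (.val hf t)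
    simp only [push_eq]
    exact ih hθ (hpush hf)
  | all φ => exact hθ.elim
  | ex φ => exact hθ.elim

theorem exists_val_bound (t : L2Term) : ∃ N : ℕ, ∀ e e' : ℕ → M.Num, (∀ i < N, e i = e' i) →
    M.val e t = M.val e' t := by
  induction t with
  | var i => exact ⟨i + 1, fun e e' h => h i (Nat.lt_succ_self i)⟩
  | zero => exact ⟨0, fun e e' h => rfl⟩
  | one => exact ⟨0, fun e e' h => rfl⟩
  | add s t hs ht =>
    obtain ⟨N, hN⟩ := hs
    obtain ⟨N', hN'⟩ := ht
    refine ⟨max N N', fun e e' h => ?_⟩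
    rw [val, val, hN e e' fun i hi => h i (lt_max_of_lt_left hi),
      hN' e e' fun i hi => h i (lt_max_of_lt_right hi)]
  | mul s t hs ht =>
    obtain ⟨N, hN⟩ := hs
    obtain ⟨N', hN'⟩ := ht
    refine ⟨max N N', fun e e' h => ?_⟩
    rw [val, val, hN e e' fun i hi => h i (lt_max_of_lt_left hi),
      hN' e e' fun i hi => h i (lt_max_of_lt_right hi)]

theorem push_agree {N : ℕ} {e e' : ℕ → M.Num} (h : ∀ i < N, e i = e' i) (a : M.Num) :
    ∀ i < N + 1, push a e i = push a e' i := by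
  intro i hi
  cases i with
  | zero => rfl
  | succ i => exact h i (Nat.lt_of_succ_lt_succ hi)

/-- The truth of a formula depends on finitely many variables. -/
theorem exists_sat_bound (V : ℕ → M.sets) (φ : L2Formula) : ∃ N : ℕ, ∀ e e' : ℕ → M.Num,
    (∀ i < N, e i = e' i) → (M.Sat V φ e ↔ M.Sat V φ e') := by
  have mono : ∀ {N N' : ℕ} {e e' : ℕ → M.Num}, N ≤ N' → (∀ i < N', e i = e' i) →
    ∀ i < N, e i = e' i := fun hN h i hi => h i (hi.trans_le hN)
  induction φ with
  | eq s t =>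
    obtain ⟨N, hN⟩ := exists_val_bound (M := M) s
    obtain ⟨N', hN'⟩ := exists_val_bound (M := M) t
    refine ⟨max N N', fun e e' h => ?_⟩
    rw [Sat, Sat, hN e e' (mono (le_max_left _ _) h), hN' e e' (mono (le_max_right _ _) h)]
  | lt s t =>
    obtain ⟨N, hN⟩ := exists_val_bound (M := M) s
    obtain ⟨N', hN'⟩ := exists_val_bound (M := M) t
    refine ⟨max N N', fun e e' h => ?_⟩
    rw [Sat, Sat, hN e e' (mono (le_max_left _ _) h), hN' e e' (mono (le_max_right _ _) h)]
  | mem t X =>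
    obtain ⟨N, hN⟩ := exists_val_bound (M := M) t
    exact ⟨N, fun e e' h => by rw [Sat, Sat, hN e e' h]⟩
  | neg φ ih =>
    obtain ⟨N, hN⟩ := ih
    exact ⟨N, fun e e' h => by rw [Sat, Sat, hN e e' h]⟩
  | and φ ψ ih ih' =>
    obtain ⟨N, hN⟩ := ih
    obtain ⟨N', hN'⟩ := ih'
    refine ⟨max N N', fun e e' h => ?_⟩
    rw [Sat, Sat, hN e e' (mono (le_max_left _ _) h), hN' e e' (mono (le_max_right _ _) h)]
  | or φ ψ ih ih' =>
    obtain ⟨N, hN⟩ := ih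
    obtain ⟨N', hN'⟩ := ih'
    refine ⟨max N N', fun e e' h => ?_⟩
    rw [Sat, Sat, hN e e' (mono (le_max_left _ _) h), hN' e e' (mono (le_max_right _ _) h)]
  | ballLT t φ ih =>
    obtain ⟨N, hN⟩ := ih
    obtain ⟨N', hN'⟩ := exists_val_bound (M := M) t
    refine ⟨max N N', fun e e' h => ?_⟩
    rw [Sat, Sat, hN' e e' (mono (le_max_right _ _) h)]
    exact forall₂_congr fun a _ => hN _ _ (mono (by omega) (push_agree h a))
  | bexLT t φ ih =>
    obtain ⟨N, hN⟩ := ih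
    obtain ⟨N', hN'⟩ := exists_val_bound (M := M) t
    refine ⟨max N N', fun e e' h => ?_⟩
    rw [Sat, Sat, hN' e e' (mono (le_max_right _ _) h)]
    exact exists_congr fun a => and_congr_right fun _ => hN _ _ (mono (by omega) (push_agree h a))
  | all φ ih =>
    obtain ⟨N, hN⟩ := ih
    exact ⟨N, fun e e' h => forall_congr' fun a => hN _ _ (mono (by omega) (push_agree h a))⟩
  | ex φ ih =>
    obtain ⟨N, hN⟩ := ih
    exact ⟨N, fun e e' h => exists_congr fun a => hN _ _ (mono (by omega) (push_agree h a))⟩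

/-- A code of the first `N` values of an assignment. -/
def encode (e : ℕ → M.Num) : ℕ → M.Num
  | 0 => 0
  | N + 1 => M.pair (encode e N) (e N)

/-- The assignment with a given code of its first `N` values. -/
noncomputable def decode : ℕ → M.Num → ℕ → M.Num
  | 0, _, _ => 0
  | N + 1, m, i => if i = N then (unpair m).2 else decode N (unpair m).1 i

theorem decode_encode (e : ℕ → M.Num) (N : ℕ) : ∀ i < N, decode N (encode e N) i = e i := by
  induction N with
  | zero => intro i hi; exact (Nat.not_lt_zero i hi).elim
  | succ N ih =>
    intro i hi
    rw [encode, decode, unpair_pair]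
    split_ifs with h
    · rw [h]
    · exact ih i (by omega)

theorem Tm.encode {c : ℕ → α → M.Num} (hc : ∀ i, Tm M (c i)) (N : ℕ) :
    Tm M (fun v => encode (fun i => c i v) N) := by
  induction N with
  | zero => exact .const 0
  | succ N ih => exact ih.pair (hc N)

theorem Fn.decode (N : ℕ) (i : ℕ) :
    ∀ {f : α → M.Num}, Fn M f → Fn M (fun v => decode N (f v) i) := by
  induction N with
  | zero => exact fun _ => .const 0
  | succ N ih =>
    intro f hf
    by_cases h : i = N
    · simpa [L2Structure.decode, h] using hf.unpair_snd
    · simpa [L2Structure.decode, h] using ih hf.unpair_fst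

/-! ### Elimination of unbounded quantifiers -/

section

variable (H : ∀ P : M.Num → Prop, Sig M (fun v : M.Num × PUnit.{u+1} => P v.1) → {n | P n} ∈ M.sets)

include H

/-- Only finitely many variables matter, so they can be packed into one number `m`, and Σ⁰₁
comprehension gives the set of those `m` for which a witness exists. The existential statement
becomes the atomic formula "the packed variables belong to this set", because packing is a term. -/
theorem Bdd.ex_of_sig_comprehension {P : M.Num → α → Prop}
    (hP : Bdd M (fun p : M.Num × α => P p.1 p.2)) : Bdd M (fun v => ∃ a, P a v) := by
  obtain ⟨V, c, θ, hc, hθ, h⟩ := hP.unbind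
  obtain ⟨N, hN⟩ := exists_sat_bound V θ
  have hX := H (fun m => ∃ a, M.Sat V θ (push a (decode N m))) (.ex (by
    have : ∀ (a m : M.Num), push a (decode N m) = fun i =>
        push (Prod.fst : M.Num × M.Num × PUnit.{u+1} → M.Num) (fun i v => decode N v.2.1 i) i
          (a, m, ⟨⟩) := by
      intro a m; funext i; cases i <;> rfl
    simp only [this]
    refine (Del.sat V θ hθ (fun i => ?_)).1
    cases i with
    | zero => exact .v0
    | succ i => exact .decode N i .v1))
  refine (Bdd.mem hX (Tm.encode (fun i => Tm.coord (hc i)) N)).of_iff fun v => ?_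
  refine exists_congr fun a => (h a v).trans (hN _ _ ?_)
  intro i hi
  exact push_agree (fun i hi => (decode_encode (fun i => c i v) N i hi).symm) a i (by omega)

/-- Induction on `φ`: each unbounded quantifier is traded for a new set parameter, so every
arithmetical formula is equivalent in `M` to a bounded one. -/
theorem Bdd.sat_of_sig_comprehension (V : ℕ → M.sets) (φ : L2Formula) :
    Bdd M (fun e : ℕ → M.Num => M.Sat V φ e) := by
  have hval : ∀ t, Tm M (fun e : ℕ → M.Num => M.val e t) := fun t =>
    ⟨fun i e => e i, t, fun i => Or.inl ⟨i, rfl⟩, fun _ => rfl⟩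
  have hpush : CMap M (fun p : M.Num × (ℕ → M.Num) => push p.1 p.2) := by
    rintro f (⟨i, rfl⟩ | ⟨a, rfl⟩)
    · cases i with
      | zero => exact Or.inl rfl
      | succ i => exact Or.inr ⟨fun e => e i, Or.inl ⟨i, rfl⟩, rfl⟩
    · exact Ctx.const_mem a
  induction φ with
  | eq s t => exact .eq (hval s) (hval t)
  | lt s t => exact .lt (hval s) (hval t)
  | mem t X => exact .mem (V X).2 (hval t)
  | neg φ ih => exact ih.not
  | and φ ψ ih ih' => exact ih.and ih'
  | or φ ψ ih ih' => exact ih.or ih'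
  | ballLT t φ ih => exact Bdd.ballLT (hval t) (ih.comp hpush)
  | bexLT t φ ih => exact Bdd.bexLT (hval t) (ih.comp hpush)
  | all φ ih =>
    refine (Bdd.ex_of_sig_comprehension H (P := fun a e => ¬ M.Sat V φ (push a e))
      (ih.comp hpush).not).not.of_iff fun e => ?_
    simp [Sat]
  | ex φ ih =>
    exact Bdd.ex_of_sig_comprehension H (P := fun a e => M.Sat V φ (push a e)) (ih.comp hpush)

theorem isACA0_of_sig_comprehension : M.IsACA0 where
  basic := hM.out.basic
  set_induction X hX h0 hs := Sig.induction (P := fun n => n ∈ X) (Del.mem hX .v0).1 h0 hs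
  arith_comprehension φ V e := by
    refine comprehension (P := fun n => M.Sat V φ (push n e))
      ((Bdd.sat_of_sig_comprehension H V φ).comp (g := fun v : M.Num × PUnit.{u+1} => push v.1 e) ?_).del
    rintro f (⟨i, rfl⟩ | ⟨a, rfl⟩)
    · cases i with
      | zero => exact Or.inl rfl
      | succ i => exact Ctx.const_mem (e i)
    · exact Ctx.const_mem a

end

end L2Structure

/-- Over `RCA₀`, that is, in every model of `RCA₀`: Cousin's lemma for Baire class 1 functions implies
`ACA₀`. Moreover, if a nondecreasing Cauchy sequence `z` in the unit interval has no limit, then the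
functions `x ↦ |x - z_n|` have a sequence of codes, and each such sequence is a code for a Baire
class 1 gauge without a fine tagged partition. -/
theorem mainTheorem3 (M : L2Structure.{u}) (hM : M.IsRCA0) :
    (M.CousinBaireOne → M.IsACA0) ∧
    ∀ z : M.Num → M.RealName, M.IsRealSeq z → (∀ n : M.Num, (z n).InUnit) →
      (∀ m n : M.Num, m ≤ n → z m ≤ z n) → L2Structure.IsCauchy z →
      (¬ ∃ x : M.RealName, x.IsReal ∧ L2Structure.ConvergesTo z x) →
      (∃ F : Set M.Num, M.CodesDistances z F) ∧
      ∀ F : Set M.Num, M.CodesDistances z F → M.IsBaireOneGauge F ∧ ¬ M.HasFinePartition F := by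
  have : Fact M.IsRCA0 := ⟨hM⟩
  refine ⟨fun hcousin => L2Structure.isACA0_of_sig_comprehension fun P hP => L2Structure.sig_comprehension_of_limits
    (fun z hz hu hmono hc => ?_) hP, fun z hz hu hmono hc hlim => ⟨L2Structure.exists_codesDistances hz,
    fun F hF => ⟨L2Structure.isBaireOneGauge_dist hz hF hc hlim, L2Structure.not_hasFinePartition hz
      (fun m n h => ((hz.2 m).le_iff (hz.2 n)).1 (hmono m n h)) hlim hF hu⟩⟩⟩
  by_contra hlim
  obtain ⟨F, hF⟩ := L2Structure.exists_codesDistances hz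
  exact L2Structure.not_hasFineCover hz hmono hlim hF hu (hcousin F (L2Structure.isBaireOneGauge_dist hz hF hc hlim))
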